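/- **Theorem 1.3.** Let $M$ be a structure with domain $\mathbb N$ in a countable relational language $L$, let $G=\mathrm{Aut}(M)\le \mathrm{Sym}(\mathbb N)$ be its automorphism group (a closed subgroup of $\mathrm{Sym}(\mathbb N)$ for the topology of pointwise convergence), and suppose that $G$ is oligomorphic, i.e. for each $n$ the action of $G$ on $\mathbb N^n$ has only finitely many orbits. Let $T=\mathrm{Th}(M)$. Then: (i) $\mathcal B(T)$ is a totally disconnected, locally compact topological group; (ii) $\mathcal B(T)$ is topologically isomorphic to $\mathrm{Out}(G)=\mathrm{Aut}(G)/\mathrm{Inn}(G)$. In particular, $\mathrm{Out}(G)$ is a totally disconnected, locally compact topological group. Here the following notions are used. *Aut and Out.* $\mathrm{Aut}(G)$ is the group of all automorphisms $\Phi$ of $G$ such that $\Phi$ and $\Phi^{-1}$ are continuous. It carries the topology for which the subgroups $\{\Phi : \Phi(A_1)=A_1,\dots,\Phi(A_n)=A_n\}$, with $A_1,\dots,A_n$ cosets of open subgroups of $G$, form a basis of neighbourhoods of the identity. $\mathrm{Inn}(G)$ is the subgroup of inner automorphisms, and $\mathrm{Out}(G)$ carries the quotient topology. *Interpretations.* A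 self-interpretation $\alpha$ of $T$ consists of a dimension $k\ge 1$, an $L$-formula $\varphi_D(\bar x)$ and an $L$-formula $\varphi_E(\bar x,\bar y)$ in $k$-tuples of variables, and for each $n$-ary relation symbol $R$ of $L$ an $L$-formula $\alpha.R(\bar x_1,\dots,\bar x_n)$ in $n$ many $k$-tuples of variables. It is required that $T$ proves that $\varphi_D$ defines a nonempty set $D$, that $\varphi_E$ defines an equivalence relation $E$ on $D$, and that each $\alpha.R$ defines an $E$-invariant relation on $D$; and that $T\vdash\alpha.\psi$ for every $\psi\in T$. Here $\alpha.\psi$ is obtained from $\psi$ by replacing variables by $k$-tuples of variables, each relation symbol $R$ by $\alpha.R$, equality by $\varphi_E$, and each quantifier by $k$ quantifiers relativized to $\varphi_D$. Interpretations are composed by translating formulas: $(\beta\circ\alpha).R=\alpha.(\beta.R)$, and similarly for $\varphi_D$ and $\varphi_E$, with the variable tuples restricted to $D_\alpha$. The identity $1_T$ is the interpretation with $k=1$, $\varphi_D$ the formula $x=x$, $\varphi_E$ equality, and each $R$ assigned to itself. *Homotopy.* For self-interpretations $\alpha_0,\alpha_1$ of $T$ with sorts $D_0/E_0$, $D_1/E_1$,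 write $\alpha_0\approx_T\alpha_1$ if there is an $L$-formula of which $T$ proves that it defines a bijection $\Theta\colon D_0/E_0\to D_1/E_1$ with $\Theta^n(\alpha_0.R)=\alpha_1.R$ for each $n$-ary relation symbol $R$ of $L$. *The group $\mathcal B(T)$.* Regard formulas as equal if they are equivalent under $T$, and topologize the set of self-interpretations of $T$ by taking as basic open sets those given by prescribing $k,\varphi_D,\varphi_E$ and the formulas $\alpha.R$ for finitely many relation symbols $R$. Let $\mathrm{Mor}(T,T)$ be the monoid of self-interpretations modulo $\approx_T$ under composition, with the quotient topology. Then $\mathcal B(T)$ is its group of invertible elements, with the topology that makes $u\mapsto(u,u^{-1})$ a homeomorphism onto its image in $\mathrm{Mor}(T,T)\times\mathrm{Mor}(T,T)$. -/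

import Mathlib

namespace OligoOut

open FirstOrder FirstOrder.Language

/-! ## Permutation groups of the natural numbers -/

/-- The topology of pointwise convergence on the group of permutations of `ℕ`. -/
instance permTopology : TopologicalSpace (Equiv.Perm ℕ) :=
  TopologicalSpace.induced (fun g : Equiv.Perm ℕ => (g : ℕ → ℕ)) inferInstance

/-- A closed subgroup of `Sym(ℕ)` is oligomorphic if for each `n` its diagonal action on `ℕ ^ n`
has only finitely many orbits. -/
def IsOligomorphic (G : Subgroup (Equiv.Perm ℕ)) : Prop :=
  IsClosed (G : Set (Equiv.Perm ℕ)) ∧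
    ∀ n : ℕ, Finite (MulAction.orbitRel.Quotient G (Fin n → ℕ))

/-- The automorphism group of a structure with domain `ℕ`, as a group of permutations. -/
def autGroup (L : FirstOrder.Language.{0, 0}) [L.Structure ℕ] : Subgroup (Equiv.Perm ℕ) where
  carrier := {g | ∃ f : ℕ ≃[L] ℕ, ∀ x, f x = g x}
  mul_mem' := by
    rintro a b ⟨f, hf⟩ ⟨f', hf'⟩
    exact ⟨f.comp f', fun x => by simp [FirstOrder.Language.Equiv.comp_apply, hf, hf']⟩
  one_mem' := ⟨FirstOrder.Language.Equiv.refl L ℕ, fun x => by simp⟩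
  inv_mem' := by
    rintro a ⟨f, hf⟩
    refine ⟨f.symm, fun x => ?_⟩
    apply f.injective
    rw [FirstOrder.Language.Equiv.apply_symm_apply, hf]
    simp

/-! ## The topological groups `Aut(G)` and `Out(G)` -/

section Aut

variable (G : Type) [Group G] [TopologicalSpace G]

/-- `Aut(G)`: the group of automorphisms of `G` that are continuous in both directions. -/
def ContAut : Subgroup (MulAut G) where
  carrier := {φ | Continuous (φ : G → G) ∧ Continuous (φ.symm : G → G)}
  mul_mem' := by
    rintro a b ⟨h1, h2⟩ ⟨h3, h4⟩
    exact ⟨h1.comp h3, h4.comp h2⟩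
  one_mem' := ⟨continuous_id, continuous_id⟩
  inv_mem' := by
    rintro a ⟨h1, h2⟩
    exact ⟨h2, h1⟩

variable {G} in
/-- `A` is a left coset of an open subgroup of `G`. (Every right coset is one as well.) -/
def IsOpenCoset (A : Set G) : Prop :=
  ∃ (U : OpenSubgroup G) (a : G), A = (fun u => a * u) '' (U : Set G)

/-- The topology on `Aut(G)` coming from its action on the set of cosets of open subgroups of `G`,
that is, the topology of pointwise convergence for that action. The groups
`{Φ | Φ(A₁) = A₁, …, Φ(Aₙ) = Aₙ}`, where the `Aᵢ` are cosets of open subgroups, form a basis of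
neighbourhoods of the identity. -/
instance contAutTopology : TopologicalSpace (ContAut G) :=
  TopologicalSpace.generateFrom
    {W | ∃ A B : Set G, IsOpenCoset A ∧ IsOpenCoset B ∧
      W = {Φ : ContAut G | (Φ : MulAut G) '' A = B}}

/-- `Inn(G)`: the inner automorphisms, as a subgroup of `Aut(G)`. -/
def Inn : Subgroup (ContAut G) :=
  (MulAut.conj : G →* MulAut G).range.subgroupOf (ContAut G)

instance inn_normal : (Inn G).Normal := by
  constructor
  intro n hn g
  rw [Inn, Subgroup.mem_subgroupOf] at hn ⊢
  obtain ⟨x, hx⟩ := hn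
  refine ⟨(g : MulAut G) x, ?_⟩
  ext y
  have : (n : MulAut G) = MulAut.conj x := hx.symm
  simp [this, MulAut.mul_apply]

/-- `Out(G) = Aut(G) / Inn(G)`, with the quotient topology. -/
abbrev Out : Type := ContAut G ⧸ Inn G

end Aut

/-! ## Syntactic interpretations -/

section Interp

variable {L L' L'' L''' : FirstOrder.Language.{0, 0}}

/-- The variable that a term of a relational language is. -/
def termVar [L'.IsRelational] {V : Type} : L'.Term V → V
  | .var v => v
  | .func f _ => isEmptyElim f

/-- The data of an interpretation of the language `L'` in the language `L`: a dimension `k ≥ 1`,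
formulas `φ_D` and `φ_E`, and for each `n`-ary relation symbol `R` of `L'` a formula `α.R` in `n`
many `k`-tuples of variables. The variable `(i, j)` is the `j`-th component of the `i`-th tuple. -/
structure PreInterp (L L' : FirstOrder.Language.{0, 0}) where
  /-- The dimension. -/
  dim : ℕ
  one_le_dim : 1 ≤ dim
  /-- The formula `φ_D`. -/
  dom : L.Formula (Fin dim)
  /-- The formula `φ_E`. -/
  eqv : L.Formula (Fin dim ⊕ Fin dim)
  /-- The formulas `α.R`. -/
  rel : ∀ {n : ℕ}, L'.Relations n → L.Formula (Fin n × Fin dim)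

namespace PreInterp

/-- Bookkeeping of variables for the quantifier step: the tuple of the last bound variable is
singled out. -/
def shift {V : Type} {n k : ℕ} : (V ⊕ Fin (n + 1)) × Fin k → ((V ⊕ Fin n) × Fin k) ⊕ Fin k
  | (Sum.inl v, j) => Sum.inl (Sum.inl v, j)
  | (Sum.inr i, j) => Fin.lastCases (motive := fun _ => ((V ⊕ Fin n) × Fin k) ⊕ Fin k)
      (Sum.inr j) (fun i' => Sum.inl (Sum.inr i', j)) i

/-- The translation `φ ↦ α.φ`, each variable being replaced by a `k`-tuple of variables:
relation symbols `R` are replaced by `α.R`, equality is replaced by `φ_E`, and a quantifier over `x`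
is replaced by `k` quantifiers, relativized to `φ_D`. (The connective `imp`, `falsum` and the
universal quantifier are the primitive ones here.) -/
noncomputable def translate [L'.IsRelational] (α : PreInterp L L') {V : Type} :
    ∀ {n : ℕ}, L'.BoundedFormula V n → L.Formula ((V ⊕ Fin n) × Fin α.dim)
  | _, .falsum => ⊥
  | _, .equal t₁ t₂ =>
      α.eqv.relabel (Sum.elim (fun j => (termVar t₁, j)) (fun j => (termVar t₂, j)))
  | _, .rel R ts => (α.rel R).relabel (fun p => (termVar (ts p.1), p.2))
  | _, .imp φ ψ => (α.translate φ).imp (α.translate ψ)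
  | _, .all φ =>
      Formula.iAlls (Fin α.dim) ((α.dom.relabel Sum.inr).imp ((α.translate φ).relabel shift))

/-- The translation of formulas with free variables in `V`. -/
noncomputable def translateFormula [L'.IsRelational] (α : PreInterp L L') {V : Type}
    (φ : L'.Formula V) : L.Formula (V × Fin α.dim) :=
  (α.translate φ).relabel (fun p => (Sum.elim id (fun i => Fin.elim0 i) p.1, p.2))

/-- The translation of sentences. -/
noncomputable def translateSentence [L'.IsRelational] (α : PreInterp L L')
    (φ : L'.Sentence) : L.Sentence :=
  (α.translateFormula φ).relabel (fun p => p.1)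

/-- The requirements on an interpretation of the theory `U` in the theory `T`. The clauses up to
`rel_congr` hold in all models of `T`, in other words, `T` proves them: `D` is nonempty, `E` is an
equivalence relation on `D`, and `α.R` is an `E`-invariant relation on `D`. -/
structure IsInterp [L'.IsRelational] (α : PreInterp L L') (T : L.Theory) (U : L'.Theory) :
    Prop where
  dom_nonempty : ∀ A : Theory.ModelType.{0, 0, 0} T, ∃ x : Fin α.dim → A, α.dom.Realize x
  eqv_dom : ∀ (A : Theory.ModelType.{0, 0, 0} T) (x y : Fin α.dim → A),
    α.eqv.Realize (Sum.elim x y) → α.dom.Realize x ∧ α.dom.Realize y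
  eqv_refl : ∀ (A : Theory.ModelType.{0, 0, 0} T) (x : Fin α.dim → A),
    α.dom.Realize x → α.eqv.Realize (Sum.elim x x)
  eqv_symm : ∀ (A : Theory.ModelType.{0, 0, 0} T) (x y : Fin α.dim → A),
    α.eqv.Realize (Sum.elim x y) → α.eqv.Realize (Sum.elim y x)
  eqv_trans : ∀ (A : Theory.ModelType.{0, 0, 0} T) (x y z : Fin α.dim → A),
    α.eqv.Realize (Sum.elim x y) → α.eqv.Realize (Sum.elim y z) → α.eqv.Realize (Sum.elim x z)
  rel_dom : ∀ (A : Theory.ModelType.{0, 0, 0} T) {n : ℕ} (R : L'.Relations n)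
    (x : Fin n × Fin α.dim → A), (α.rel R).Realize x → ∀ i, α.dom.Realize (fun j => x (i, j))
  rel_congr : ∀ (A : Theory.ModelType.{0, 0, 0} T) {n : ℕ} (R : L'.Relations n)
    (x y : Fin n × Fin α.dim → A),
    (∀ i, α.eqv.Realize (Sum.elim (fun j => x (i, j)) (fun j => y (i, j)))) →
    (α.rel R).Realize x → (α.rel R).Realize y
  /-- `T` proves the translation of each sentence of `U`. -/
  translate_mem : ∀ ψ ∈ U, T ⊨ᵇ α.translateSentence ψ

/-- `α.φ`, together with the requirement that all tuples of free variables lie in `D`. -/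
noncomputable def guarded [L'.IsRelational] (α : PreInterp L L') {V : Type} [Finite V]
    (φ : L'.Formula V) : L.Formula (V × Fin α.dim) :=
  α.translateFormula φ ⊓ Formula.iInf (fun v : V => α.dom.relabel (fun j => (v, j)))

/-- The composition `β ∘ α` (first `α`, then `β`): each formula of `β` is translated by `α`, and
a `(k_β * k_α)`-tuple is regarded as a `k_β`-tuple of `k_α`-tuples. -/
noncomputable def comp [L'.IsRelational] (β : PreInterp L' L'') (α : PreInterp L L') :
    PreInterp L L'' where
  dim := β.dim * α.dim
  one_le_dim := Nat.mul_pos β.one_le_dim α.one_le_dim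
  dom := (α.guarded β.dom).relabel finProdFinEquiv
  eqv := (α.guarded β.eqv).relabel (fun p => Sum.map (fun i => finProdFinEquiv (i, p.2))
    (fun i => finProdFinEquiv (i, p.2)) p.1)
  rel R := (α.guarded (β.rel R)).relabel (fun p => (p.1.1, finProdFinEquiv (p.1.2, p.2)))

/-- The trivial interpretation of `L` in itself. -/
def one (L : FirstOrder.Language.{0, 0}) : PreInterp L L where
  dim := 1
  one_le_dim := le_refl 1
  dom := ⊤
  eqv := Term.equal (Term.var (Sum.inl 0)) (Term.var (Sum.inr 0))
  rel R := R.formula (fun i => Term.var (i, 0))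

/-! ### Coordinate maps (auxiliary) -/

/-- `r x a` says that the tuple `x` represents the element `a` of the `L'`-structure `N` via a
coordinate map for `α` in the `L`-structure `A`. -/
structure IsCoord (α : PreInterp L L') (A : Type) [L.Structure A] (N : Type) [L'.Structure N]
    (r : (Fin α.dim → A) → N → Prop) : Prop where
  func : ∀ x a b, r x a → r x b → a = b
  surj : ∀ a, ∃ x, r x a
  dom_iff : ∀ x, α.dom.Realize x ↔ ∃ a, r x a
  eqv_iff : ∀ x y, α.eqv.Realize (Sum.elim x y) ↔ ∃ a, r x a ∧ r y a
  rel_iff : ∀ {n : ℕ} (R : L'.Relations n) (x : Fin n × Fin α.dim → A),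
    (α.rel R).Realize x ↔
      ∃ a : Fin n → N, (∀ i, r (fun j => x (i, j)) (a i)) ∧ Structure.RelMap R a

theorem realize_termVar [L'.IsRelational] {V N : Type} [L'.Structure N] (t : L'.Term V)
    (v : V → N) : t.realize v = v (termVar t) := by
  cases t with
  | var _ => rfl
  | func f _ => exact isEmptyElim f

section Coord

variable {α : PreInterp L L'} {A : Type} [L.Structure A] {N : Type} [L'.Structure N]
  {r : (Fin α.dim → A) → N → Prop}

theorem IsCoord.eqv_iff' (h : α.IsCoord A N r) {x y a b} (hx : r x a) (hy : r y b) :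
    α.eqv.Realize (Sum.elim x y) ↔ a = b := by
  rw [h.eqv_iff]
  constructor
  · rintro ⟨c, h1, h2⟩
    rw [h.func _ _ _ hx h1, h.func _ _ _ hy h2]
  · rintro rfl
    exact ⟨a, hx, hy⟩

theorem IsCoord.rel_iff' (h : α.IsCoord A N r) {n : ℕ} (R : L'.Relations n)
    {x : Fin n × Fin α.dim → A} {a : Fin n → N} (hx : ∀ i, r (fun j => x (i, j)) (a i)) :
    (α.rel R).Realize x ↔ Structure.RelMap R a := by
  rw [h.rel_iff]
  constructor
  · rintro ⟨b, h1, h2⟩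
    have : a = b := funext fun i => h.func _ _ _ (hx i) (h1 i)
    rwa [this]
  · intro h2
    exact ⟨a, hx, h2⟩

theorem IsCoord.realize_translate [L'.IsRelational] (h : α.IsCoord A N r) {V : Type} {n : ℕ}
    (φ : L'.BoundedFormula V n) (x : (V ⊕ Fin n) × Fin α.dim → A) (a : V → N) (b : Fin n → N)
    (hx : ∀ w, r (fun j => x (w, j)) (Sum.elim a b w)) :
    (α.translate φ).Realize x ↔ φ.Realize a b := by
  induction φ with
  | falsum => exact Iff.rfl
  | equal t₁ t₂ =>
    rw [translate, Formula.realize_relabel]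
    have : (x ∘ Sum.elim (fun j => (termVar t₁, j)) (fun j => (termVar t₂, j)))
      = Sum.elim (fun j => x (termVar t₁, j)) (fun j => x (termVar t₂, j)) := by
      funext s; cases s <;> rfl
    rw [this, h.eqv_iff' (hx _) (hx _)]
    simp only [BoundedFormula.Realize, realize_termVar]
  | rel R ts =>
    rw [translate, Formula.realize_relabel,
      h.rel_iff' R (a := fun i => Sum.elim a b (termVar (ts i))) (fun i => hx (termVar (ts i)))]
    simp only [BoundedFormula.Realize, realize_termVar]
  | imp φ ψ ih1 ih2 =>
    rw [translate, Formula.realize_imp, BoundedFormula.realize_imp, ih1 _ _ hx, ih2 _ _ hx]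
  | all φ ih =>
    rw [translate, Formula.realize_iAlls, BoundedFormula.realize_all]
    have key : ∀ (y : Fin α.dim → A) (c : N), r y c →
        (((α.translate φ).relabel shift).Realize (fun s => Sum.elim x y s) ↔
          φ.Realize a (Fin.snoc b c)) := by
      intro y c hy
      rw [Formula.realize_relabel]
      apply ih
      rintro (v | i)
      · exact hx (Sum.inl v)
      · refine Fin.lastCases ?_ (fun i' => ?_) i
        · simpa [shift] using hy
        · simpa [shift] using hx (Sum.inr i')
    constructor
    · intro H c
      obtain ⟨y, hy⟩ := h.surj c
      refine (key y c hy).1 ?_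
      have := H y
      rw [Formula.realize_imp, Formula.realize_relabel] at this
      exact this ((h.dom_iff _).2 ⟨c, hy⟩)
    · intro H y
      rw [Formula.realize_imp, Formula.realize_relabel]
      intro hy
      obtain ⟨c, hc⟩ := (h.dom_iff _).1 hy
      exact (key y c hc).2 (H c)

theorem IsCoord.realize_translateFormula [L'.IsRelational] (h : α.IsCoord A N r) {V : Type}
    (φ : L'.Formula V) (x : V × Fin α.dim → A) (a : V → N)
    (hx : ∀ w, r (fun j => x (w, j)) (a w)) :
    (α.translateFormula φ).Realize x ↔ φ.Realize a := by
  rw [translateFormula, Formula.realize_relabel]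
  apply h.realize_translate
  rintro (v | i)
  · exact hx v
  · exact Fin.elim0 i

theorem IsCoord.realize_translateSentence [L'.IsRelational] (h : α.IsCoord A N r)
    (φ : L'.Sentence) : A ⊨ α.translateSentence φ ↔ N ⊨ φ := by
  rw [Sentence.Realize, translateSentence, Formula.realize_relabel]
  exact h.realize_translateFormula _ _ _ (fun w => isEmptyElim w)

theorem IsCoord.realize_guarded [L'.IsRelational] (h : α.IsCoord A N r) {V : Type} [Finite V]
    (φ : L'.Formula V) (x : V × Fin α.dim → A) :
    (α.guarded φ).Realize x ↔
      ∃ a : V → N, (∀ w, r (fun j => x (w, j)) (a w)) ∧ φ.Realize a := by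
  rw [guarded, Formula.realize_inf, Formula.realize_iInf]
  constructor
  · rintro ⟨h1, h2⟩
    have : ∀ w, ∃ a, r (fun j => x (w, j)) a := by
      intro w
      have := h2 w
      rw [Formula.realize_relabel] at this
      exact (h.dom_iff _).1 this
    choose a ha using this
    exact ⟨a, ha, (h.realize_translateFormula φ x a ha).1 h1⟩
  · rintro ⟨a, ha, h1⟩
    refine ⟨(h.realize_translateFormula φ x a ha).2 h1, fun w => ?_⟩
    rw [Formula.realize_relabel]
    exact (h.dom_iff _).2 ⟨a w, ha w⟩

/-- Composition of coordinate maps. -/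
def compRel {β : PreInterp L' L''} {P : Type} (r : (Fin α.dim → A) → N → Prop)
    (s : (Fin β.dim → N) → P → Prop) (x : Fin (β.dim * α.dim) → A) (c : P) : Prop :=
  ∃ b : Fin β.dim → N, (∀ i, r (fun j => x (finProdFinEquiv (i, j))) (b i)) ∧ s b c

theorem IsCoord.comp [L'.IsRelational] (h : α.IsCoord A N r) {β : PreInterp L' L''}
    {P : Type} [L''.Structure P] {s : (Fin β.dim → N) → P → Prop} (h' : β.IsCoord N P s) :
    (β.comp α).IsCoord A P (compRel r s) where
  func := by
    rintro x c d ⟨b, h1, h2⟩ ⟨b', h3, h4⟩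
    have : b = b' := funext fun i => h.func _ _ _ (h1 i) (h3 i)
    subst this
    exact h'.func _ _ _ h2 h4
  surj := by
    intro c
    obtain ⟨b, hb⟩ := h'.surj c
    choose y hy using fun i => h.surj (b i)
    refine ⟨fun l => y (finProdFinEquiv.symm l).1 (finProdFinEquiv.symm l).2, b, fun i => ?_, hb⟩
    simpa using hy i
  dom_iff := by
    intro x
    refine (Formula.realize_relabel.trans (h.realize_guarded _ _)).trans ?_
    constructor
    · rintro ⟨a, h1, h2⟩
      obtain ⟨c, hc⟩ := (h'.dom_iff _).1 h2
      exact ⟨c, a, h1, hc⟩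
    · rintro ⟨c, a, h1, hc⟩
      exact ⟨a, h1, (h'.dom_iff _).2 ⟨c, hc⟩⟩
  eqv_iff := by
    intro x y
    refine (Formula.realize_relabel.trans (h.realize_guarded _ _)).trans ?_
    constructor
    · rintro ⟨a, h1, h2⟩
      have e : a = Sum.elim (fun i => a (Sum.inl i)) (fun i => a (Sum.inr i)) := by
        funext s; cases s <;> rfl
      rw [e] at h2
      obtain ⟨c, hc1, hc2⟩ := (h'.eqv_iff _ _).1 h2
      exact ⟨c, ⟨_, fun i => h1 (Sum.inl i), hc1⟩, ⟨_, fun i => h1 (Sum.inr i), hc2⟩⟩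
    · rintro ⟨c, ⟨a, h1, hc⟩, ⟨a', h1', hc'⟩⟩
      refine ⟨Sum.elim a a', ?_, (h'.eqv_iff _ _).2 ⟨c, hc, hc'⟩⟩
      rintro (i | i)
      · exact h1 i
      · exact h1' i
  rel_iff := by
    intro n R x
    refine (Formula.realize_relabel.trans (h.realize_guarded _ _)).trans ?_
    constructor
    · rintro ⟨a, h1, h2⟩
      obtain ⟨c, hc1, hc2⟩ := (h'.rel_iff _ _).1 h2
      exact ⟨c, fun i => ⟨_, fun i' => h1 (i, i'), hc1 i⟩, hc2⟩
    · rintro ⟨c, hc1, hc2⟩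
      choose b hb1 hb2 using hc1
      exact ⟨fun p => b p.1 p.2, fun p => hb1 p.1 p.2, (h'.rel_iff _ _).2 ⟨c, hb2, hc2⟩⟩

theorem isCoord_id (A : Type) [L.Structure A] :
    (PreInterp.one L).IsCoord A A (fun x a => x (0 : Fin 1) = a) where
  func := by rintro x a b rfl rfl; rfl
  surj a := ⟨fun _ => a, rfl⟩
  dom_iff x := ⟨fun _ => ⟨_, rfl⟩, fun _ => Formula.realize_top.2 trivial⟩
  eqv_iff x y := by
    refine Formula.realize_equal.trans ?_
    change x (0 : Fin 1) = y (0 : Fin 1) ↔ _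
    constructor
    · intro h; exact ⟨_, h, rfl⟩
    · rintro ⟨a, h1, h2⟩; exact h1.trans h2.symm
  rel_iff R x := by
    refine Formula.realize_rel.trans ?_
    change Structure.RelMap R (fun i => x (i, (0 : Fin 1))) ↔ _
    constructor
    · intro h; exact ⟨_, fun i => rfl, h⟩
    · rintro ⟨a, h1, h2⟩
      have : a = fun i => x (i, (0 : Fin 1)) := funext fun i => (h1 i).symm
      rwa [this] at h2

theorem IsCoord.congr {N' : Type} [L'.Structure N'] (h : α.IsCoord A N r) (e : N ≃[L'] N') :
    α.IsCoord A N' (fun x a => ∃ b, r x b ∧ e b = a) where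
  func := by
    rintro x a b ⟨c, h1, rfl⟩ ⟨d, h2, rfl⟩
    rw [h.func _ _ _ h1 h2]
  surj a := by
    obtain ⟨x, hx⟩ := h.surj (e.symm a)
    exact ⟨x, _, hx, by simp⟩
  dom_iff x := by
    rw [h.dom_iff]
    exact ⟨fun ⟨a, ha⟩ => ⟨e a, a, ha, rfl⟩, fun ⟨_, a, ha, _⟩ => ⟨a, ha⟩⟩
  eqv_iff x y := by
    rw [h.eqv_iff]
    constructor
    · rintro ⟨a, h1, h2⟩; exact ⟨e a, ⟨a, h1, rfl⟩, ⟨a, h2, rfl⟩⟩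
    · rintro ⟨_, ⟨a, h1, rfl⟩, ⟨b, h2, h3⟩⟩
      rw [e.injective h3] at h2
      exact ⟨a, h1, h2⟩
  rel_iff R x := by
    rw [h.rel_iff]
    constructor
    · rintro ⟨a, h1, h2⟩
      exact ⟨e ∘ a, fun i => ⟨_, h1 i, rfl⟩, (e.map_rel R a).2 h2⟩
    · rintro ⟨a, h1, h2⟩
      choose b hb1 hb2 using h1
      obtain rfl : e ∘ b = a := funext hb2
      exact ⟨b, hb1, (e.map_rel R b).1 h2⟩

end Coord

/-- If in each model of `T` there is a coordinate map onto a model of `U`, then `α` is an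
interpretation of `U` in `T`. -/
theorem isInterp_of_isCoord [L'.IsRelational] {α : PreInterp L L'} {T : L.Theory}
    {U : L'.Theory}
    (H : ∀ A : Theory.ModelType.{0, 0, 0} T, ∃ (N : Theory.ModelType.{0, 0, 0} U)
      (r : (Fin α.dim → A) → N → Prop), α.IsCoord A N r) : α.IsInterp T U where
  dom_nonempty A := by
    obtain ⟨N, r, h⟩ := H A
    obtain ⟨a⟩ := N.nonempty'
    obtain ⟨x, hx⟩ := h.surj a
    exact ⟨x, (h.dom_iff x).2 ⟨a, hx⟩⟩
  eqv_dom A x y hxy := by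
    obtain ⟨N, r, h⟩ := H A
    obtain ⟨a, h1, h2⟩ := (h.eqv_iff _ _).1 hxy
    exact ⟨(h.dom_iff _).2 ⟨a, h1⟩, (h.dom_iff _).2 ⟨a, h2⟩⟩
  eqv_refl A x hx := by
    obtain ⟨N, r, h⟩ := H A
    obtain ⟨a, h1⟩ := (h.dom_iff _).1 hx
    exact (h.eqv_iff _ _).2 ⟨a, h1, h1⟩
  eqv_symm A x y hxy := by
    obtain ⟨N, r, h⟩ := H A
    obtain ⟨a, h1, h2⟩ := (h.eqv_iff _ _).1 hxy
    exact (h.eqv_iff _ _).2 ⟨a, h2, h1⟩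
  eqv_trans A x y z hxy hyz := by
    obtain ⟨N, r, h⟩ := H A
    obtain ⟨a, h1, h2⟩ := (h.eqv_iff _ _).1 hxy
    obtain ⟨b, h3, h4⟩ := (h.eqv_iff _ _).1 hyz
    obtain rfl := h.func _ _ _ h2 h3
    exact (h.eqv_iff _ _).2 ⟨a, h1, h4⟩
  rel_dom A n R x hx i := by
    obtain ⟨N, r, h⟩ := H A
    obtain ⟨a, h1, h2⟩ := (h.rel_iff _ _).1 hx
    exact (h.dom_iff _).2 ⟨a i, h1 i⟩
  rel_congr A n R x y hxy hx := by
    obtain ⟨N, r, h⟩ := H A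
    obtain ⟨a, h1, h2⟩ := (h.rel_iff _ _).1 hx
    refine (h.rel_iff _ _).2 ⟨a, fun i => ?_, h2⟩
    obtain ⟨b, h3, h4⟩ := (h.eqv_iff _ _).1 (hxy i)
    obtain rfl := h.func _ _ _ h3 (h1 i)
    exact h4
  translate_mem ψ hψ := by
    rw [Theory.models_sentence_iff]
    intro A
    obtain ⟨N, r, h⟩ := H A
    exact (h.realize_translateSentence ψ).2 (Theory.realize_sentence_of_mem U hψ)

end PreInterp

/-- An interpretation `α : T ⇝ U` of the theory `U` in the theory `T`. -/
structure Interpretation [L'.IsRelational] (T : L.Theory) (U : L'.Theory)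
    extends PreInterp L L' where
  isInterp : toPreInterp.IsInterp T U

namespace Interpretation

section Basic

variable [L'.IsRelational] {T : L.Theory} {U : L'.Theory}

/-- In a model `A` of `T`, the equivalence relation defined by `φ_E` on the set defined by
`φ_D`. -/
def setoid (α : Interpretation T U) (A : Theory.ModelType.{0, 0, 0} T) :
    Setoid {x : Fin α.dim → A // α.dom.Realize x} where
  r x y := α.eqv.Realize (Sum.elim x.1 y.1)
  iseqv :=
    ⟨fun x => α.isInterp.eqv_refl A x.1 x.2, fun h => α.isInterp.eqv_symm A _ _ h,
      fun h h' => α.isInterp.eqv_trans A _ _ _ h h'⟩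

/-- The sort `D/E` of `α` in a model `A` of `T`. -/
def Obj (α : Interpretation T U) (A : Theory.ModelType.{0, 0, 0} T) : Type :=
  Quotient (α.setoid A)

/-- The element of `D/E` given by an element of `D`. -/
def proj (α : Interpretation T U) (A : Theory.ModelType.{0, 0, 0} T) (x : Fin α.dim → A)
    (hx : α.dom.Realize x) : α.Obj A :=
  Quotient.mk (α.setoid A) ⟨x, hx⟩

/-- `D/E` as an `L'`-structure: the relation symbol `R` denotes the relation defined by `α.R`. -/
instance objStructure (α : Interpretation T U) (A : Theory.ModelType.{0, 0, 0} T) :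
    L'.Structure (α.Obj A) where
  funMap f := isEmptyElim f
  RelMap {n} R q := ∃ (x : Fin n × Fin α.dim → A) (hx : ∀ i, α.dom.Realize (fun j => x (i, j))),
    (∀ i, α.proj A (fun j => x (i, j)) (hx i) = q i) ∧ (α.rel R).Realize x

/-- The relation "the tuple `x` represents the element `a` of `D/E`". -/
def Rep (α : Interpretation T U) (A : Theory.ModelType.{0, 0, 0} T) (x : Fin α.dim → A)
    (a : α.Obj A) : Prop :=
  ∃ hx : α.dom.Realize x, α.proj A x hx = a

theorem isCoord_rep (α : Interpretation T U) (A : Theory.ModelType.{0, 0, 0} T) :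
    α.IsCoord A (α.Obj A) (α.Rep A) where
  func := by rintro x a b ⟨h, rfl⟩ ⟨h', rfl⟩; rfl
  surj a := by
    obtain ⟨⟨x, hx⟩, rfl⟩ := Quotient.exists_rep a
    exact ⟨x, hx, rfl⟩
  dom_iff x := ⟨fun h => ⟨_, h, rfl⟩, fun ⟨_, h, _⟩ => h⟩
  eqv_iff x y := by
    constructor
    · intro h
      obtain ⟨h1, h2⟩ := α.isInterp.eqv_dom A x y h
      exact ⟨α.proj A x h1, ⟨h1, rfl⟩, ⟨h2, (Quotient.sound (s := α.setoid A) h).symm⟩⟩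
    · rintro ⟨_, ⟨h1, rfl⟩, ⟨h2, h3⟩⟩
      exact Quotient.exact (s := α.setoid A) h3.symm
  rel_iff R x := by
    constructor
    · intro h
      have hx := α.isInterp.rel_dom A R x h
      exact ⟨fun i => α.proj A _ (hx i), fun i => ⟨hx i, rfl⟩, x, hx, fun i => rfl, h⟩
    · rintro ⟨a, h1, y, hy, h2, h3⟩
      refine α.isInterp.rel_congr A R y x (fun i => ?_) h3
      obtain ⟨h4, h5⟩ := h1 i
      exact Quotient.exact (s := α.setoid A) ((h2 i).trans h5.symm)

instance obj_nonempty (α : Interpretation T U) (A : Theory.ModelType.{0, 0, 0} T) :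
    Nonempty (α.Obj A) := by
  obtain ⟨x, hx⟩ := α.isInterp.dom_nonempty A
  exact ⟨α.proj A x hx⟩

instance obj_model (α : Interpretation T U) (A : Theory.ModelType.{0, 0, 0} T) :
    (α.Obj A) ⊨ U := by
  rw [Theory.model_iff]
  intro ψ hψ
  exact ((α.isCoord_rep A).realize_translateSentence ψ).1
    (Theory.models_sentence_iff.1 (α.isInterp.translate_mem ψ hψ) A)

/-- The model of `U` that `α` yields from a model of `T`. -/
def objModel (α : Interpretation T U) (A : Theory.ModelType.{0, 0, 0} T) :
    Theory.ModelType.{0, 0, 0} U :=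
  Theory.ModelType.of U (α.Obj A)

/-- The formula `φ_Θ` defines in each model of `T` (that is, provably in `T`) a bijection
`Θ : D₀/E₀ → D₁/E₁` such that `Θ(α₀.R) = α₁.R` for each relation symbol `R`; in other words,
an isomorphism between the two structures given by `α₀` and `α₁`. -/
def IsHomotopy (α₀ α₁ : Interpretation T U) (Θ : L.Formula (Fin α₀.dim ⊕ Fin α₁.dim)) : Prop :=
  ∀ A : Theory.ModelType.{0, 0, 0} T, ∃ e : α₀.Obj A ≃[L'] α₁.Obj A,
    ∀ (x : Fin α₀.dim → A) (y : Fin α₁.dim → A), Θ.Realize (Sum.elim x y) ↔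
      ∃ (hx : α₀.dom.Realize x) (hy : α₁.dom.Realize y), e (α₀.proj A x hx) = α₁.proj A y hy

/-- The relation `α₀ ≈_T α₁`. -/
def Homotopic (α₀ α₁ : Interpretation T U) : Prop :=
  ∃ Θ : L.Formula (Fin α₀.dim ⊕ Fin α₁.dim), IsHomotopy α₀ α₁ Θ

theorem exists_equiv {α : PreInterp L L'} {A N N' : Type} [L.Structure A]
    [L'.Structure N] [L'.Structure N'] {r : (Fin α.dim → A) → N → Prop}
    {r' : (Fin α.dim → A) → N' → Prop} (h : α.IsCoord A N r) (h' : α.IsCoord A N' r') :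
    ∃ e : N ≃[L'] N', ∀ x a, r x a ↔ r' x (e a) := by
  have h1 : ∀ a, ∃ b, ∃ x, r x a ∧ r' x b := by
    intro a
    obtain ⟨x, hx⟩ := h.surj a
    obtain ⟨b, hb⟩ := (h'.dom_iff x).1 ((h.dom_iff x).2 ⟨a, hx⟩)
    exact ⟨b, x, hx, hb⟩
  have h2 : ∀ b, ∃ a, ∃ x, r x a ∧ r' x b := by
    intro b
    obtain ⟨x, hx⟩ := h'.surj b
    obtain ⟨a, ha⟩ := (h.dom_iff x).1 ((h'.dom_iff x).2 ⟨b, hx⟩)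
    exact ⟨a, x, ha, hx⟩
  have key : ∀ x y a b a' b', r x a → r' x b → r y a' → r' y b' → (a = a' ↔ b = b') := by
    intro x y a b a' b' p1 p2 p3 p4
    rw [← h.eqv_iff' p1 p3, h'.eqv_iff' p2 p4]
  choose f hf using h1
  choose g hg using h2
  have hf' : ∀ x a, r x a → r' x (f a) := by
    intro x a hx
    obtain ⟨y, p1, p2⟩ := hf a
    obtain ⟨b, hb⟩ := (h'.dom_iff x).1 ((h.dom_iff x).2 ⟨a, hx⟩)
    have := (key x y a b a (f a) hx hb p1 p2).1 rfl
    rwa [← this]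
  have hg' : ∀ x b, r' x b → r x (g b) := by
    intro x b hx
    obtain ⟨y, p1, p2⟩ := hg b
    obtain ⟨a, ha⟩ := (h.dom_iff x).1 ((h'.dom_iff x).2 ⟨b, hx⟩)
    have := (key x y a b (g b) b ha hx p1 p2).2 rfl
    rwa [← this]
  have gf : ∀ a, g (f a) = a := by
    intro a
    obtain ⟨x, hx⟩ := h.surj a
    exact h.func _ _ _ (hg' _ _ (hf' _ _ hx)) hx
  have fg : ∀ b, f (g b) = b := by
    intro b
    obtain ⟨x, hx⟩ := h'.surj b
    exact h'.func _ _ _ (hf' _ _ (hg' _ _ hx)) hx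
  refine ⟨⟨⟨f, g, gf, fg⟩, ?_, ?_⟩, ?_⟩
  · intro n F
    exact isEmptyElim F
  · intro n R a
    choose x hx using fun i => h.surj (a i)
    rw [← h.rel_iff' R (x := fun p => x p.1 p.2) (a := a) hx,
      h'.rel_iff' R (a := fun i => f (a i)) (fun i => hf' _ _ (hx i))]
    rfl
  · intro x a
    refine ⟨hf' x a, fun hx => ?_⟩
    have := hg' _ _ hx
    change r x (g (f a)) at this
    rwa [gf] at this

/-- A way of establishing homotopies. -/
theorem homotopic_of_isCoord {α₀ α₁ : Interpretation T U}
    (Θ : L.Formula (Fin α₀.dim ⊕ Fin α₁.dim))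
    (H : ∀ A : Theory.ModelType.{0, 0, 0} T, ∃ (N : Theory.ModelType.{0, 0, 0} U)
      (r₀ : (Fin α₀.dim → A) → N → Prop) (r₁ : (Fin α₁.dim → A) → N → Prop),
      α₀.IsCoord A N r₀ ∧ α₁.IsCoord A N r₁ ∧
      ∀ x y, Θ.Realize (Sum.elim x y) ↔ ∃ a, r₀ x a ∧ r₁ y a) : Homotopic α₀ α₁ := by
  refine ⟨Θ, fun A => ?_⟩
  obtain ⟨N, r₀, r₁, h₀, h₁, hΘ⟩ := H A
  obtain ⟨e₀, he₀⟩ := exists_equiv (α₀.isCoord_rep A) h₀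
  obtain ⟨e₁, he₁⟩ := exists_equiv (α₁.isCoord_rep A) h₁
  refine ⟨e₁.symm.comp e₀, fun x y => ?_⟩
  rw [hΘ]
  constructor
  · rintro ⟨a, ha, hb⟩
    have hx := (h₀.dom_iff x).2 ⟨a, ha⟩
    have hy := (h₁.dom_iff y).2 ⟨a, hb⟩
    refine ⟨hx, hy, ?_⟩
    have p0 := h₀.func _ _ _ ((he₀ x _).1 ⟨hx, rfl⟩) ha
    have p1 := h₁.func _ _ _ ((he₁ y _).1 ⟨hy, rfl⟩) hb
    rw [FirstOrder.Language.Equiv.comp_apply, p0, ← p1, FirstOrder.Language.Equiv.symm_apply_apply]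
  · rintro ⟨hx, hy, h⟩
    refine ⟨e₀ (α₀.proj A x hx), (he₀ x _).1 ⟨hx, rfl⟩, ?_⟩
    rw [FirstOrder.Language.Equiv.comp_apply] at h
    have : e₀ (α₀.proj A x hx) = e₁ (α₁.proj A y hy) := by
      rw [← h, FirstOrder.Language.Equiv.apply_symm_apply]
    rw [this]
    exact (he₁ y _).1 ⟨hy, rfl⟩

/-- What a homotopy yields in terms of coordinate maps. -/
theorem IsHomotopy.isCoord {α₀ α₁ : Interpretation T U}
    {Θ : L.Formula (Fin α₀.dim ⊕ Fin α₁.dim)} (h : IsHomotopy α₀ α₁ Θ)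
    (A : Theory.ModelType.{0, 0, 0} T) :
    ∃ r₀ : (Fin α₀.dim → A) → α₁.objModel A → Prop, α₀.IsCoord A (α₁.objModel A) r₀ ∧
      ∀ x y, Θ.Realize (Sum.elim x y) ↔ ∃ a, r₀ x a ∧ α₁.Rep A y a := by
  obtain ⟨e, he⟩ := h A
  refine ⟨_, (α₀.isCoord_rep A).congr e, fun x y => ?_⟩
  rw [he]
  constructor
  · rintro ⟨hx, hy, h⟩
    exact ⟨_, ⟨_, ⟨hx, rfl⟩, h⟩, ⟨hy, rfl⟩⟩
  · rintro ⟨a, ⟨_, ⟨hx, rfl⟩, h⟩, ⟨hy, h'⟩⟩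
    exact ⟨hx, hy, h.trans h'.symm⟩

/-- A special case: the tuples for `α₀` are reindexed tuples for `α₁`. -/
theorem homotopic_of_reindex {α₀ α₁ : Interpretation T U} (f : Fin α₁.dim → Fin α₀.dim)
    (H : ∀ A : Theory.ModelType.{0, 0, 0} T, ∃ (N : Theory.ModelType.{0, 0, 0} U)
      (r₀ : (Fin α₀.dim → A) → N → Prop) (r₁ : (Fin α₁.dim → A) → N → Prop),
      α₀.IsCoord A N r₀ ∧ α₁.IsCoord A N r₁ ∧ ∀ x a, r₀ x a ↔ r₁ (x ∘ f) a) :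
    Homotopic α₀ α₁ := by
  refine homotopic_of_isCoord (α₁.eqv.relabel (Sum.map f id)) fun A => ?_
  obtain ⟨N, r₀, r₁, h₀, h₁, h⟩ := H A
  refine ⟨N, r₀, r₁, h₀, h₁, fun x y => ?_⟩
  rw [Formula.realize_relabel]
  have : Sum.elim x y ∘ Sum.map f id = Sum.elim (x ∘ f) y := by
    funext s; cases s <;> rfl
  rw [this, h₁.eqv_iff]
  simp only [h]

theorem Homotopic.refl (α : Interpretation T U) : Homotopic α α :=
  homotopic_of_isCoord α.eqv fun A =>
    ⟨α.objModel A, _, _, α.isCoord_rep A, α.isCoord_rep A, (α.isCoord_rep A).eqv_iff⟩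

theorem Homotopic.symm {α₀ α₁ : Interpretation T U} (h : Homotopic α₀ α₁) :
    Homotopic α₁ α₀ := by
  obtain ⟨Θ, h⟩ := h
  refine homotopic_of_isCoord (Θ.relabel Sum.swap) fun A => ?_
  obtain ⟨r₀, h₀, hΘ⟩ := h.isCoord A
  refine ⟨_, _, r₀, α₁.isCoord_rep A, h₀, fun x y => ?_⟩
  rw [Formula.realize_relabel]
  have : Sum.elim x y ∘ Sum.swap = Sum.elim y x := by
    funext s; cases s <;> rfl
  rw [this, hΘ]
  simp only [and_comm]

theorem Homotopic.trans {α₀ α₁ α₂ : Interpretation T U} (h : Homotopic α₀ α₁)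
    (h' : Homotopic α₁ α₂) : Homotopic α₀ α₂ := by
  obtain ⟨Θ, h⟩ := h
  obtain ⟨Θ', h'⟩ := h'
  refine homotopic_of_isCoord (Formula.iExs (Fin α₁.dim)
    ((Θ.relabel (Sum.map Sum.inl id) : L.Formula ((Fin α₀.dim ⊕ Fin α₂.dim) ⊕ Fin α₁.dim)) ⊓
      Θ'.relabel (Sum.elim Sum.inr (Sum.inl ∘ Sum.inr)))) fun A => ?_
  obtain ⟨r₁, h₁, hΘ'⟩ := h'.isCoord A
  obtain ⟨s₀, h₀, hΘ⟩ := h.isCoord A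
  obtain ⟨e, he⟩ := exists_equiv (α₁.isCoord_rep A) h₁
  refine ⟨α₂.objModel A, _, _, h₀.congr e, α₂.isCoord_rep A, fun x z => ?_⟩
  rw [Formula.realize_iExs]
  have key : ∀ y : Fin α₁.dim → A,
      ((Θ.relabel (Sum.map Sum.inl id) : L.Formula ((Fin α₀.dim ⊕ Fin α₂.dim) ⊕ Fin α₁.dim)) ⊓
        Θ'.relabel (Sum.elim Sum.inr (Sum.inl ∘ Sum.inr))).Realize (Sum.elim (Sum.elim x z) y) ↔
      (∃ a, s₀ x a ∧ α₁.Rep A y a) ∧ (∃ a, r₁ y a ∧ α₂.Rep A z a) := by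
    intro y
    rw [Formula.realize_inf, Formula.realize_relabel, Formula.realize_relabel, ← hΘ, ← hΘ']
    have e1 : Sum.elim (Sum.elim x z) y ∘ Sum.map Sum.inl id = Sum.elim x y := by
      funext s; cases s <;> rfl
    have e2 : Sum.elim (Sum.elim x z) y ∘ Sum.elim Sum.inr (Sum.inl ∘ Sum.inr)
        = Sum.elim y z := by
      funext s; cases s <;> rfl
    rw [e1, e2]
  simp only [key]
  constructor
  · rintro ⟨y, ⟨a, ha, ha'⟩, ⟨b, hb, hb'⟩⟩
    refine ⟨b, ⟨a, ha, ?_⟩, hb'⟩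
    exact h₁.func _ _ _ ((he y a).1 ha') hb
  · rintro ⟨b, ⟨a, ha, rfl⟩, hb'⟩
    obtain ⟨y, hy⟩ := (α₁.isCoord_rep A).surj a
    exact ⟨y, ⟨a, ha, hy⟩, ⟨_, (he y a).1 hy, hb'⟩⟩

/-- Homotopy as an equivalence relation on `Int(T, U)`. -/
instance homotopySetoid (T : L.Theory) (U : L'.Theory) : Setoid (Interpretation T U) where
  r := Homotopic
  iseqv := ⟨Homotopic.refl, Homotopic.symm, Homotopic.trans⟩

/-- `α` and `β` have the same dimension, and their formulas `φ_D` and `φ_E` agree up to equivalence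
in `T`. -/
def SameSort (α β : Interpretation T U) : Prop :=
  ∃ h : α.dim = β.dim, T.Iff (α.dom.relabel (Fin.cast h)) β.dom ∧
    T.Iff (α.eqv.relabel (Sum.map (Fin.cast h) (Fin.cast h))) β.eqv

/-- `α` and `β` have the same dimension, and the formulas `α.R` and `β.R` agree up to equivalence
in `T`. -/
def SameRel (α β : Interpretation T U) {n : ℕ} (R : L'.Relations n) : Prop :=
  ∃ h : α.dim = β.dim, T.Iff ((α.rel R).relabel (Prod.map id (Fin.cast h))) (β.rel R)

/-- The topology on `Int(T, U)` as a path space: formulas are considered up to equivalence in `T`,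
and the basic open sets consist of the interpretations that have a prescribed dimension and
prescribed formulas `φ_D`, `φ_E`, as well as prescribed formulas `α.R` for finitely many relation
symbols `R`. -/
instance interpTopology (T : L.Theory) (U : L'.Theory) :
    TopologicalSpace (Interpretation T U) :=
  TopologicalSpace.generateFrom
    ({W | ∃ α : Interpretation T U, W = {β | SameSort α β}} ∪
      {W | ∃ (α : Interpretation T U) (n : ℕ) (R : L'.Relations n), W = {β | SameRel α β R}})

end Basic

section Comp

variable [L'.IsRelational] [L''.IsRelational] [L'''.IsRelational]
variable {T : L.Theory} {U : L'.Theory} {V : L''.Theory} {W : L'''.Theory}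

/-- The composition `β ∘ α : T ⇝ V` of `α : T ⇝ U` and `β : U ⇝ V`. -/
noncomputable def comp (β : Interpretation U V) (α : Interpretation T U) :
    Interpretation T V where
  toPreInterp := β.toPreInterp.comp α.toPreInterp
  isInterp := PreInterp.isInterp_of_isCoord fun A =>
    ⟨β.objModel (α.objModel A), _,
      (α.isCoord_rep A).comp (β.isCoord_rep (α.objModel A))⟩

/-- The trivial interpretation `1_T : T ⇝ T`. -/
def one [L.IsRelational] (T : L.Theory) : Interpretation T T where
  toPreInterp := PreInterp.one L
  isInterp := PreInterp.isInterp_of_isCoord fun A => ⟨A, _, PreInterp.isCoord_id A⟩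

theorem comp_congr_left {β₀ β₁ : Interpretation U V} (h : Homotopic β₀ β₁)
    (α : Interpretation T U) : Homotopic (β₀.comp α) (β₁.comp α) := by
  obtain ⟨Θ, h⟩ := h
  refine homotopic_of_isCoord ((α.guarded Θ).relabel fun p =>
    (Sum.map (fun i => finProdFinEquiv (i, p.2)) (fun i => finProdFinEquiv (i, p.2)) p.1 :
      Fin (β₀.comp α).dim ⊕ Fin (β₁.comp α).dim)) fun A => ?_
  obtain ⟨s, hs, hΘ⟩ := h.isCoord (α.objModel A)
  refine ⟨_, _, _, (α.isCoord_rep A).comp hs,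
    (α.isCoord_rep A).comp (β₁.isCoord_rep (α.objModel A)), fun x y => ?_⟩
  rw [Formula.realize_relabel, (α.isCoord_rep A).realize_guarded]
  constructor
  · rintro ⟨a, h1, h2⟩
    have e : a = Sum.elim (fun i => a (Sum.inl i)) (fun i => a (Sum.inr i)) := by
      funext s; cases s <;> rfl
    rw [e] at h2
    obtain ⟨c, hc1, hc2⟩ := (hΘ _ _).1 h2
    exact ⟨c, ⟨_, fun i => h1 (Sum.inl i), hc1⟩, ⟨_, fun i => h1 (Sum.inr i), hc2⟩⟩
  · rintro ⟨c, ⟨a, h1, hc⟩, ⟨a', h1', hc'⟩⟩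
    refine ⟨Sum.elim a a', ?_, (hΘ _ _).2 ⟨c, hc, hc'⟩⟩
    rintro (i | i)
    · exact h1 i
    · exact h1' i

theorem comp_congr_right (β : Interpretation U V) {α₀ α₁ : Interpretation T U}
    (h : Homotopic α₀ α₁) : Homotopic (β.comp α₀) (β.comp α₁) := by
  obtain ⟨Θ, h⟩ := h
  refine homotopic_of_isCoord (Formula.iExs (Fin (β.comp α₁).dim)
    ((Formula.iInf fun i : Fin β.dim => (Θ.relabel (Sum.map
      (fun j => (Sum.inl (finProdFinEquiv (i, j)) : Fin (β.comp α₀).dim ⊕ Fin (β.comp α₁).dim))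
      (fun j => (finProdFinEquiv (i, j) : Fin (β.comp α₁).dim))) :
      L.Formula ((Fin (β.comp α₀).dim ⊕ Fin (β.comp α₁).dim) ⊕ Fin (β.comp α₁).dim))) ⊓
    (β.comp α₁).eqv.relabel (Sum.elim Sum.inr (Sum.inl ∘ Sum.inr)))) fun A => ?_
  obtain ⟨s, hs, hΘ⟩ := h.isCoord A
  have h₁ : (β.comp α₁).IsCoord A (β.objModel (α₁.objModel A))
      (PreInterp.compRel (α₁.Rep A) (β.Rep (α₁.objModel A))) :=
    (α₁.isCoord_rep A).comp (β.isCoord_rep (α₁.objModel A))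
  refine ⟨β.objModel (α₁.objModel A), _, _, hs.comp (β.isCoord_rep (α₁.objModel A)), h₁, fun x z => ?_⟩
  rw [Formula.realize_iExs]
  simp only [Formula.realize_inf, Formula.realize_iInf, Formula.realize_relabel]
  have e1 : ∀ (y : Fin (β.comp α₁).dim → A) (i : Fin β.dim), Sum.elim (Sum.elim x z) y ∘ Sum.map
      (fun j => (Sum.inl (finProdFinEquiv (i, j)) : Fin (β.comp α₀).dim ⊕ Fin (β.comp α₁).dim))
      (fun j => (finProdFinEquiv (i, j) : Fin (β.comp α₁).dim)) =
      Sum.elim (fun j => x (finProdFinEquiv (i, j))) (fun j => y (finProdFinEquiv (i, j))) := by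
    intro y i
    funext s; cases s <;> rfl
  have e2 : ∀ y : Fin (β.comp α₁).dim → A, Sum.elim (Sum.elim x z) y ∘
      Sum.elim Sum.inr (Sum.inl ∘ Sum.inr) = Sum.elim y z := by
    intro y
    funext s; cases s <;> rfl
  simp only [e1, e2, hΘ]
  constructor
  · rintro ⟨y, H1, H2⟩
    obtain ⟨c, ⟨b, hb, hc⟩, hz⟩ := (h₁.eqv_iff _ _).1 H2
    refine ⟨c, ⟨b, fun i => ?_, hc⟩, hz⟩
    obtain ⟨a, ha, ha'⟩ := H1 i
    obtain rfl := (α₁.isCoord_rep A).func _ _ _ (hb i) ha'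
    exact ha
  · rintro ⟨c, ⟨b, hb, hc⟩, hz⟩
    choose y hy using fun i => (α₁.isCoord_rep A).surj (b i)
    have hy' : ∀ i, α₁.Rep A (fun j => y (finProdFinEquiv.symm (finProdFinEquiv (i, j))).1
        (finProdFinEquiv.symm (finProdFinEquiv (i, j))).2) (b i) := by
      intro i
      simpa using hy i
    exact ⟨fun l => y (finProdFinEquiv.symm l).1 (finProdFinEquiv.symm l).2,
      fun i => ⟨b i, hb i, hy' i⟩, (h₁.eqv_iff _ _).2 ⟨c, ⟨b, hy', hc⟩, hz⟩⟩

theorem one_comp (α : Interpretation T U) : Homotopic ((one U).comp α) α := by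
  refine homotopic_of_reindex (fun j => (finProdFinEquiv ((0 : Fin 1), j) :)) fun A => ?_
  refine ⟨α.objModel A, _, _,
    (α.isCoord_rep A).comp (PreInterp.isCoord_id (α.objModel A)), α.isCoord_rep A, fun x a => ?_⟩
  constructor
  · rintro ⟨b, hb, rfl⟩
    exact hb (0 : Fin 1)
  · intro h
    refine ⟨fun _ => a, fun i => ?_, rfl⟩
    have : i = (0 : Fin 1) := Subsingleton.elim (α := Fin 1) _ _
    subst this
    exact h

theorem comp_one [L.IsRelational] (α : Interpretation T U) : Homotopic (α.comp (one T)) α := by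
  refine homotopic_of_reindex (fun j => (finProdFinEquiv (j, (0 : Fin 1)) :)) fun A => ?_
  refine ⟨α.objModel A, _, _,
    (PreInterp.isCoord_id A).comp (α.isCoord_rep A), α.isCoord_rep A, fun x a => ?_⟩
  constructor
  · rintro ⟨b, hb, h⟩
    obtain rfl : _ = b := funext hb
    exact h
  · intro h
    exact ⟨_, fun i => rfl, h⟩

theorem comp_assoc (γ : Interpretation V W) (β : Interpretation U V) (α : Interpretation T U) :
    Homotopic ((γ.comp β).comp α) (γ.comp (β.comp α)) := by
  refine homotopic_of_reindex (Fin.cast (Nat.mul_assoc γ.dim β.dim α.dim).symm) fun A => ?_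
  refine ⟨γ.objModel (β.objModel (α.objModel A)), _, _,
    (α.isCoord_rep A).comp ((β.isCoord_rep (α.objModel A)).comp (γ.isCoord_rep (β.objModel (α.objModel A)))),
    ((α.isCoord_rep A).comp (β.isCoord_rep (α.objModel A))).comp (γ.isCoord_rep (β.objModel (α.objModel A))),
    fun x a => ?_⟩
  have key : ∀ (i : Fin γ.dim) (j : Fin β.dim) (l : Fin α.dim),
      Fin.cast (Nat.mul_assoc γ.dim β.dim α.dim).symm
        (finProdFinEquiv (i, finProdFinEquiv (j, l))) =
      finProdFinEquiv (finProdFinEquiv (i, j), l) := by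
    intro i j l
    apply Fin.ext
    simp [finProdFinEquiv]
    ring
  have hk : ∀ (i : Fin γ.dim) (j : Fin β.dim) (c : α.Obj A),
      α.Rep A (fun l => x (finProdFinEquiv (finProdFinEquiv (i, j), l) :
        Fin (γ.dim * β.dim * α.dim))) c ↔
      α.Rep A (fun l => x (Fin.cast (Nat.mul_assoc γ.dim β.dim α.dim).symm
        (finProdFinEquiv (i, finProdFinEquiv (j, l))))) c := by
    intro i j c
    have : (fun l => x (finProdFinEquiv (finProdFinEquiv (i, j), l) :
        Fin (γ.dim * β.dim * α.dim))) = (fun l => x (Fin.cast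
          (Nat.mul_assoc γ.dim β.dim α.dim).symm (finProdFinEquiv (i, finProdFinEquiv (j, l))))) :=
      funext fun l => congrArg x (key i j l).symm
    rw [this]
  constructor
  · rintro ⟨b, hb, c, hc, h⟩
    refine ⟨c, fun i => ⟨fun j => b (finProdFinEquiv (i, j)), fun j => ?_, hc i⟩, h⟩
    exact (hk i j _).1 (hb (finProdFinEquiv (i, j)))
  · rintro ⟨c, hc, h⟩
    choose b hb hb' using hc
    refine ⟨fun l => b (finProdFinEquiv.symm l).1 (finProdFinEquiv.symm l).2, fun l => ?_,
      c, fun i => by simpa using hb' i, h⟩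
    obtain ⟨⟨i, j⟩, rfl⟩ := finProdFinEquiv.surjective l
    have e : b (finProdFinEquiv.symm (finProdFinEquiv (i, j))).1
        (finProdFinEquiv.symm (finProdFinEquiv (i, j))).2 = b i j := by simp
    have H := (hk i j _).2 (hb i j)
    rw [← e] at H
    exact H

end Comp

end Interpretation

/-- `Mor(T, U)`: the interpretations of `U` in `T` modulo `≈_T`, with the quotient topology. -/
def Mor [L'.IsRelational] (T : L.Theory) (U : L'.Theory) : Type :=
  Quotient (Interpretation.homotopySetoid T U)

instance morTopology [L'.IsRelational] (T : L.Theory) (U : L'.Theory) :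
    TopologicalSpace (Mor T U) :=
  inferInstanceAs (TopologicalSpace (Quotient (Interpretation.homotopySetoid T U)))

/-- The monoid of morphisms `T ⇝ T` under composition. -/
noncomputable instance morMonoid [L.IsRelational] (T : L.Theory) : Monoid (Mor T T) where
  mul p q := Quotient.map₂ Interpretation.comp
    (fun _ β' h α _ h' => (Interpretation.comp_congr_left h α).trans
      (Interpretation.comp_congr_right β' h')) p q
  one := Quotient.mk _ (Interpretation.one T)
  mul_assoc := by
    rintro ⟨γ⟩ ⟨β⟩ ⟨α⟩
    exact Quotient.sound (Interpretation.comp_assoc γ β α)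
  one_mul := by
    rintro ⟨α⟩
    exact Quotient.sound (Interpretation.one_comp α)
  mul_one := by
    rintro ⟨α⟩
    exact Quotient.sound (Interpretation.comp_one α)

/-- `B(T)`: the group of invertible elements of the topological monoid `Mor(T, T)`. Its topology is
the one of Mathlib on groups of units, obtained by identifying an invertible element `u` with the
pair `(u, u⁻¹)` in `Mor(T, T) × Mor(T, T)ᵒᵖ`. -/
abbrev BGroup [L.IsRelational] (T : L.Theory) : Type := (Mor T T)ˣ

end Interp

end OligoOut

namespace OligoOut

open FirstOrder FirstOrder.Language

/-! ## Back and forth -/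

/-! Since `G` is oligomorphic, `M` is countably categorical and homogeneous: tuples of the same type
lie in the same orbit, and a relation of finite arity on `ℕ` is definable exactly when it is
`G`-invariant. Interpretations can therefore be studied through the action of `G`. A
self-interpretation `α` yields a countable model of `T` with domain `D/E`, which is isomorphic to
`M`. An isomorphism amounts to a partial surjection `r` from `k`-tuples onto `ℕ`, a coordinate map
(`exists_isCoord_nat`). The action of `G` on tuples descends along `r` to a continuous endomorphism
`Φ` of `G`; this is the relation `Represents α Φ`. Another choice of `r` changes `Φ` by a
conjugation, homotopic interpretations induce the same maps, and composition goes to composition.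
Conversely, interpretations inducing the same `Φ` are homotopic, because the relation "same value in
`ℕ`" is invariant and so definable (`Represents.homotopic`). Every topological automorphism of `G`
is induced by an interpretation (`exists_represents_contAut`). Hence invertible classes correspond
to automorphisms modulo inner ones, which gives the abstract isomorphism `toOutHom`.

For the topologies, the link in both directions is a permutation `s` of `ℕ` that fixes an initial
segment and preserves orbits on tuples of some bounded length. If two interpretations have the same
sort and agree on enough relation symbols, their coordinate maps differ by such an `s`, and the
induced maps agree on prescribed cosets (`Represents.eventually_exists`). If two automorphisms agree
on enough cosets, they differ by such an `s`; composing a coordinate map with `s` changes only the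
formulas for symbols outside a prescribed finite set (`Represents.eventually_exists_mem`).

The remaining properties are proved for `Out(G)` and carried over to `B(T)`. `Inn(G)` is closed,
because a point stabilizer has only finitely many fixed points, so a limit of inner automorphisms
comes from a limit of conjugating elements (`isClosed_inn`). Stabilizers of finitely many cosets
give a neighbourhood basis of open subgroups, whence total disconnectedness. Automorphisms close to
the identity are conjugations by elements of the normalizer of `G` in `Sym(ℕ)`. The image of that
normalizer in `Out(G)` is compact, since modulo `G` it permutes the finitely many orbits on
`n`-tuples for each `n` (`isCompact_range_conjContAut`). -/

theorem snoc_castSucc_apply {X : Type} {n : ℕ} (a : Fin n → X) (x : X) (i : Fin n) :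
    (Fin.snoc a x : Fin (n + 1) → X) i.castSucc = a i :=
  Fin.snoc_castSucc (α := fun _ => X) x a i

theorem snoc_last_apply {X : Type} {n : ℕ} (a : Fin n → X) (x : X) :
    (Fin.snoc a x : Fin (n + 1) → X) (Fin.last n) = x :=
  Fin.snoc_last (α := fun _ => X) x a

/-- The back-and-forth method for a family `P` of relations between finite tuples of two countable
sets. -/
theorem exists_equiv_of_back_and_forth {X Y : Type} [Countable X] [Countable Y] [Nonempty X]
    [Nonempty Y] (P : ∀ n : ℕ, (Fin n → X) → (Fin n → Y) → Prop)
    (hre : ∀ {n m : ℕ} (a : Fin n → X) (b : Fin n → Y) (f : Fin m → Fin n),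
      P n a b → P m (a ∘ f) (b ∘ f))
    (heq : ∀ (a : Fin 2 → X) (b : Fin 2 → Y), P 2 a b → (a 0 = a 1 ↔ b 0 = b 1))
    (forth : ∀ {n : ℕ} (a : Fin n → X) (b : Fin n → Y), P n a b → ∀ x, ∃ y,
      P (n + 1) (Fin.snoc a x : Fin (n + 1) → X) (Fin.snoc b y : Fin (n + 1) → Y))
    (back : ∀ {n : ℕ} (a : Fin n → X) (b : Fin n → Y), P n a b → ∀ y, ∃ x,
      P (n + 1) (Fin.snoc a x : Fin (n + 1) → X) (Fin.snoc b y : Fin (n + 1) → Y))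
    {n₀ : ℕ} (a₀ : Fin n₀ → X) (b₀ : Fin n₀ → Y) (h₀ : P n₀ a₀ b₀) :
    ∃ e : X ≃ Y, (∀ i, e (a₀ i) = b₀ i) ∧ ∀ (m : ℕ) (c : Fin m → X), P m c (e ∘ c) := by
  classical
  let S := Σ n : ℕ, {p : (Fin n → X) × (Fin n → Y) // P n p.1 p.2}
  let Ext : S → S → Prop := fun p q =>
    ∃ f : Fin p.1 → Fin q.1, q.2.1.1 ∘ f = p.2.1.1 ∧ q.2.1.2 ∘ f = p.2.1.2
  have ext_refl : ∀ p, Ext p p := fun p => ⟨id, rfl, rfl⟩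
  have ext_trans : ∀ p q r, Ext p q → Ext q r → Ext p r := by
    rintro p q r ⟨f, h1, h2⟩ ⟨g, h3, h4⟩
    exact ⟨g ∘ f, by rw [← Function.comp_assoc, h3, h1], by rw [← Function.comp_assoc, h4, h2]⟩
  have step : ∀ (p : S) (x : X) (y : Y), ∃ q : S, Ext p q ∧ (∃ i, q.2.1.1 i = x) ∧
      ∃ i, q.2.1.2 i = y := by
    rintro ⟨n, ⟨a, b⟩, h⟩ x y
    -- Each stage goes forth once and back once, so that the limit is both total and surjective.
    obtain ⟨y', h1⟩ := forth a b h x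
    obtain ⟨x', h2⟩ := back _ _ h1 y
    refine ⟨⟨n + 1 + 1, ⟨_, _⟩, h2⟩, ⟨fun i => i.castSucc.castSucc, ?_, ?_⟩,
      ⟨(Fin.last n).castSucc, ?_⟩, ⟨Fin.last (n + 1), snoc_last_apply _ _⟩⟩
    · exact funext fun i => (snoc_castSucc_apply _ _ _).trans (snoc_castSucc_apply _ _ _)
    · exact funext fun i => (snoc_castSucc_apply _ _ _).trans (snoc_castSucc_apply _ _ _)
    · exact (snoc_castSucc_apply _ _ _).trans (snoc_last_apply _ _)
  choose next hnext hX hY using step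
  obtain ⟨xs, hxs⟩ := exists_surjective_nat X
  obtain ⟨ys, hys⟩ := exists_surjective_nat Y
  let st : ℕ → S := fun k => Nat.rec ⟨n₀, ⟨a₀, b₀⟩, h₀⟩ (fun k p => next p (xs k) (ys k)) k
  have st_succ : ∀ k, st (k + 1) = next (st k) (xs k) (ys k) := fun k => rfl
  have st_mono : ∀ k l, k ≤ l → Ext (st k) (st l) := by
    intro k l hkl
    induction l, hkl using Nat.le_induction with
    | base => exact ext_refl _
    | succ l _ ih => exact ext_trans _ _ _ ih (hnext _ _ _)
  let R : X → Y → Prop := fun x y => ∃ k i, (st k).2.1.1 i = x ∧ (st k).2.1.2 i = y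
  have R_up : ∀ x y, R x y → ∃ k, ∀ l, k ≤ l → ∃ i, (st l).2.1.1 i = x ∧ (st l).2.1.2 i = y := by
    rintro x y ⟨k, i, rfl, rfl⟩
    refine ⟨k, fun l hl => ?_⟩
    obtain ⟨f, h1, h2⟩ := st_mono k l hl
    exact ⟨f i, congrFun h1 i, congrFun h2 i⟩
  -- Finitely many matched pairs all occur at one late stage, and `hre` pulls `P` back from there.
  have R_fin : ∀ (m : ℕ) (c : Fin m → X) (d : Fin m → Y), (∀ j, R (c j) (d j)) → P m c d := by
    intro m c d h
    choose k hk using fun j => R_up _ _ (h j)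
    choose f hf1 hf2 using fun j => hk j (Finset.univ.sup k) (Finset.le_sup (Finset.mem_univ j))
    have := hre _ _ f (st (Finset.univ.sup k)).2.2
    rwa [show (st (Finset.univ.sup k)).2.1.1 ∘ f = c from funext hf1,
      show (st (Finset.univ.sup k)).2.1.2 ∘ f = d from funext hf2] at this
  have R_inj : ∀ x y x' y', R x y → R x' y' → (x = x' ↔ y = y') := by
    intro x y x' y' h h'
    have := heq _ _ (R_fin 2 ![x, x'] ![y, y'] (fun j => by fin_cases j <;> simpa))
    simpa using this
  have R_left : ∀ x, ∃ y, R x y := by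
    intro x
    obtain ⟨k, rfl⟩ := hxs x
    obtain ⟨i, hi⟩ := hX (st k) (xs k) (ys k)
    exact ⟨_, k + 1, i, hi, rfl⟩
  have R_right : ∀ y, ∃ x, R x y := by
    intro y
    obtain ⟨k, rfl⟩ := hys y
    obtain ⟨i, hi⟩ := hY (st k) (xs k) (ys k)
    exact ⟨_, k + 1, i, rfl, hi⟩
  choose e he using R_left
  choose e' he' using R_right
  refine ⟨⟨e, e', fun x => ?_, fun y => ?_⟩, fun i => ?_, fun m c => ?_⟩
  · exact (R_inj _ _ _ _ (he' (e x)) (he x)).2 rfl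
  · exact (R_inj _ _ _ _ (he (e' y)) (he' y)).1 rfl
  · exact (R_inj _ _ _ _ (he (a₀ i)) ⟨0, i, rfl, rfl⟩).1 rfl
  · exact R_fin m c _ fun j => he (c j)

/-! ## Permutation groups -/

theorem continuousAt_of_eventually_eq {X Y : Type} [TopologicalSpace X] [TopologicalSpace Y]
    {f : X → Y} {x : X} (h : ∀ᶠ y in nhds x, f y = f x) : ContinuousAt f x :=
  (tendsto_nhds_of_eventually_eq h)

/-- The value of `g * h` at `x` depends only on `h x` and on `g` at that one point; the value of
`g⁻¹` at `x` persists as long as `g` keeps sending `g⁻¹ x` to `x`. -/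
instance perm_isTopologicalGroup : IsTopologicalGroup (Equiv.Perm ℕ) where
  continuous_mul := by
    refine continuous_induced_rng.2 (continuous_pi fun x => ?_)
    have hc : ∀ y : ℕ, Continuous fun g : Equiv.Perm ℕ => g y := fun y =>
      (continuous_apply y).comp continuous_induced_dom
    rw [continuous_iff_continuousAt]
    rintro ⟨g, h⟩
    refine (continuousAt_of_eventually_eq ?_ : ContinuousAt
      (fun p : Equiv.Perm ℕ × Equiv.Perm ℕ => p.1 (p.2 x)) (g, h))
    have h1 : ∀ᶠ p : Equiv.Perm ℕ × Equiv.Perm ℕ in nhds (g, h), p.2 x = h x :=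
      ((isOpen_discrete {h x}).preimage ((hc x).comp continuous_snd)).mem_nhds rfl
    have h2 : ∀ᶠ p : Equiv.Perm ℕ × Equiv.Perm ℕ in nhds (g, h), p.1 (h x) = g (h x) :=
      ((isOpen_discrete {g (h x)}).preimage ((hc (h x)).comp continuous_fst)).mem_nhds rfl
    filter_upwards [h1, h2] with p p1 p2
    rw [p1, p2]
  continuous_inv := by
    refine continuous_induced_rng.2 (continuous_pi fun x => ?_)
    have hc : ∀ y : ℕ, Continuous fun g : Equiv.Perm ℕ => g y := fun y =>
      (continuous_apply y).comp continuous_induced_dom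
    rw [continuous_iff_continuousAt]
    intro g
    refine (continuousAt_of_eventually_eq ?_ : ContinuousAt
      (fun p : Equiv.Perm ℕ => p⁻¹ x) g)
    have h1 : ∀ᶠ p : Equiv.Perm ℕ in nhds g, p (g⁻¹ x) = g (g⁻¹ x) :=
      ((isOpen_discrete {g (g⁻¹ x)}).preimage (hc (g⁻¹ x))).mem_nhds rfl
    filter_upwards [h1] with p p1
    rw [Equiv.Perm.inv_eq_iff_eq, p1]
    simp

theorem continuous_perm_apply (y : ℕ) : Continuous fun g : Equiv.Perm ℕ => g y :=
  (continuous_apply y).comp continuous_induced_dom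

/-- A basic neighbourhood restricts finitely many values, and a finite set of arguments is contained
in an initial segment. -/
theorem exists_fixing_of_mem_nhds {G : Subgroup (Equiv.Perm ℕ)} {g : G} {U : Set G}
    (hU : U ∈ nhds g) : ∃ m : ℕ, ∀ h : G, (∀ i < m, (h : Equiv.Perm ℕ) i = g.1 i) → h ∈ U := by
  have h1 : Topology.IsInducing fun h : G => (h.1 : ℕ → ℕ) :=
    (Topology.IsInducing.mk rfl : Topology.IsInducing fun h : Equiv.Perm ℕ => (h : ℕ → ℕ)).comp
      Topology.IsInducing.subtypeVal
  rw [h1.nhds_eq_comap, Filter.mem_comap] at hU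
  obtain ⟨V, hV, hVU⟩ := hU
  rw [nhds_pi, Filter.mem_pi] at hV
  obtain ⟨I, hI, t, ht, hIV⟩ := hV
  obtain ⟨m, hm⟩ := hI.bddAbove
  refine ⟨m + 1, fun h hh => hVU (hIV fun i hi => ?_)⟩
  change h.1 i ∈ t i
  rw [hh i (Nat.lt_succ_of_le (hm hi))]
  exact mem_of_mem_nhds (ht i)

theorem isOpen_apply_eq (G : Subgroup (Equiv.Perm ℕ)) (a b : ℕ) :
    IsOpen {h : G | h.1 a = b} :=
  (isOpen_discrete {b}).preimage ((continuous_perm_apply a).comp continuous_subtype_val)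

/-- A coset `hV` is invariant under `V` on the right and under `hVh⁻¹` on the left. Both are open,
so both contain the pointwise stabilizer of an initial segment. Membership in the coset then depends
only on the orbit of a finite tuple, as exploited in `mem_coset_iff_of_preservesOrbits`. -/
theorem exists_fixing_mul_mul {G : Subgroup (Equiv.Perm ℕ)} {B : Set G} (hB : IsOpenCoset B) :
    ∃ m : ℕ, ∀ x z w : G, (∀ i < m, z.1 i = i) → (∀ i < m, w.1 i = i) →
      (z * x * w ∈ B ↔ x ∈ B) := by
  obtain ⟨V, h, rfl⟩ := hB
  have hmem : ∀ x : G, x ∈ (fun u => h * u) '' (V : Set G) ↔ h⁻¹ * x ∈ V := by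
    intro x
    constructor
    · rintro ⟨u, hu, rfl⟩
      simpa using hu
    · intro hx
      exact ⟨_, hx, by simp⟩
  have h1 : (V : Set G) ∈ nhds (1 : G) := V.mem_nhds_one
  have h2 : {z : G | h⁻¹ * z * h ∈ V} ∈ nhds (1 : G) := by
    have : Continuous fun z : G => h⁻¹ * z * h := by fun_prop
    refine this.continuousAt.preimage_mem_nhds ?_
    simpa using h1
  obtain ⟨m, hm⟩ := exists_fixing_of_mem_nhds (Filter.inter_mem h1 h2)
  refine ⟨m, fun x z w hz hw => ?_⟩
  have hz' := (hm z hz).2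
  have hw' := (hm w hw).1
  rw [hmem, hmem]
  have e : h⁻¹ * (z * x * w) = (h⁻¹ * z * h) * (h⁻¹ * x) * w := by group
  rw [e]
  have hz'' : h⁻¹ * z * h ∈ V.toSubgroup := hz'
  exact (V.toSubgroup.mul_mem_cancel_right hw').trans (V.toSubgroup.mul_mem_cancel_left hz'')

/-- Two tuples are in the same orbit of `G`. -/
def SameOrbit (G : Subgroup (Equiv.Perm ℕ)) {V : Type} (c d : V → ℕ) : Prop :=
  ∃ g ∈ G, ∀ i, g (c i) = d i

namespace SameOrbit

variable {G : Subgroup (Equiv.Perm ℕ)} {V W : Type} {c d e : V → ℕ}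

theorem symm (h : SameOrbit G c d) : SameOrbit G d c := by
  obtain ⟨g, hg, h⟩ := h
  exact ⟨g⁻¹, G.inv_mem hg, fun i => by simp [← h]⟩

theorem trans (h : SameOrbit G c d) (h' : SameOrbit G d e) : SameOrbit G c e := by
  obtain ⟨g, hg, h⟩ := h
  obtain ⟨g', hg', h'⟩ := h'
  exact ⟨g' * g, G.mul_mem hg' hg, fun i => by simp [h, h']⟩

theorem comp (h : SameOrbit G c d) (f : W → V) : SameOrbit G (c ∘ f) (d ∘ f) := by
  obtain ⟨g, hg, h⟩ := h
  exact ⟨g, hg, fun i => h (f i)⟩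

end SameOrbit

/-- Agreement with elements of `G` on every finite tuple puts `s` in the closure of `G`. -/
theorem mem_of_forall_sameOrbit {G : Subgroup (Equiv.Perm ℕ)}
    (hG : IsClosed (G : Set (Equiv.Perm ℕ))) {s : Equiv.Perm ℕ}
    (h : ∀ (n : ℕ) (c : Fin n → ℕ), SameOrbit G c (s ∘ c)) : s ∈ G := by
  have : s ∈ closure (G : Set (Equiv.Perm ℕ)) := by
    rw [mem_closure_iff_nhds]
    intro U hU
    rw [(Topology.IsInducing.mk rfl :
      Topology.IsInducing fun h : Equiv.Perm ℕ => (h : ℕ → ℕ)).nhds_eq_comap,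
      Filter.mem_comap] at hU
    obtain ⟨V, hV, hVU⟩ := hU
    rw [nhds_pi, Filter.mem_pi] at hV
    obtain ⟨I, hI, t, ht, hIV⟩ := hV
    obtain ⟨m, hm⟩ := hI.bddAbove
    obtain ⟨g, hg, hgs⟩ := h (m + 1) (fun i => i)
    refine ⟨g, hVU (hIV fun i hi => ?_), hg⟩
    change g i ∈ t i
    rw [show g i = s i from hgs ⟨i, Nat.lt_succ_of_le (hm hi)⟩]
    exact mem_of_mem_nhds (ht i)
  rwa [hG.closure_eq] at this

namespace IsOligomorphic

variable {G : Subgroup (Equiv.Perm ℕ)}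

theorem exists_reps (hG : IsOligomorphic G) (n : ℕ) :
    ∃ F : Set (Fin n → ℕ), F.Finite ∧ ∀ c, ∃ d ∈ F, SameOrbit G c d := by
  have := hG.2 n
  refine ⟨Set.range (Quotient.out : MulAction.orbitRel.Quotient G (Fin n → ℕ) → _),
    Set.finite_range _, fun c => ⟨_, ⟨Quotient.mk _ c, rfl⟩, ?_⟩⟩
  have h : MulAction.orbitRel G (Fin n → ℕ) _ c :=
    Quotient.mk_out (s := MulAction.orbitRel G (Fin n → ℕ)) c
  rw [MulAction.orbitRel_apply] at h
  obtain ⟨g, hg⟩ := h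
  exact ⟨g.1, g.2, fun i => congrFun hg i⟩

/-- For large `N`, each orbit of `G` on `n`-tuples contains a tuple of numbers below `N`. -/
theorem exists_bound (hG : IsOligomorphic G) (n : ℕ) :
    ∃ N : ℕ, ∀ c : Fin n → ℕ, ∃ d, SameOrbit G c d ∧ ∀ i, d i < N := by
  obtain ⟨F, hF, h⟩ := hG.exists_reps n
  obtain ⟨N, hN⟩ := (hF.image fun d => Finset.univ.sup d).bddAbove
  refine ⟨N + 1, fun c => ?_⟩
  obtain ⟨d, hd, hcd⟩ := h c
  exact ⟨d, hcd, fun i => Nat.lt_succ_of_le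
    ((Finset.le_sup (f := d) (Finset.mem_univ i)).trans (hN ⟨d, hd, rfl⟩))⟩

end IsOligomorphic

/-! ## Definability in structures with oligomorphic automorphism group -/

section ModelTheory

variable {L : FirstOrder.Language.{0, 0}}

/-- The universal closure of a formula. -/
noncomputable def univClosure {V : Type} [Finite V] (φ : L.Formula V) : L.Sentence :=
  Formula.iAlls V (φ.relabel Sum.inr : L.Formula (Empty ⊕ V))

theorem realize_univClosure {V : Type} [Finite V] (φ : L.Formula V) (A : Type)
    [L.Structure A] : A ⊨ univClosure φ ↔ ∀ v : V → A, φ.Realize v := by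
  rw [Sentence.Realize, univClosure, Formula.realize_iAlls]
  refine forall_congr' fun v => ?_
  rw [Formula.realize_relabel]
  rfl

/-- Existential quantification over the last variable. -/
noncomputable def existsLast {n : ℕ} (θ : L.Formula (Fin (n + 1))) : L.Formula (Fin n) :=
  Formula.iExs (Fin 1) (θ.relabel (Fin.lastCases (motive := fun _ => Fin n ⊕ Fin 1)
    (Sum.inr 0) Sum.inl))

theorem realize_existsLast {n : ℕ} (θ : L.Formula (Fin (n + 1))) {A : Type} [L.Structure A]
    (a : Fin n → A) :
    (existsLast θ).Realize a ↔ ∃ y : A, θ.Realize (Fin.snoc a y : Fin (n + 1) → A) := by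
  rw [existsLast, Formula.realize_iExs]
  have key : ∀ y : Fin 1 → A, Sum.elim a y ∘ (Fin.lastCases (motive := fun _ => Fin n ⊕ Fin 1)
      (Sum.inr 0) Sum.inl) = (Fin.snoc a (y 0) : Fin (n + 1) → A) := by
    intro y
    funext i
    refine Fin.lastCases ?_ (fun j => ?_) i
    · rw [snoc_last_apply, Function.comp_apply, Fin.lastCases_last]
      rfl
    · rw [snoc_castSucc_apply, Function.comp_apply, Fin.lastCases_castSucc]
      rfl
  simp only [Formula.realize_relabel, key]
  exact ⟨fun ⟨y, hy⟩ => ⟨y 0, hy⟩, fun ⟨y, hy⟩ => ⟨fun _ => y, hy⟩⟩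

variable [L.Structure ℕ]

/-- The structure with domain `ℕ` as a model of its complete theory. -/
abbrev natModel (L : FirstOrder.Language.{0, 0}) [L.Structure ℕ] :
    Theory.ModelType.{0, 0, 0} (L.completeTheory ℕ) :=
  Theory.ModelType.of (L.completeTheory ℕ) ℕ

/-- The universal closure is a sentence and the theory of `ℕ` is complete. This is the means of
transfer from `ℕ` to arbitrary models used throughout. -/
theorem forall_realize_iff {V : Type} [Finite V] (φ : L.Formula V)
    (A : Theory.ModelType.{0, 0, 0} (L.completeTheory ℕ)) :
    (∀ v : V → A, φ.Realize v) ↔ ∀ v : V → ℕ, φ.Realize v := by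
  rw [← realize_univClosure, ← realize_univClosure]
  constructor
  · intro h
    by_contra h'
    have : ∼(univClosure φ) ∈ L.completeTheory ℕ := by
      rw [mem_completeTheory, Sentence.realize_not]
      exact h'
    have := Theory.realize_sentence_of_mem (L.completeTheory ℕ) (M := A) this
    rw [Sentence.realize_not] at this
    exact this h
  · intro h
    exact Theory.realize_sentence_of_mem (L.completeTheory ℕ) (M := A) (mem_completeTheory.2 h)

theorem realize_of_forall {V : Type} [Finite V] {φ : L.Formula V}
    (h : ∀ v : V → ℕ, φ.Realize v) (A : Theory.ModelType.{0, 0, 0} (L.completeTheory ℕ))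
    (v : V → A) : φ.Realize v :=
  (forall_realize_iff φ A).2 h v

theorem iff_of_forall {V : Type} [Finite V] {φ ψ : L.Formula V}
    (h : ∀ v : V → ℕ, φ.Realize v ↔ ψ.Realize v)
    (A : Theory.ModelType.{0, 0, 0} (L.completeTheory ℕ)) (v : V → A) :
    φ.Realize v ↔ ψ.Realize v :=
  Formula.realize_iff.1 (realize_of_forall (φ := φ.iff ψ) (fun v => Formula.realize_iff.2 (h v)) A v)

theorem theory_iff_iff {V : Type} [Finite V] {φ ψ : L.Formula V} :
    (L.completeTheory ℕ).Iff φ ψ ↔ ∀ v : V → ℕ, φ.Realize v ↔ ψ.Realize v := by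
  have : (L.completeTheory ℕ).Iff φ ψ ↔ L.completeTheory ℕ ⊨ᵇ (φ.iff ψ : L.Formula V) := Iff.rfl
  rw [this, Theory.models_formula_iff]
  constructor
  · intro h v
    exact Formula.realize_iff.1 (h (natModel L) v)
  · intro h A v
    exact Formula.realize_iff.2 (iff_of_forall h A v)

theorem realize_comp_of_mem_autGroup {g : Equiv.Perm ℕ} (hg : g ∈ autGroup L) {V : Type}
    (φ : L.Formula V) (v : V → ℕ) : φ.Realize (g ∘ v) ↔ φ.Realize v := by
  obtain ⟨f, hf⟩ := hg
  rw [← show (f ∘ v) = g ∘ v from funext fun i => hf (v i), StrongHomClass.realize_formula f φ]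

theorem SameOrbit.realize_iff {V : Type} {c d : V → ℕ} (h : SameOrbit (autGroup L) c d)
    (φ : L.Formula V) : φ.Realize c ↔ φ.Realize d := by
  obtain ⟨g, hg, h⟩ := h
  rw [← realize_comp_of_mem_autGroup hg φ c, show g ∘ c = d from funext h]

theorem relMap_comp_of_mem_autGroup {g : Equiv.Perm ℕ} (hg : g ∈ autGroup L) {n : ℕ}
    (R : L.Relations n) (a : Fin n → ℕ) :
    Structure.RelMap R (g ∘ a) ↔ Structure.RelMap R a := by
  obtain ⟨f, hf⟩ := hg
  rw [← show (f ∘ a) = g ∘ a from funext fun i => hf (a i)]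
  exact f.map_rel R a

/-- The formulas of `α` do not distinguish `x` from `g ∘ x`. Comparing this coordinate map with `r`
is what produces the induced map on `G`. -/
theorem PreInterp.IsCoord.comp_perm {α : PreInterp L L} {r : (Fin α.dim → ℕ) → ℕ → Prop}
    (h : α.IsCoord ℕ ℕ r) {g : Equiv.Perm ℕ} (hg : g ∈ autGroup L) :
    α.IsCoord ℕ ℕ (fun x a => r (g ∘ x) a) where
  func x a b := h.func _ a b
  surj a := by
    obtain ⟨x, hx⟩ := h.surj a
    refine ⟨g.symm ∘ x, ?_⟩
    rwa [← Function.comp_assoc, Equiv.self_comp_symm, Function.id_comp]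
  dom_iff x := by rw [← h.dom_iff, realize_comp_of_mem_autGroup hg]
  eqv_iff x y := by rw [← h.eqv_iff, ← Sum.comp_elim, realize_comp_of_mem_autGroup hg]
  rel_iff R x := by rw [← realize_comp_of_mem_autGroup hg, h.rel_iff]; rfl

/-- Two tuples satisfy the same formulas. -/
def SameType {V A B : Type} [L.Structure A] [L.Structure B] (a : V → A) (b : V → B) : Prop :=
  ∀ φ : L.Formula V, φ.Realize a ↔ φ.Realize b

/-- Types over the empty set in `ℕ` are isolated. -/
theorem exists_isolating_formula (hG : IsOligomorphic (autGroup L)) {n : ℕ} (w : Fin n → ℕ) :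
    ∃ θ : L.Formula (Fin n), ∀ v : Fin n → ℕ, θ.Realize v ↔ SameType (L := L) w v := by
  classical
  obtain ⟨F, hF, hF'⟩ := hG.exists_reps n
  have : Finite F := hF
  -- For each of the finitely many orbit representatives, `ψ` either is trivial or separates `w`
  -- from it. The conjunction of these formulas isolates the type of `w`.
  have h1 : ∀ d : F, ∃ ψ : L.Formula (Fin n), ψ.Realize w ∧
      (ψ.Realize d.1 → SameType (L := L) w d.1) := by
    intro d
    by_cases h : SameType (L := L) w d.1
    · exact ⟨⊤, Formula.realize_top.2 trivial, fun _ => h⟩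
    · simp only [SameType, not_forall] at h
      obtain ⟨φ, hφ⟩ := h
      by_cases h2 : φ.Realize w
      · exact ⟨φ, h2, fun h3 => absurd (by tauto) hφ⟩
      · refine ⟨∼φ, Formula.realize_not.2 h2, fun h3 => absurd ?_ hφ⟩
        rw [Formula.realize_not] at h3
        tauto
  choose ψ hψ1 hψ2 using h1
  refine ⟨Formula.iInf ψ, fun v => ?_⟩
  rw [Formula.realize_iInf]
  constructor
  · intro h
    obtain ⟨d, hd, hvd⟩ := hF' v
    have := hψ2 ⟨d, hd⟩ ((hvd.realize_iff _).1 (h ⟨d, hd⟩))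
    exact fun φ => (this φ).trans (hvd.realize_iff φ).symm
  · intro h d
    exact (h _).1 (hψ1 d)

/-- The type of the extended tuple is isolated by some `θ`. "Some `y` satisfies `θ`" belongs to the
type of `a`, hence holds of `b`, and the implications from `θ` transfer to `N`. -/
theorem SameType.forth (hG : IsOligomorphic (autGroup L))
    {N : Theory.ModelType.{0, 0, 0} (L.completeTheory ℕ)} {n : ℕ} {a : Fin n → ℕ} {b : Fin n → N}
    (h : SameType (L := L) a b) (x : ℕ) :
    ∃ y : N, SameType (L := L) (Fin.snoc a x : Fin (n + 1) → ℕ)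
      (Fin.snoc b y : Fin (n + 1) → N) := by
  obtain ⟨θ, hθ⟩ := exists_isolating_formula hG (Fin.snoc a x : Fin (n + 1) → ℕ)
  obtain ⟨y, hy⟩ := (realize_existsLast θ b).1
    ((h _).1 ((realize_existsLast θ a).2 ⟨x, (hθ _).2 fun φ => Iff.rfl⟩))
  have key : ∀ φ : L.Formula (Fin (n + 1)), φ.Realize (Fin.snoc a x : Fin (n + 1) → ℕ) →
      φ.Realize (Fin.snoc b y : Fin (n + 1) → N) := by
    intro φ hφ
    exact Formula.realize_imp.1 (realize_of_forall (φ := θ.imp φ)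
      (fun v => Formula.realize_imp.2 fun hv => ((hθ v).1 hv φ).1 hφ) N _) hy
  refine ⟨y, fun φ => ⟨key φ, fun hφ => ?_⟩⟩
  by_contra h'
  exact Formula.realize_not.1 (key (∼φ) (Formula.realize_not.2 h')) hφ

/-- Finitely many isolating formulas cover all `(n + 1)`-tuples of `ℕ`, hence also those of `N`: no
model realizes a type that `ℕ` omits. One of them holds of the extended tuple in `N`, and its
existential quantification passes to `a`. -/
theorem SameType.back (hG : IsOligomorphic (autGroup L))
    {N : Theory.ModelType.{0, 0, 0} (L.completeTheory ℕ)} {n : ℕ} {a : Fin n → ℕ} {b : Fin n → N}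
    (h : SameType (L := L) a b) (y : N) :
    ∃ x : ℕ, SameType (L := L) (Fin.snoc a x : Fin (n + 1) → ℕ)
      (Fin.snoc b y : Fin (n + 1) → N) := by
  obtain ⟨F, hF, hF'⟩ := hG.exists_reps (n + 1)
  have : Finite F := hF
  choose θ hθ using fun w : Fin (n + 1) → ℕ => exists_isolating_formula hG w
  have h1 : (Formula.iSup fun d : F => θ d.1).Realize (Fin.snoc b y : Fin (n + 1) → N) := by
    refine realize_of_forall (fun v => ?_) N _
    rw [Formula.realize_iSup]
    obtain ⟨d, hd, hvd⟩ := hF' v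
    exact ⟨⟨d, hd⟩, (hθ d v).2 fun φ => (hvd.realize_iff φ).symm⟩
  obtain ⟨⟨d, _⟩, hd'⟩ := Formula.realize_iSup.1 h1
  have hd : (θ d).Realize (Fin.snoc b y : Fin (n + 1) → N) := hd'
  obtain ⟨x, hx⟩ := (realize_existsLast (θ d) a).1
    ((h _).2 ((realize_existsLast (θ d) b).2 ⟨y, hd⟩))
  have hx' := (hθ d _).1 hx
  refine ⟨x, fun φ => ?_⟩
  by_cases hφ : φ.Realize (Fin.snoc a x : Fin (n + 1) → ℕ)
  · refine iff_of_true hφ (Formula.realize_imp.1 (realize_of_forall (φ := (θ d).imp φ)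
      (fun v => Formula.realize_imp.2 fun hv => ?_) N _) hd)
    exact ((hθ d v).1 hv φ).1 ((hx' φ).2 hφ)
  · refine iff_of_false hφ (Formula.realize_not.1 (Formula.realize_imp.1
      (realize_of_forall (φ := (θ d).imp (∼φ))
      (fun v => Formula.realize_imp.2 fun hv => Formula.realize_not.2 ?_) N _) hd))
    rwa [← (hθ d v).1 hv φ, hx' φ]

/-- Homogeneity and categoricity of a countable model with oligomorphic automorphism group. -/
theorem SameType.exists_equiv [L.IsRelational] (hG : IsOligomorphic (autGroup L))
    {N : Theory.ModelType.{0, 0, 0} (L.completeTheory ℕ)} [Countable N] {n : ℕ}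
    {a : Fin n → ℕ} {b : Fin n → N} (h : SameType (L := L) a b) :
    ∃ e : ℕ ≃[L] N, ∀ i, e (a i) = b i := by
  obtain ⟨e, he, he'⟩ := exists_equiv_of_back_and_forth
    (fun n (a : Fin n → ℕ) (b : Fin n → N) => SameType (L := L) a b)
    (fun a b f h φ => by rw [← Formula.realize_relabel, ← Formula.realize_relabel]; exact h _)
    (fun a b h => by
      have := h (Term.equal (Term.var 0) (Term.var 1))
      rwa [Formula.realize_equal, Formula.realize_equal] at this)
    (fun a b h => h.forth hG) (fun a b h => h.back hG) a b h
  refine ⟨⟨e, fun {m} f => isEmptyElim f, fun {m} R c => ?_⟩, he⟩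
  have := he' m c (R.formula fun i => Term.var i)
  rw [Formula.realize_rel, Formula.realize_rel] at this
  exact this.symm

theorem SameType.sameOrbit [L.IsRelational] (hG : IsOligomorphic (autGroup L)) {n : ℕ}
    {a b : Fin n → ℕ} (h : SameType (L := L) a b) : SameOrbit (autGroup L) a b := by
  have : Countable (natModel L) := inferInstanceAs (Countable ℕ)
  obtain ⟨e, he⟩ := SameType.exists_equiv (N := natModel L) hG h
  exact ⟨e.toEquiv, ⟨e, fun x => rfl⟩, he⟩

/-- The empty tuples have the same type by completeness, so the back-and-forth can start from them.
-/
theorem nonempty_equiv_nat [L.IsRelational] (hG : IsOligomorphic (autGroup L))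
    (N : Theory.ModelType.{0, 0, 0} (L.completeTheory ℕ)) [Countable N] :
    Nonempty (N ≃[L] ℕ) := by
  obtain ⟨e, -⟩ := SameType.exists_equiv (N := N) hG (a := (Fin.elim0 : Fin 0 → ℕ))
    (b := (Fin.elim0 : Fin 0 → N)) (fun φ => by
      have := forall_realize_iff φ N
      constructor
      · intro h
        exact this.2 (fun v => by rwa [Subsingleton.elim v Fin.elim0]) _
      · intro h
        exact this.1 (fun v => by rwa [Subsingleton.elim v Fin.elim0]) _)
  exact ⟨e.symm⟩

/-- A set of tuples that is invariant under an oligomorphic automorphism group is definable. -/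
theorem exists_formula [L.IsRelational] (hG : IsOligomorphic (autGroup L)) {V : Type} [Finite V]
    (S : (V → ℕ) → Prop) (hS : ∀ c d, SameOrbit (autGroup L) c d → S c → S d) :
    ∃ φ : L.Formula V, ∀ v : V → ℕ, φ.Realize v ↔ S v := by
  obtain ⟨n, ⟨f⟩⟩ := Finite.exists_equiv_fin V
  obtain ⟨F, hF, hF'⟩ := hG.exists_reps n
  choose θ hθ using fun w : Fin n → ℕ => exists_isolating_formula hG w
  have : Finite {d : F // S (d.1 ∘ f)} := by
    have : Finite F := hF
    infer_instance
  -- Types and orbits coincide, so an invariant set is the union of the finitely many isolated types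
  -- of those representatives that it contains.
  refine ⟨(Formula.iSup fun d : {d : F // S (d.1 ∘ f)} => θ d.1.1).relabel f.symm, fun v => ?_⟩
  rw [Formula.realize_relabel, Formula.realize_iSup]
  have hv : (v ∘ f.symm) ∘ f = v := by funext i; simp
  constructor
  · rintro ⟨⟨⟨d, hd⟩, hSd⟩, h⟩
    have := (SameType.sameOrbit hG ((hθ d _).1 h)).comp f
    rw [hv] at this
    exact hS _ _ this hSd
  · intro h
    obtain ⟨d, hd, hvd⟩ := hF' (v ∘ f.symm)
    refine ⟨⟨⟨d, hd⟩, hS _ _ ?_ h⟩, (hθ d _).2 fun φ => (hvd.realize_iff φ).symm⟩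
    have := hvd.comp f
    rwa [hv] at this

/-- A formula involves only finitely many relation symbols. -/
theorem exists_finite_support [L.IsRelational] {V : Type} {n : ℕ} (φ : L.BoundedFormula V n) :
    ∃ S : Set (Σ n : ℕ, L.Relations n), S.Finite ∧ ∀ s : Equiv.Perm ℕ,
      (∀ R ∈ S, ∀ a : Fin R.1 → ℕ, Structure.RelMap R.2 (s ∘ a) ↔ Structure.RelMap R.2 a) →
      ∀ (v : V → ℕ) (xs : Fin n → ℕ), φ.Realize (s ∘ v) (s ∘ xs) ↔ φ.Realize v xs := by
  have ht : ∀ {n : ℕ} (t : L.Term (V ⊕ Fin n)) (s : Equiv.Perm ℕ) (v : V → ℕ) (xs : Fin n → ℕ),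
      t.realize (Sum.elim (s ∘ v) (s ∘ xs)) = s (t.realize (Sum.elim v xs)) := by
    intro n t s v xs
    rw [PreInterp.realize_termVar, PreInterp.realize_termVar]
    cases termVar t <;> rfl
  induction φ with
  | falsum => exact ⟨∅, Set.finite_empty, fun _ _ _ _ => Iff.rfl⟩
  | equal t₁ t₂ =>
    refine ⟨∅, Set.finite_empty, fun s _ v xs => ?_⟩
    simp only [BoundedFormula.Realize, ht, EmbeddingLike.apply_eq_iff_eq]
  | rel R ts =>
    refine ⟨{⟨_, R⟩}, Set.finite_singleton _, fun s hs v xs => ?_⟩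
    simp only [BoundedFormula.Realize, ht]
    exact hs ⟨_, R⟩ rfl _
  | imp φ ψ ih1 ih2 =>
    obtain ⟨S1, hS1, h1⟩ := ih1
    obtain ⟨S2, hS2, h2⟩ := ih2
    refine ⟨S1 ∪ S2, hS1.union hS2, fun s hs v xs => ?_⟩
    rw [BoundedFormula.realize_imp, BoundedFormula.realize_imp,
      h1 s (fun R hR => hs R (Or.inl hR)), h2 s (fun R hR => hs R (Or.inr hR))]
  | all φ ih =>
    obtain ⟨S, hS, h⟩ := ih
    refine ⟨S, hS, fun s hs v xs => ?_⟩
    rw [BoundedFormula.realize_all, BoundedFormula.realize_all, ← s.forall_congr_right]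
    refine forall_congr' fun x => ?_
    rw [← h s hs v, Fin.comp_snoc]

/-- `s` maps each orbit of `G` on `n`-tuples into itself. -/
def PreservesOrbits (G : Subgroup (Equiv.Perm ℕ)) (n : ℕ) (s : Equiv.Perm ℕ) : Prop :=
  ∀ c : Fin n → ℕ, SameOrbit G c (s ∘ c)

/-- Finitely many relation symbols suffice for defining all orbits on `n`-tuples. -/
theorem exists_finite_preservesOrbits [L.IsRelational] (hG : IsOligomorphic (autGroup L))
    (n : ℕ) : ∃ S : Set (Σ n : ℕ, L.Relations n), S.Finite ∧ ∀ s : Equiv.Perm ℕ,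
      (∀ R ∈ S, ∀ a : Fin R.1 → ℕ, Structure.RelMap R.2 (s ∘ a) ↔ Structure.RelMap R.2 a) →
      PreservesOrbits (autGroup L) n s := by
  obtain ⟨F, hF, hF'⟩ := hG.exists_reps n
  choose θ hθ using fun w : Fin n → ℕ => exists_isolating_formula hG w
  choose S hS hS' using fun w : Fin n → ℕ => exists_finite_support (θ w)
  refine ⟨⋃ w ∈ F, S w, hF.biUnion fun w _ => hS w, fun s hs c => ?_⟩
  -- Since `s` respects all symbols in the isolating formula of the orbit, `s ∘ c` satisfies it as
  -- `c` does.
  obtain ⟨d, hd, hcd⟩ := hF' c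
  have h1 : (θ d).Realize c := (hθ d c).2 fun φ => (hcd.realize_iff φ).symm
  have h2 := hS' d s (fun R hR => hs R (Set.mem_biUnion hd hR)) c Fin.elim0
  have h0 : ∀ (v : Fin n → ℕ) (xs : Fin 0 → ℕ),
      BoundedFormula.Realize (θ d) v xs ↔ (θ d).Realize v := fun v xs =>
    iff_of_eq (congrArg (BoundedFormula.Realize (θ d) v) (Subsingleton.elim _ _))
  have h3 : (θ d).Realize (s ∘ c) := (h0 _ _).1 (h2.2 ((h0 _ _).2 h1))
  exact hcd.trans (SameType.sameOrbit hG ((hθ d _).1 h3))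

end ModelTheory

/-! ## Interpretations and coordinate maps on `ℕ` -/

section Coordinates

variable {L : FirstOrder.Language.{0, 0}} [L.IsRelational] [L.Structure ℕ]

/-- An interpretation in the structure `ℕ` with a coordinate map onto `ℕ` is an interpretation
of the complete theory. -/
theorem PreInterp.IsCoord.isInterp {α : PreInterp L L} {r : (Fin α.dim → ℕ) → ℕ → Prop}
    (h : α.IsCoord ℕ ℕ r) : α.IsInterp (L.completeTheory ℕ) (L.completeTheory ℕ) where
  dom_nonempty A := by
    by_contra! H
    obtain ⟨x, hx⟩ := h.surj 0
    exact Formula.realize_not.1 ((forall_realize_iff (∼α.dom) A).1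
      (fun v => Formula.realize_not.2 (H v)) x) ((h.dom_iff x).2 ⟨0, hx⟩)
  eqv_dom A x y hxy := by
    have := realize_of_forall (φ := α.eqv.imp (α.dom.relabel Sum.inl ⊓ α.dom.relabel Sum.inr))
      (fun v => by
        rw [Formula.realize_imp, Formula.realize_inf, Formula.realize_relabel,
          Formula.realize_relabel, ← Sum.elim_comp_inl_inr v, h.eqv_iff]
        rintro ⟨a, h1, h2⟩
        exact ⟨(h.dom_iff _).2 ⟨a, h1⟩, (h.dom_iff _).2 ⟨a, h2⟩⟩) A (Sum.elim x y)
    rw [Formula.realize_imp, Formula.realize_inf, Formula.realize_relabel,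
          Formula.realize_relabel] at this
    exact this hxy
  eqv_refl A x hx := by
    have := realize_of_forall (φ := α.dom.imp (α.eqv.relabel (Sum.elim id id)))
      (fun v => by
        rw [Formula.realize_imp, Formula.realize_relabel, Sum.comp_elim, h.eqv_iff, h.dom_iff]
        rintro ⟨a, h1⟩
        exact ⟨a, h1, h1⟩) A x
    rw [Formula.realize_imp, Formula.realize_relabel, Sum.comp_elim] at this
    exact this hx
  eqv_symm A x y hxy := by
    have := realize_of_forall (φ := α.eqv.imp (α.eqv.relabel (Sum.elim Sum.inr Sum.inl)))
      (fun v => by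
        rw [Formula.realize_imp, Formula.realize_relabel, Sum.comp_elim, h.eqv_iff,
          ← Sum.elim_comp_inl_inr v, h.eqv_iff]
        rintro ⟨a, h1, h2⟩
        exact ⟨a, h2, h1⟩) A (Sum.elim x y)
    rw [Formula.realize_imp, Formula.realize_relabel, Sum.comp_elim] at this
    exact this hxy
  eqv_trans A x y z hxy hyz := by
    have := realize_of_forall (V := Fin α.dim ⊕ (Fin α.dim ⊕ Fin α.dim))
      (φ := (α.eqv.relabel (Sum.elim Sum.inl (Sum.inr ∘ Sum.inl))).imp
        ((α.eqv.relabel Sum.inr).imp (α.eqv.relabel (Sum.elim Sum.inl (Sum.inr ∘ Sum.inr)))))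
      (fun v => by
        rw [Formula.realize_imp, Formula.realize_imp, Formula.realize_relabel,
          Formula.realize_relabel, Formula.realize_relabel, Sum.comp_elim, Sum.comp_elim,
          ← Sum.elim_comp_inl_inr (v ∘ Sum.inr), h.eqv_iff, h.eqv_iff, h.eqv_iff]
        rintro ⟨a, h1, h2⟩ ⟨b, h3, h4⟩
        obtain rfl := h.func _ _ _ h2 h3
        exact ⟨a, h1, h4⟩) A (Sum.elim x (Sum.elim y z))
    rw [Formula.realize_imp, Formula.realize_imp, Formula.realize_relabel,
          Formula.realize_relabel, Formula.realize_relabel, Sum.comp_elim, Sum.comp_elim] at this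
    exact this hxy hyz
  rel_dom A n R x hx i := by
    have := realize_of_forall (φ := (α.rel R).imp (α.dom.relabel fun j => (i, j)))
      (fun v => by
        rw [Formula.realize_imp, Formula.realize_relabel, h.rel_iff]
        rintro ⟨a, h1, h2⟩
        exact (h.dom_iff _).2 ⟨a i, h1 i⟩) A x
    rw [Formula.realize_imp, Formula.realize_relabel] at this
    exact this hx
  rel_congr A n R x y hxy hx := by
    have := realize_of_forall (V := (Fin n × Fin α.dim) ⊕ (Fin n × Fin α.dim))
      (φ := (Formula.iInf fun i : Fin n => α.eqv.relabel
        (Sum.elim (fun j => Sum.inl (i, j)) (fun j => Sum.inr (i, j)))).imp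
        (((α.rel R).relabel Sum.inl).imp ((α.rel R).relabel Sum.inr)))
      (fun v => by
        simp only [Formula.realize_imp, Formula.realize_iInf, Formula.realize_relabel,
          Sum.comp_elim, h.rel_iff, h.eqv_iff]
        rintro H ⟨a, h1, h2⟩
        refine ⟨a, fun i => ?_, h2⟩
        obtain ⟨b, h3, h4⟩ := H i
        obtain rfl := h.func _ _ _ h3 (h1 i)
        exact h4) A (Sum.elim x y)
    simp only [Formula.realize_imp, Formula.realize_iInf, Formula.realize_relabel,
          Sum.comp_elim] at this
    exact this hxy hx
  translate_mem ψ hψ := by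
    rw [Theory.models_sentence_iff]
    intro A
    refine Theory.realize_sentence_of_mem (L.completeTheory ℕ) (M := A) ?_
    rw [mem_completeTheory] at hψ ⊢
    exact (h.realize_translateSentence ψ).2 hψ

/-- A surjective partial map from `k`-tuples onto `ℕ` for which the action of `G` on tuples
induces an action of elements of `G` on `ℕ`. -/
structure IsEquivariantCoord (G : Subgroup (Equiv.Perm ℕ)) {k : ℕ}
    (r : (Fin k → ℕ) → ℕ → Prop) (Φ : G → G) : Prop where
  func : ∀ x a b, r x a → r x b → a = b
  surj : ∀ a, ∃ x, r x a
  equivariant : ∀ (g : G) x a, r x a → r (g.1 ∘ x) ((Φ g).1 a)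

theorem IsEquivariantCoord.comp_sameOrbit {G : Subgroup (Equiv.Perm ℕ)} {k : ℕ}
    {r : (Fin k → ℕ) → ℕ → Prop} {Φ : G → G} (h : IsEquivariantCoord G r Φ) {V : Type}
    {c d : V → ℕ} (hcd : SameOrbit G c d) :
    ∃ g ∈ G, ∀ (f : Fin k → V) a, r (c ∘ f) a → r (d ∘ f) (g a) := by
  obtain ⟨g, hg, hgc⟩ := hcd
  obtain rfl : g ∘ c = d := funext hgc
  exact ⟨(Φ ⟨g, hg⟩).1, (Φ ⟨g, hg⟩).2, fun f a ha => h.equivariant ⟨g, hg⟩ _ _ ha⟩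

/-- The formulas defining the data of an equivariant coordinate map. -/
theorem IsEquivariantCoord.exists_isCoord (hG : IsOligomorphic (autGroup L)) {k : ℕ}
    (hk : 1 ≤ k) {r : (Fin k → ℕ) → ℕ → Prop} {Φ : autGroup L → autGroup L}
    (h : IsEquivariantCoord (autGroup L) r Φ) :
    ∃ (dom : L.Formula (Fin k)) (eqv : L.Formula (Fin k ⊕ Fin k))
      (rel : ∀ {n : ℕ}, L.Relations n → L.Formula (Fin n × Fin k)),
      (PreInterp.mk k hk dom eqv rel : PreInterp L L).IsCoord ℕ ℕ r := by
  obtain ⟨dom, hdom⟩ := exists_formula hG (fun x : Fin k → ℕ => ∃ a, r x a) (by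
    rintro c d hcd ⟨a, ha⟩
    obtain ⟨g, hg, H⟩ := h.comp_sameOrbit hcd
    exact ⟨_, H id a ha⟩)
  obtain ⟨eqv, heqv⟩ := exists_formula hG
    (fun x : Fin k ⊕ Fin k → ℕ => ∃ a, r (x ∘ Sum.inl) a ∧ r (x ∘ Sum.inr) a) (by
    rintro c d hcd ⟨a, ha, ha'⟩
    obtain ⟨g, hg, H⟩ := h.comp_sameOrbit hcd
    exact ⟨_, H _ a ha, H _ a ha'⟩)
  have hrel : ∀ (n : ℕ) (R : L.Relations n), ∃ φ : L.Formula (Fin n × Fin k),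
      ∀ x : Fin n × Fin k → ℕ, φ.Realize x ↔
        ∃ a : Fin n → ℕ, (∀ i, r (fun j => x (i, j)) (a i)) ∧ Structure.RelMap R a := by
    intro n R
    refine exists_formula hG _ ?_
    rintro c d hcd ⟨a, ha, ha'⟩
    obtain ⟨g, hg, H⟩ := h.comp_sameOrbit hcd
    exact ⟨g ∘ a, fun i => H (fun j => (i, j)) _ (ha i),
      (relMap_comp_of_mem_autGroup hg R a).2 ha'⟩
  choose rel hrel using hrel
  refine ⟨dom, eqv, fun {n} R => rel n R, h.func, h.surj, hdom, fun x y => heqv _,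
    fun {n} R x => hrel n R x⟩

/-- The interpretation `α` induces the map `Φ` on the automorphism group. -/
def Represents (α : Interpretation (L.completeTheory ℕ) (L.completeTheory ℕ))
    (Φ : autGroup L → autGroup L) : Prop :=
  ∃ r : (Fin α.dim → ℕ) → ℕ → Prop, α.IsCoord ℕ ℕ r ∧
    ∀ (g : autGroup L) x a, r x a → r (g.1 ∘ x) ((Φ g).1 a)

variable {α β : Interpretation (L.completeTheory ℕ) (L.completeTheory ℕ)}

/-- `D/E` is a countable model of the theory, so categoricity identifies it with `ℕ`. -/
theorem exists_isCoord_nat (hG : IsOligomorphic (autGroup L))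
    (α : Interpretation (L.completeTheory ℕ) (L.completeTheory ℕ)) :
    ∃ r : (Fin α.dim → ℕ) → ℕ → Prop, α.IsCoord ℕ ℕ r := by
  have : Countable (α.objModel (natModel L)) := by
    have : Countable (natModel L) := inferInstanceAs (Countable ℕ)
    exact inferInstanceAs (Countable (Quotient (α.setoid (natModel L))))
  obtain ⟨e⟩ := nonempty_equiv_nat hG (α.objModel (natModel L))
  exact ⟨_, (α.isCoord_rep (natModel L)).congr e⟩

/-- Both `r` and `x ↦ r (g ∘ x)` are coordinate maps of the same interpretation, so they differ by
an automorphism of the structure; that automorphism is `Φ g`. -/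
theorem PreInterp.IsCoord.exists_equivariant {α : PreInterp L L}
    {r : (Fin α.dim → ℕ) → ℕ → Prop} (h : α.IsCoord ℕ ℕ r) :
    ∃ Φ : autGroup L → autGroup L, ∀ g x a, r x a → r (g.1 ∘ x) ((Φ g).1 a) := by
  have : ∀ g : autGroup L, ∃ e : autGroup L, ∀ x a, r x a → r (g.1 ∘ x) (e.1 a) := by
    rintro ⟨g, hg⟩
    obtain ⟨e, he⟩ := Interpretation.exists_equiv h (h.comp_perm hg)
    exact ⟨⟨e.toEquiv, e, fun _ => rfl⟩, fun x a => (he x a).1⟩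
  choose Φ hΦ using this
  exact ⟨Φ, hΦ⟩

theorem exists_represents (hG : IsOligomorphic (autGroup L))
    (α : Interpretation (L.completeTheory ℕ) (L.completeTheory ℕ)) :
    ∃ Φ : autGroup L → autGroup L, Represents α Φ := by
  obtain ⟨r, hr⟩ := exists_isCoord_nat hG α
  obtain ⟨Φ, hΦ⟩ := hr.exists_equivariant
  exact ⟨Φ, r, hr, hΦ⟩

/-- Transporting `r` along the homotopy gives the coordinate map "`y` is related by `Θ` to some `x`
with value `a`" for `β`. It is equivariant for the same `Φ` because `Θ` is `G`-invariant. -/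
theorem Represents.of_homotopic {Φ : autGroup L → autGroup L} (h : Represents α Φ)
    (H : Interpretation.Homotopic α β) : Represents β Φ := by
  obtain ⟨r, hr, hΦ⟩ := h
  obtain ⟨Θ, hΘ⟩ := H
  obtain ⟨e, he⟩ := hΘ (natModel L)
  obtain ⟨e₁, he₁⟩ := Interpretation.exists_equiv (α.isCoord_rep (natModel L)) hr
  refine ⟨_, (β.isCoord_rep (natModel L)).congr (e₁.comp e.symm), ?_⟩
  have key : ∀ y a, (∃ b, β.Rep (natModel L) y b ∧ e₁.comp e.symm b = a) ↔
      ∃ x, Θ.Realize (Sum.elim x y) ∧ r x a := by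
    intro y a
    constructor
    · rintro ⟨b, ⟨hy, rfl⟩, rfl⟩
      obtain ⟨x, hx, hxb⟩ := (α.isCoord_rep (natModel L)).surj (e.symm (β.proj (natModel L) y hy))
      refine ⟨x, (he _ _).2 ⟨hx, hy, ?_⟩, (he₁ _ _).1 ⟨hx, hxb⟩⟩
      rw [hxb, FirstOrder.Language.Equiv.apply_symm_apply]
    · rintro ⟨x, hx, hr'⟩
      obtain ⟨hx, hy, hxy⟩ := (he _ _).1 hx
      refine ⟨_, ⟨hy, rfl⟩, ?_⟩
      rw [FirstOrder.Language.Equiv.comp_apply, ← hxy, FirstOrder.Language.Equiv.symm_apply_apply]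
      exact hr.func _ _ _ ((he₁ _ _).1 ⟨hx, rfl⟩) hr'
  intro g y a hya
  obtain ⟨x, hx, hr'⟩ := (key _ _).1 hya
  refine (key _ _).2 ⟨g.1 ∘ x, ?_, hΦ g _ _ hr'⟩
  exact (iff_of_eq (congrArg (Formula.Realize (M := ℕ) Θ) (Sum.comp_elim g.1 x y))).1
    ((realize_comp_of_mem_autGroup g.2 Θ (Sum.elim x y)).2 hx)

theorem Represents.comp {Φ Ψ : autGroup L → autGroup L} (h : Represents α Φ)
    (h' : Represents β Ψ) : Represents (β.comp α) (Ψ ∘ Φ) := by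
  obtain ⟨r, hr, hΦ⟩ := h
  obtain ⟨s, hs, hΨ⟩ := h'
  refine ⟨PreInterp.compRel r s, hr.comp hs, ?_⟩
  rintro g x c ⟨b, hb, hc⟩
  exact ⟨_, fun i => hΦ g _ _ (hb i), hΨ _ _ _ hc⟩

theorem represents_one : Represents (Interpretation.one (L.completeTheory ℕ)) id :=
  ⟨_, PreInterp.isCoord_id ℕ, fun g x a hxa => by rw [← hxa]; rfl⟩

/-- Two coordinate maps for `α` differ by an automorphism `e` of the structure, which intertwines
the two induced actions. -/
theorem Represents.exists_conj {Φ Ψ : autGroup L → autGroup L} (h : Represents α Φ)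
    (h' : Represents α Ψ) : ∃ e : autGroup L, ∀ g, Ψ g = e * Φ g * e⁻¹ := by
  obtain ⟨r, hr, hΦ⟩ := h
  obtain ⟨s, hs, hΨ⟩ := h'
  obtain ⟨e, he⟩ := Interpretation.exists_equiv hr hs
  refine ⟨⟨e.toEquiv, e, fun _ => rfl⟩, fun g => ?_⟩
  rw [eq_mul_inv_iff_mul_eq]
  ext a
  obtain ⟨x, hx⟩ := hr.surj a
  exact hs.func _ _ _ (hΨ g _ _ ((he _ _).1 hx)) ((he _ _).1 (hΦ g _ _ hx))

/-- The coordinate map is followed by the automorphism `e`. -/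
theorem Represents.conj {Φ : autGroup L → autGroup L} (h : Represents α Φ) (e : autGroup L) :
    Represents α (fun g => e * Φ g * e⁻¹) := by
  obtain ⟨r, hr, hΦ⟩ := h
  obtain ⟨f, hf⟩ := e.2
  refine ⟨_, hr.congr f, ?_⟩
  rintro g x a ⟨b, hb, rfl⟩
  refine ⟨_, hΦ g _ _ hb, ?_⟩
  rw [hf, hf]
  simp

end Coordinates

/-! ### Homotopies detected on `ℕ`, and the realization of automorphisms by interpretations -/

section Homotopy

variable {L : FirstOrder.Language.{0, 0}} [L.IsRelational] [L.Structure ℕ]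

variable {α β : Interpretation (L.completeTheory ℕ) (L.completeTheory ℕ)}

/-- A formula that defines in `ℕ` the relation "`x` and `y` represent the same element" for two
coordinate maps is a homotopy. -/
theorem homotopic_of_nat {r : (Fin α.dim → ℕ) → ℕ → Prop} {s : (Fin β.dim → ℕ) → ℕ → Prop}
    (hr : α.IsCoord ℕ ℕ r) (hs : β.IsCoord ℕ ℕ s) (Θ : L.Formula (Fin α.dim ⊕ Fin β.dim))
    (hΘ : ∀ x y, Θ.Realize (Sum.elim x y) ↔ ∃ a, r x a ∧ s y a) :
    Interpretation.Homotopic α β := by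
  -- This and the following `t_` facts express in first-order terms that `Θ` is an isomorphism. They
  -- are checked in `ℕ` with the coordinate maps and then transferred to every model.
  have t_func : ∀ (A : Theory.ModelType.{0, 0, 0} (L.completeTheory ℕ)) (x : Fin α.dim → A)
      (y y' : Fin β.dim → A), Θ.Realize (Sum.elim x y) →
      (Θ.Realize (Sum.elim x y') ↔ β.eqv.Realize (Sum.elim y y')) := by
    intro A x y y'
    have := realize_of_forall (V := Fin α.dim ⊕ (Fin β.dim ⊕ Fin β.dim))
      (φ := (Θ.relabel (Sum.elim Sum.inl (Sum.inr ∘ Sum.inl))).imp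
        ((Θ.relabel (Sum.elim Sum.inl (Sum.inr ∘ Sum.inr))).iff (β.eqv.relabel Sum.inr)))
      (fun v => by
        rw [Formula.realize_imp, Formula.realize_iff, Formula.realize_relabel,
          Formula.realize_relabel, Formula.realize_relabel, Sum.comp_elim, Sum.comp_elim,
          ← Sum.elim_comp_inl_inr (v ∘ Sum.inr), hs.eqv_iff, hΘ, hΘ]
        rintro ⟨a, h1, h2⟩
        constructor
        · rintro ⟨b, h3, h4⟩
          obtain rfl := hr.func _ _ _ h1 h3
          exact ⟨a, h2, h4⟩
        · rintro ⟨b, h3, h4⟩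
          obtain rfl := hs.func _ _ _ h2 h3
          exact ⟨a, h1, h4⟩) A (Sum.elim x (Sum.elim y y'))
    rw [Formula.realize_imp, Formula.realize_iff, Formula.realize_relabel,
          Formula.realize_relabel, Formula.realize_relabel, Sum.comp_elim, Sum.comp_elim] at this
    exact this
  have t_surj : ∀ (A : Theory.ModelType.{0, 0, 0} (L.completeTheory ℕ)) (y : Fin β.dim → A),
      β.dom.Realize y ↔ ∃ x, Θ.Realize (Sum.elim x y) := by
    intro A y
    have := iff_of_forall (φ := β.dom)
      (ψ := Formula.iExs (Fin α.dim) (Θ.relabel (Sum.elim Sum.inr Sum.inl)))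
      (fun v => by
        simp only [Formula.realize_iExs, Formula.realize_relabel, Sum.comp_elim,
          Sum.elim_comp_inl, Sum.elim_comp_inr, hΘ, hs.dom_iff]
        constructor
        · rintro ⟨a, ha⟩
          obtain ⟨x, hx⟩ := hr.surj a
          exact ⟨x, a, hx, ha⟩
        · rintro ⟨x, a, -, ha⟩
          exact ⟨a, ha⟩) A y
    simpa only [Formula.realize_iExs, Formula.realize_relabel, Sum.comp_elim,
          Sum.elim_comp_inl, Sum.elim_comp_inr] using this
  have t_dom : ∀ (A : Theory.ModelType.{0, 0, 0} (L.completeTheory ℕ)) (x : Fin α.dim → A),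
      α.dom.Realize x ↔ ∃ y, Θ.Realize (Sum.elim x y) := by
    intro A x
    have := iff_of_forall (φ := α.dom) (ψ := Formula.iExs (Fin β.dim) Θ)
      (fun v => by
        simp only [Formula.realize_iExs, hΘ, hr.dom_iff]
        constructor
        · rintro ⟨a, ha⟩
          obtain ⟨x, hx⟩ := hs.surj a
          exact ⟨x, a, ha, hx⟩
        · rintro ⟨x, a, ha, -⟩
          exact ⟨a, ha⟩) A x
    simpa only [Formula.realize_iExs] using this
  have t_eqv : ∀ (A : Theory.ModelType.{0, 0, 0} (L.completeTheory ℕ)) (x x' : Fin α.dim → A),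
      α.eqv.Realize (Sum.elim x x') ↔
        ∃ y, Θ.Realize (Sum.elim x y) ∧ Θ.Realize (Sum.elim x' y) := by
    intro A x x'
    have := iff_of_forall (φ := α.eqv) (ψ := Formula.iExs (Fin β.dim)
        ((Θ.relabel (Sum.elim (Sum.inl ∘ Sum.inl) Sum.inr) :
          L.Formula ((Fin α.dim ⊕ Fin α.dim) ⊕ Fin β.dim)) ⊓
          Θ.relabel (Sum.elim (Sum.inl ∘ Sum.inr) Sum.inr)))
      (fun v => by
        rw [← Sum.elim_comp_inl_inr v]
        simp only [Formula.realize_iExs, Formula.realize_inf, Formula.realize_relabel,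
          Sum.comp_elim, ← Function.comp_assoc,
          Sum.elim_comp_inl, Sum.elim_comp_inr, hΘ, hr.eqv_iff]
        constructor
        · rintro ⟨a, ha, ha'⟩
          obtain ⟨y, hy⟩ := hs.surj a
          exact ⟨y, ⟨a, ha, hy⟩, a, ha', hy⟩
        · rintro ⟨y, ⟨a, ha, hy⟩, b, hb, hy'⟩
          obtain rfl := hs.func _ _ _ hy hy'
          exact ⟨a, ha, hb⟩) A (Sum.elim x x')
    simpa only [Formula.realize_iExs, Formula.realize_inf, Formula.realize_relabel,
          Sum.comp_elim, ← Function.comp_assoc,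
          Sum.elim_comp_inl, Sum.elim_comp_inr] using this
  have t_rel : ∀ (A : Theory.ModelType.{0, 0, 0} (L.completeTheory ℕ)) {n : ℕ}
      (R : L.Relations n) (x : Fin n × Fin α.dim → A), (α.rel R).Realize x ↔
        ∃ y : Fin n × Fin β.dim → A, (∀ i, Θ.Realize
          (Sum.elim (fun j => x (i, j)) (fun j => y (i, j)))) ∧ (β.rel R).Realize y := by
    intro A n R x
    have := iff_of_forall (φ := α.rel R) (ψ := Formula.iExs (Fin n × Fin β.dim)
        ((Formula.iInf fun i : Fin n => (Θ.relabel
          (Sum.elim (fun j => Sum.inl (i, j)) (fun j => Sum.inr (i, j))) :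
          L.Formula ((Fin n × Fin α.dim) ⊕ (Fin n × Fin β.dim)))) ⊓
          (β.rel R).relabel Sum.inr))
      (fun v => by
        simp only [Formula.realize_iExs, Formula.realize_inf, Formula.realize_iInf,
          Formula.realize_relabel, Sum.comp_elim, Sum.elim_comp_inr]
        simp only [Function.comp_def, Sum.elim_inl, Sum.elim_inr, hΘ, hr.rel_iff, hs.rel_iff]
        constructor
        · rintro ⟨a, ha, ha'⟩
          choose y hy using fun i => hs.surj (a i)
          exact ⟨fun p => y p.1 p.2, fun i => ⟨a i, ha i, hy i⟩, a, hy, ha'⟩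
        · rintro ⟨y, H, b, hb, hb'⟩
          refine ⟨b, fun i => ?_, hb'⟩
          obtain ⟨a, ha, hy⟩ := H i
          obtain rfl := hs.func _ _ _ hy (hb i)
          exact ha) A x
    simp only [Formula.realize_iExs, Formula.realize_inf, Formula.realize_iInf,
          Formula.realize_relabel, Sum.comp_elim, Sum.elim_comp_inr] at this
    exact this
  refine Interpretation.homotopic_of_isCoord Θ fun A => ?_
  have h := β.isCoord_rep A
  refine ⟨β.objModel A, fun x a => ∃ y, Θ.Realize (Sum.elim x y) ∧ β.Rep A y a, _,
    ⟨?_, ?_, ?_, ?_, ?_⟩, h, ?_⟩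
  · rintro x a b ⟨y, h1, h2⟩ ⟨y', h3, h4⟩
    exact (h.eqv_iff' h2 h4).1 ((t_func A x y y' h1).1 h3)
  · intro a
    obtain ⟨y, hy⟩ := h.surj a
    obtain ⟨x, hx⟩ := (t_surj A y).1 ((h.dom_iff y).2 ⟨a, hy⟩)
    exact ⟨x, y, hx, hy⟩
  · intro x
    rw [t_dom]
    constructor
    · rintro ⟨y, hy⟩
      obtain ⟨a, ha⟩ := (h.dom_iff y).1 ((t_surj A y).2 ⟨x, hy⟩)
      exact ⟨a, y, hy, ha⟩
    · rintro ⟨a, y, hy, -⟩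
      exact ⟨y, hy⟩
  · intro x x'
    rw [t_eqv]
    constructor
    · rintro ⟨y, hy, hy'⟩
      obtain ⟨a, ha⟩ := (h.dom_iff y).1 ((t_surj A y).2 ⟨x, hy⟩)
      exact ⟨a, ⟨y, hy, ha⟩, y, hy', ha⟩
    · rintro ⟨a, ⟨y, hy, ha⟩, y', hy', ha'⟩
      exact ⟨y, hy, (t_func A _ _ _ hy').2 ((h.eqv_iff' ha' ha).2 rfl)⟩
  · intro n R x
    rw [t_rel]
    constructor
    · rintro ⟨y, hy, hR⟩
      obtain ⟨a, ha, ha'⟩ := (h.rel_iff R y).1 hR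
      exact ⟨a, fun i => ⟨_, hy i, ha i⟩, ha'⟩
    · rintro ⟨a, H, ha⟩
      choose y hy hya using H
      exact ⟨fun p => y p.1 p.2, hy, (h.rel_iff R _).2 ⟨a, hya, ha⟩⟩
  · intro x y
    constructor
    · intro hxy
      obtain ⟨a, ha⟩ := (h.dom_iff y).1 ((t_surj A y).2 ⟨x, hxy⟩)
      exact ⟨a, ⟨y, hxy, ha⟩, ha⟩
    · rintro ⟨a, ⟨y', hy, ha⟩, ha'⟩
      exact (t_func A _ _ _ hy).2 ((h.eqv_iff' ha ha').2 rfl)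

/-- Interpretations that induce the same map on the automorphism group are homotopic. -/
theorem Represents.homotopic (hG : IsOligomorphic (autGroup L)) {Φ : autGroup L → autGroup L}
    (h : Represents α Φ) (h' : Represents β Φ) : Interpretation.Homotopic α β := by
  obtain ⟨r, hr, hΦ⟩ := h
  obtain ⟨s, hs, hΦ'⟩ := h'
  obtain ⟨Θ, hΘ⟩ := exists_formula hG
    (fun v : Fin α.dim ⊕ Fin β.dim → ℕ => ∃ a, r (v ∘ Sum.inl) a ∧ s (v ∘ Sum.inr) a) (by
      rintro c d ⟨g, hg, hcd⟩ ⟨a, ha, ha'⟩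
      obtain rfl : g ∘ c = d := funext hcd
      exact ⟨_, hΦ ⟨g, hg⟩ _ _ ha, hΦ' ⟨g, hg⟩ _ _ ha'⟩)
  exact homotopic_of_nat hr hs Θ fun x y => hΘ _

/-- The value of `Φ` at an element is forced by its action on representing tuples, and actions
compose. -/
theorem Represents.map_mul {Φ : autGroup L → autGroup L} (h : Represents α Φ)
    (g k : autGroup L) : Φ (g * k) = Φ g * Φ k := by
  obtain ⟨r, hr, hΦ⟩ := h
  ext a
  obtain ⟨x, hx⟩ := hr.surj a
  exact hr.func _ _ _ (hΦ (g * k) _ _ hx) (hΦ g _ _ (hΦ k _ _ hx))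

/-- The value of `Φ g` at `a` is determined by `g` on a single finite tuple representing `a`. -/
theorem Represents.continuous {Φ : autGroup L → autGroup L} (h : Represents α Φ) :
    Continuous Φ := by
  obtain ⟨r, hr, hΦ⟩ := h
  refine continuous_induced_rng.2 (continuous_induced_rng.2 (continuous_pi fun a => ?_))
  obtain ⟨x, hx⟩ := hr.surj a
  refine continuous_iff_continuousAt.2 fun g => continuousAt_of_eventually_eq ?_
  have : ∀ᶠ k : autGroup L in nhds g, ∀ i, k.1 (x i) = g.1 (x i) := by
    rw [Filter.eventually_all]
    exact fun i => (isOpen_apply_eq _ _ _).mem_nhds rfl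
  filter_upwards [this] with k hk
  have e : k.1 ∘ x = g.1 ∘ x := funext hk
  have h1 := hΦ k _ _ hx
  rw [e] at h1
  exact hr.func _ _ _ h1 (hΦ g _ _ hx)

/-- Each automorphism of the topological group `G` is induced by an interpretation. -/
theorem exists_represents_contAut (hG : IsOligomorphic (autGroup L))
    (Φ : ContAut (autGroup L)) :
    ∃ α : Interpretation (L.completeTheory ℕ) (L.completeTheory ℕ), Represents α Φ.1 := by
  classical
  obtain ⟨N₁, hN₁⟩ := hG.exists_bound 1
  have hst : ∀ a : ℕ, ∃ m : ℕ, ∀ g : autGroup L, (∀ i < m, g.1 i = i) → (Φ.1 g).1 a = a := by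
    intro a
    have h1 : {g : autGroup L | (Φ.1 g).1 a = a} ∈ nhds (1 : autGroup L) :=
      ((isOpen_apply_eq (autGroup L) a a).preimage Φ.2.1).mem_nhds (by simp)
    exact exists_fixing_of_mem_nhds h1
  choose m hm using hst
  -- `N₁` bounds representatives of the orbits on points. Fixing all numbers below `N` forces `Φ g`
  -- to fix each `a < N₁`.
  let N : ℕ := N₁ + (Finset.range N₁).sup m + 2
  have hN : ∀ a < N₁, m a ≤ N := fun a ha =>
    (Finset.le_sup (f := m) (Finset.mem_range.2 ha)).trans (by omega)
  -- The first half of `t a` records how a group element acts below `N`. The second half encodes `a`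
  -- as the only position with entry `0`, so that translates of `t a` and `t b` are never equal for
  -- distinct `a`, `b` below `N₁`.
  let t : ℕ → Fin (N + N) → ℕ := fun a => Fin.append (fun j : Fin N => (j : ℕ))
    (fun j : Fin N => if (j : ℕ) = a then 0 else 1)
  have ht1 : ∀ (a : ℕ) (j : ℕ) (hj : j < N), t a (Fin.castAdd N ⟨j, hj⟩) = j := fun a j hj => by
    simp only [t, Fin.append_left]
  have ht2 : ∀ (a : ℕ) (j : ℕ) (hj : j < N), t a (Fin.natAdd N ⟨j, hj⟩) = 0 ↔ j = a :=
    fun a j hj => by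
      simp only [t, Fin.append_right]
      split_ifs with h <;> simp [h]
  -- Equivariance forces this definition once `t a` is declared to represent `a`; well-definedness
  -- is the point to be proved.
  let r : (Fin (N + N) → ℕ) → ℕ → Prop := fun x b =>
    ∃ (g : autGroup L) (a : ℕ), a < N₁ ∧ x = g.1 ∘ t a ∧ b = (Φ.1 g).1 a
  have hr : IsEquivariantCoord (autGroup L) r Φ.1 := by
    refine ⟨?_, ?_, ?_⟩
    · rintro x _ _ ⟨g, a, ha, rfl, rfl⟩ ⟨h, b, hb, hx, rfl⟩
      have hx' : ∀ i, g.1 (t a i) = h.1 (t b i) := fun i => congrFun hx i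
      have hgh : ∀ j < N, g.1 j = h.1 j := by
        intro j hj
        have := hx' (Fin.castAdd N ⟨j, hj⟩)
        rwa [ht1, ht1] at this
      have haN : a < N := by omega
      have e1 := (ht2 a a haN).2 rfl
      have e2 := hx' (Fin.natAdd N ⟨a, haN⟩)
      rw [e1, hgh 0 (by omega)] at e2
      obtain rfl : a = b := (ht2 b a haN).1 (h.1.injective e2).symm
      -- The first halves agree, so `h⁻¹ * g` fixes every number below `N`, and `Φ (h⁻¹ * g)` fixes
      -- `a`.
      have e3 := hm a (h⁻¹ * g) (fun i hi => by
        change h.1⁻¹ (g.1 i) = i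
        rw [hgh i (hi.trans_le (hN a ha))]
        exact h.1.symm_apply_apply i)
      rw [map_mul, map_inv] at e3
      change (Φ.1 h).1⁻¹ ((Φ.1 g).1 a) = a at e3
      rwa [Equiv.Perm.inv_eq_iff_eq] at e3
    · intro b
      obtain ⟨d, ⟨g, hg, hgd⟩, hd⟩ := hN₁ (fun _ => b)
      refine ⟨_, Φ.1.symm ⟨g, hg⟩⁻¹, d 0, hd 0, rfl, ?_⟩
      rw [MulEquiv.apply_symm_apply, ← hgd 0]
      exact (g.symm_apply_apply b).symm
    · rintro g x _ ⟨h, a, ha, rfl, rfl⟩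
      refine ⟨g * h, a, ha, rfl, ?_⟩
      rw [map_mul]
      rfl
  obtain ⟨dom, eqv, rel, H⟩ := hr.exists_isCoord hG (by omega : 1 ≤ N + N)
  exact ⟨⟨_, H.isInterp⟩, r, H, hr.equivariant⟩

end Homotopy

/-! ## The topological group `Aut(G)` -/

section ContAut

variable {G : Type} [Group G] [TopologicalSpace G]

theorem coe_mul_image (Φ Ψ : ContAut G) (A : Set G) :
    (Φ * Ψ).1 '' A = Φ.1 '' (Ψ.1 '' A) :=
  Set.image_comp Φ.1 Ψ.1 A

theorem coe_one_image (A : Set G) : (1 : ContAut G).1 '' A = A :=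
  Set.image_id A

theorem coe_inv_image_eq_iff (Φ : ContAut G) (A B : Set G) :
    (Φ⁻¹).1 '' A = B ↔ Φ.1 '' B = A := by
  constructor
  · rintro rfl
    rw [← coe_mul_image, mul_inv_cancel, coe_one_image]
  · rintro rfl
    rw [← coe_mul_image, inv_mul_cancel, coe_one_image]

theorem IsOpenCoset.image {A : Set G} (hA : IsOpenCoset A) (Φ : ContAut G) :
    IsOpenCoset (Φ.1 '' A) := by
  obtain ⟨V, a, rfl⟩ := hA
  refine ⟨V.comap (Φ.1.symm : G →* G) Φ.2.2, Φ.1 a, ?_⟩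
  ext x
  simp only [Set.mem_image, SetLike.mem_coe]
  constructor
  · rintro ⟨_, ⟨u, hu, rfl⟩, rfl⟩
    refine ⟨Φ.1 u, ?_, (map_mul _ _ _).symm⟩
    change Φ.1.symm (Φ.1 u) ∈ V
    rwa [MulEquiv.symm_apply_apply]
  · rintro ⟨u, hu, rfl⟩
    exact ⟨_, ⟨_, hu, rfl⟩, by simp⟩

/-- If some automorphism carries `A` to `B`, then `B` is itself an open coset and the set is a
generator of the topology; otherwise the set is empty. -/
theorem isOpen_image_eq {A B : Set G} (hA : IsOpenCoset A) :
    IsOpen {Φ : ContAut G | Φ.1 '' A = B} := by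
  by_cases h : ∃ Ψ : ContAut G, Ψ.1 '' A = B
  · obtain ⟨Ψ, rfl⟩ := h
    exact TopologicalSpace.isOpen_generateFrom_of_mem ⟨A, _, hA, hA.image Ψ, rfl⟩
  · convert isOpen_empty
    exact Set.eq_empty_of_forall_notMem fun Φ hΦ => h ⟨Φ, hΦ⟩

/-- An open set is built from generators by finite intersections and unions, so finitely many cosets
control membership near a point. -/
theorem exists_cosets_of_mem_nhds {Φ : ContAut G} {U : Set (ContAut G)} (hU : U ∈ nhds Φ) :
    ∃ F : Set (Set G), F.Finite ∧ (∀ A ∈ F, IsOpenCoset A) ∧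
      ∀ Ψ : ContAut G, (∀ A ∈ F, Ψ.1 '' A = Φ.1 '' A) → Ψ ∈ U := by
  obtain ⟨V, hVU, hV, hΦ⟩ := mem_nhds_iff.1 hU
  suffices H : ∃ F : Set (Set G), F.Finite ∧ (∀ A ∈ F, IsOpenCoset A) ∧
      ∀ Ψ : ContAut G, (∀ A ∈ F, Ψ.1 '' A = Φ.1 '' A) → Ψ ∈ V by
    obtain ⟨F, h1, h2, h3⟩ := H
    exact ⟨F, h1, h2, fun Ψ hΨ => hVU (h3 Ψ hΨ)⟩
  clear hU hVU
  induction hV with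
  | basic W hW =>
    obtain ⟨A, B, hA, hB, rfl⟩ := hW
    refine ⟨{A}, Set.finite_singleton A, by simpa using hA, fun Ψ hΨ => ?_⟩
    exact (hΨ A rfl).trans hΦ
  | univ => exact ⟨∅, Set.finite_empty, by simp, fun _ _ => trivial⟩
  | inter V W _ _ ih1 ih2 =>
    obtain ⟨F1, h1, h2, h3⟩ := ih1 hΦ.1
    obtain ⟨F2, h4, h5, h6⟩ := ih2 hΦ.2
    refine ⟨F1 ∪ F2, h1.union h4, ?_, fun Ψ hΨ =>
      ⟨h3 Ψ fun A hA => hΨ A (Or.inl hA), h6 Ψ fun A hA => hΨ A (Or.inr hA)⟩⟩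
    rintro A (hA | hA)
    exacts [h2 A hA, h5 A hA]
  | sUnion S _ ih =>
    obtain ⟨W, hW, hΦW⟩ := hΦ
    obtain ⟨F, h1, h2, h3⟩ := ih W hW hΦW
    exact ⟨F, h1, h2, fun Ψ hΨ => ⟨W, hW, h3 Ψ hΨ⟩⟩

/-- Near `(Φ, Ψ)` the product acts on `A` in the same way as soon as the second factor agrees with
`Ψ` on `A` and the first agrees with `Φ` on `Ψ(A)`. Inversion exchanges the source and target
cosets. -/
instance contAut_isTopologicalGroup : IsTopologicalGroup (ContAut G) where
  continuous_mul := by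
    refine continuous_generateFrom_iff.2 ?_
    rintro _ ⟨A, B, hA, hB, rfl⟩
    refine isOpen_iff_mem_nhds.2 ?_
    rintro ⟨Φ, Ψ⟩ h
    have h' : Φ.1 '' (Ψ.1 '' A) = B := (coe_mul_image Φ Ψ A).symm.trans h
    filter_upwards [((isOpen_image_eq (B := B) (hA.image Ψ)).prod
      (isOpen_image_eq (B := Ψ.1 '' A) hA)).mem_nhds ⟨h', rfl⟩]
    rintro ⟨Φ', Ψ'⟩ ⟨h1, h2⟩
    change (Φ' * Ψ').1 '' A = B
    rw [coe_mul_image, show Ψ'.1 '' A = Ψ.1 '' A from h2]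
    exact h1
  continuous_inv := by
    refine continuous_generateFrom_iff.2 ?_
    rintro _ ⟨A, B, hA, hB, rfl⟩
    convert isOpen_image_eq (B := A) hB using 1
    ext Φ
    exact coe_inv_image_eq_iff Φ A B

/-- The automorphisms that fix each coset in a given set. -/
def cosetStabilizer (F : Set (Set G)) : Subgroup (ContAut G) where
  carrier := {Φ | ∀ A ∈ F, Φ.1 '' A = A}
  mul_mem' := by
    intro Φ Ψ h1 h2 A hA
    rw [coe_mul_image, h2 A hA, h1 A hA]
  one_mem' A _ := coe_one_image A
  inv_mem' := by
    intro Φ h A hA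
    exact (coe_inv_image_eq_iff Φ A A).2 (h A hA)

theorem isOpen_cosetStabilizer {F : Set (Set G)} (hF : F.Finite)
    (hF' : ∀ A ∈ F, IsOpenCoset A) : IsOpen (cosetStabilizer F : Set (ContAut G)) := by
  have : (cosetStabilizer F : Set (ContAut G)) = ⋂ A ∈ F, {Φ | Φ.1 '' A = A} := by
    ext Φ
    simp [cosetStabilizer]
  rw [this]
  exact hF.isOpen_biInter fun A hA => isOpen_image_eq (hF' A hA)

/-- Stabilizers of finitely many open cosets are open subgroups, and the quotient map is open. -/
instance out_nonarchimedean : NonarchimedeanGroup (Out G) where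
  is_nonarchimedean := by
    intro U hU
    have h1 : (QuotientGroup.mk : ContAut G → Out G) ⁻¹' U ∈ nhds (1 : ContAut G) :=
      QuotientGroup.continuous_mk.continuousAt.preimage_mem_nhds hU
    obtain ⟨F, hF, hF', H⟩ := exists_cosets_of_mem_nhds h1
    refine ⟨⟨(cosetStabilizer F).map (QuotientGroup.mk' (Inn G)),
      QuotientGroup.isOpenMap_coe _ (isOpen_cosetStabilizer hF hF')⟩, ?_⟩
    rintro _ ⟨Φ, hΦ, rfl⟩
    exact H Φ fun A hA => (hΦ A hA).trans (coe_one_image A).symm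

end ContAut

/-! ### Automorphisms of a permutation group compared by means of permutations of `ℕ` -/

section Perm

variable {G : Subgroup (Equiv.Perm ℕ)}

theorem isOpenCoset_apply_eq (g : G) (a : ℕ) : IsOpenCoset {h : G | h.1 a = g.1 a} := by
  refine ⟨⟨(MulAction.stabilizer (Equiv.Perm ℕ) a).subgroupOf G, ?_⟩, g, ?_⟩
  · exact isOpen_apply_eq G a a
  · ext h
    constructor
    · intro hh
      refine ⟨g⁻¹ * h, ?_, by simp⟩
      change g.1⁻¹ (h.1 a) = a
      rw [Equiv.Perm.inv_eq_iff_eq]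
      exact hh
    · rintro ⟨u, hu, rfl⟩
      exact congrArg g.1 hu

/-- Automorphisms near `Φ` act like `Φ` on numbers below `N`. -/
theorem eventually_apply_eq_iff (Φ : ContAut G) (N : ℕ) : ∀ᶠ Ψ : ContAut G in nhds Φ,
    ∀ g : G, ∀ a < N, ∀ b < N, ((Ψ.1 g).1 a = b ↔ (Φ.1 g).1 a = b) := by
  have key : ∀ a b : ℕ, ∀ᶠ Ψ : ContAut G in nhds Φ, (∃ g : G, g.1 a = b) →
      ∀ g : G, ((Ψ.1 g).1 a = b ↔ (Φ.1 g).1 a = b) := by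
    intro a b
    by_cases h : ∃ g : G, g.1 a = b
    · obtain ⟨g₀, rfl⟩ := h
      have h1 := isOpenCoset_apply_eq g₀ a
      -- Sending `a` to `g₀ a` defines an open coset. An automorphism that maps the `Φ`-preimage of
      -- this coset back onto it satisfies the same condition as `Φ`.
      have h2 := isOpen_image_eq (B := {h : G | h.1 a = g₀.1 a}) (h1.image Φ⁻¹)
      have h3 : Φ.1 '' ((Φ⁻¹).1 '' {h : G | h.1 a = g₀.1 a}) = {h : G | h.1 a = g₀.1 a} := by
        rw [← coe_mul_image, mul_inv_cancel, coe_one_image]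
      filter_upwards [h2.mem_nhds h3] with Ψ hΨ _ g
      have e1 : ∀ Φ' : ContAut G, Φ'.1 '' ((Φ⁻¹).1 '' {h : G | h.1 a = g₀.1 a}) =
          {h : G | h.1 a = g₀.1 a} →
          ((Φ'.1 g).1 a = g₀.1 a ↔ g ∈ (Φ⁻¹).1 '' {h : G | h.1 a = g₀.1 a}) := by
        intro Φ' h
        change Φ'.1 g ∈ {h : G | h.1 a = g₀.1 a} ↔ _
        conv_lhs => rw [← h]
        exact Φ'.1.injective.mem_set_image
      rw [e1 Ψ hΨ, e1 Φ h3]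
    · exact Filter.Eventually.of_forall fun Ψ h' => absurd h' h
  have : ∀ᶠ Ψ : ContAut G in nhds Φ, ∀ a ∈ Finset.range N, ∀ b ∈ Finset.range N,
      (∃ g : G, g.1 a = b) → ∀ g : G, ((Ψ.1 g).1 a = b ↔ (Φ.1 g).1 a = b) := by
    simp only [Filter.eventually_all_finset]
    exact fun a _ b _ => key a b
  filter_upwards [this] with Ψ hΨ g a ha b hb
  have h := hΨ a (Finset.mem_range.2 ha) b (Finset.mem_range.2 hb)
  constructor
  · intro h'
    exact (h ⟨_, h'⟩ g).1 h'
  · intro h'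
    exact (h ⟨_, h'⟩ g).2 h'

/-- Two automorphisms of `G` that act in the same way on numbers below some bound differ by a
permutation of `ℕ`. -/
theorem exists_perm_of_apply_eq_iff {N : ℕ}
    (hN : ∀ c : Fin 1 → ℕ, ∃ d, SameOrbit G c d ∧ ∀ i, d i < N) {Φ Ψ : MulAut G}
    (h : ∀ g : G, ∀ a < N, ∀ b < N, ((Ψ g).1 a = b ↔ (Φ g).1 a = b)) :
    ∃ s : Equiv.Perm ℕ, (∀ g b, s ((Φ g).1 b) = (Ψ g).1 (s b)) ∧ ∀ a < N, s a = a := by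
  have hsurj : ∀ Φ : MulAut G, ∀ b, ∃ (g : G) (a : ℕ), a < N ∧ (Φ g).1 a = b := by
    intro Φ b
    obtain ⟨d, ⟨g, hg, hgd⟩, hd⟩ := hN (fun _ => b)
    refine ⟨Φ.symm ⟨g, hg⟩⁻¹, d 0, hd 0, ?_⟩
    rw [MulEquiv.apply_symm_apply, ← hgd 0]
    exact g.symm_apply_apply b
  -- Moving `k` to the other side turns every coincidence of values into a condition covered by `h`.
  have hrel : ∀ (Φ : MulAut G) (g k : G) (a b : ℕ), (Φ g).1 a = (Φ k).1 b ↔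
      (Φ (k⁻¹ * g)).1 a = b := by
    intro Φ g k a b
    rw [map_mul, map_inv]
    change _ ↔ (Φ k).1⁻¹ ((Φ g).1 a) = b
    rw [Equiv.Perm.inv_eq_iff_eq]
  have hrel' : ∀ (g k : G) (a b : ℕ), a < N → b < N →
      ((Ψ g).1 a = (Ψ k).1 b ↔ (Φ g).1 a = (Φ k).1 b) := by
    intro g k a b ha hb
    rw [hrel, hrel, h _ a ha b hb]
  choose k t ht hk using hsurj
  have spec : ∀ (Φ₁ Φ₂ : MulAut G), (∀ (g k : G) (a b : ℕ), a < N → b < N →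
      ((Φ₂ g).1 a = (Φ₂ k).1 b ↔ (Φ₁ g).1 a = (Φ₁ k).1 b)) → ∀ g a, a < N →
      (Φ₂ (k Φ₁ ((Φ₁ g).1 a))).1 (t Φ₁ ((Φ₁ g).1 a)) = (Φ₂ g).1 a := by
    intro Φ₁ Φ₂ H g a ha
    rw [H _ _ _ _ (ht _ _) ha, hk]
  have specΦ := spec Φ Ψ hrel'
  have specΨ := spec Ψ Φ fun g k a b ha hb => (hrel' g k a b ha hb).symm
  -- The permutation sends `Φ(g) a` to `Ψ(g) a` for `a < N`. By `hrel'` this does not depend on the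
  -- presentation of the point, and exchanging `Φ` and `Ψ` gives the inverse.
  refine ⟨⟨fun b => (Ψ (k Φ b)).1 (t Φ b), fun b => (Φ (k Ψ b)).1 (t Ψ b), fun b => ?_,
    fun b => ?_⟩, fun g b => ?_, fun a ha => ?_⟩
  · exact (specΨ _ _ (ht _ _)).trans (hk _ _)
  · exact (specΦ _ _ (ht _ _)).trans (hk _ _)
  · change (Ψ (k Φ ((Φ g).1 b))).1 (t Φ ((Φ g).1 b)) = (Ψ g).1 ((Ψ (k Φ b)).1 (t Φ b))
    have e : (Φ g).1 b = (Φ (g * k Φ b)).1 (t Φ b) := by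
      rw [map_mul]
      exact congrArg (Φ g).1 (hk Φ b).symm
    rw [e, specΦ _ _ (ht _ _), map_mul]
    rfl
  · have := specΦ 1 a ha
    simpa using this

/-- Write `c = g ∘ d` with `d` below `N`. As `s` fixes the entries of `d`, it sends `c` to `Ψ(Φ⁻¹ g)
∘ d`, which is again in the orbit of `d`. -/
theorem preservesOrbits_of_apply_eq {N n : ℕ}
    (hN : ∀ c : Fin n → ℕ, ∃ d, SameOrbit G c d ∧ ∀ i, d i < N) {Φ Ψ : MulAut G}
    {s : Equiv.Perm ℕ} (hs : ∀ g b, s ((Φ g).1 b) = (Ψ g).1 (s b)) (hs' : ∀ a < N, s a = a) :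
    PreservesOrbits G n s := by
  intro c
  obtain ⟨d, hcd, hd⟩ := hN c
  refine hcd.trans ?_
  obtain ⟨g, hg, hgd⟩ := hcd.symm
  obtain rfl : g ∘ d = c := funext hgd
  refine ⟨(Ψ (Φ.symm ⟨g, hg⟩)).1, (Ψ _).2, fun i => ?_⟩
  have := hs (Φ.symm ⟨g, hg⟩) (d i)
  rw [hs' _ (hd i), MulEquiv.apply_symm_apply] at this
  exact this.symm

/-- A permutation that fixes sufficiently many numbers and preserves the orbits on tuples respects
a given open coset. -/
theorem mem_coset_iff_of_preservesOrbits {B : Set G} {m : ℕ}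
    (hB : ∀ x z w : G, (∀ i < m, z.1 i = i) → (∀ i < m, w.1 i = i) → (z * x * w ∈ B ↔ x ∈ B))
    {s : Equiv.Perm ℕ} (hs : ∀ a < m, s a = a) (hs' : PreservesOrbits G (m + m) s)
    {x y : G} (hxy : ∀ a, y.1 (s a) = s (x.1 a)) : x ∈ B ↔ y ∈ B := by
  -- On the numbers below `m` and their images under `x`, the permutation `s` can be replaced by
  -- some `z` in `G`. Then `z * x` and `y` agree below `m`, so `y` is `z * x * w` with both `z` and
  -- `w` fixing the numbers below `m`.
  obtain ⟨z, hz, H⟩ := hs' (Fin.append (fun i : Fin m => (i : ℕ)) (fun i : Fin m => x.1 i))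
  have h1 : ∀ i < m, z i = i := by
    intro i hi
    have := H (Fin.castAdd m ⟨i, hi⟩)
    simp only [Function.comp_apply, Fin.append_left] at this
    rw [this, hs i hi]
  have h2 : ∀ i < m, z (x.1 i) = y.1 i := by
    intro i hi
    have := H (Fin.natAdd m ⟨i, hi⟩)
    simp only [Function.comp_apply, Fin.append_right] at this
    rw [this, ← hxy, hs i hi]
  have := hB x ⟨z, hz⟩ (x⁻¹ * ⟨z, hz⟩⁻¹ * y) h1 (fun i hi => by
    change x.1⁻¹ (z⁻¹ (y.1 i)) = i
    rw [Equiv.Perm.inv_eq_iff_eq, Equiv.Perm.inv_eq_iff_eq, h2 i hi])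
  rw [← this]
  have e : (⟨z, hz⟩ : G) * x * (x⁻¹ * ⟨z, hz⟩⁻¹ * y) = y := by group
  rw [e]

theorem exists_fixing_of_finite {F : Set (Set G)} (hF : F.Finite)
    (hF' : ∀ A ∈ F, IsOpenCoset A) : ∃ m : ℕ, ∀ B ∈ F, ∀ x z w : G, (∀ i < m, z.1 i = i) →
      (∀ i < m, w.1 i = i) → (z * x * w ∈ B ↔ x ∈ B) := by
  choose! m hm using fun A hA => exists_fixing_mul_mul (hF' A hA)
  obtain ⟨M, hM⟩ := (hF.image m).bddAbove
  refine ⟨M, fun B hB x z w hz hw => hm B hB x z w (fun i hi => hz i ?_) fun i hi => hw i ?_⟩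
  · exact hi.trans_le (hM ⟨B, hB, rfl⟩)
  · exact hi.trans_le (hM ⟨B, hB, rfl⟩)

end Perm

/-! ## `Out(G)` for oligomorphic `G` -/

section Out

variable {G : Subgroup (Equiv.Perm ℕ)}

/-- For an ultrafilter, a tuple that depends on the parameter is eventually in a fixed orbit. -/
theorem IsOligomorphic.exists_eventually_sameOrbit (hG : IsOligomorphic G) {X : Type}
    (u : Ultrafilter X) {n : ℕ} (c : X → Fin n → ℕ) :
    ∃ d : Fin n → ℕ, ∀ᶠ x in (u : Filter X), SameOrbit G d (c x) := by
  obtain ⟨F, hF, hF'⟩ := hG.exists_reps n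
  have h : (⋃ d ∈ F, {x | SameOrbit G d (c x)}) ∈ u := by
    refine Filter.mem_of_superset Filter.univ_mem fun x _ => ?_
    obtain ⟨d, hd, h⟩ := hF' (c x)
    exact Set.mem_biUnion hd h.symm
  obtain ⟨d, -, hd⟩ := (Ultrafilter.finite_biUnion_mem_iff hF).1 h
  exact ⟨d, hd⟩

theorem mem_inn_iff {Φ : ContAut G} : Φ ∈ Inn G ↔ ∃ g : G, ∀ h, Φ.1 h = g * h * g⁻¹ := by
  rw [Inn, Subgroup.mem_subgroupOf, MonoidHom.mem_range]
  refine exists_congr fun g => ?_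
  rw [MulEquiv.ext_iff]
  simp only [MulAut.conj_apply, eq_comm]

/-- The stabilizer of a point has only finitely many fixed points. -/
theorem IsOligomorphic.exists_eventually_eq (hG : IsOligomorphic G) {X : Type}
    (u : Ultrafilter X) (f : X → G) (a : ℕ)
    (h : ∀ᶠ x in (u : Filter X), ∀ᶠ y in (u : Filter X), ∀ k : G, k.1 ((f x).1 a) = (f x).1 a →
      k.1 ((f y).1 a) = (f y).1 a) :
    ∃ b, ∀ᶠ x in (u : Filter X), (f x).1 a = b := by
  obtain ⟨x₀, hx₀⟩ := h.exists
  -- Eventually all these pairs share one orbit. An element of `G` that carries one pair to another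
  -- fixes the common first entry, hence by assumption the second entry too, so the second entries
  -- coincide.
  obtain ⟨d, hd⟩ := hG.exists_eventually_sameOrbit u (fun y => ![(f x₀).1 a, (f y).1 a])
  obtain ⟨y₀, ⟨g₀, hg₀, hy₀⟩, -⟩ := (hd.and hx₀).exists
  refine ⟨(f y₀).1 a, ?_⟩
  filter_upwards [hd, hx₀] with y ⟨g, hg, hy⟩ hy'
  have e0 : g₀ (d 0) = (f x₀).1 a := hy₀ 0
  have e1 : g₀ (d 1) = (f y₀).1 a := hy₀ 1
  have e2 : g (d 0) = (f x₀).1 a := hy 0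
  have e3 : g (d 1) = (f y).1 a := hy 1
  have := hy' (⟨g₀, hg₀⟩ * ⟨g, hg⟩⁻¹) (by
    change g₀ (g⁻¹ _) = _
    rw [← e2]
    exact (congrArg g₀ (g.symm_apply_apply _)).trans (e0.trans e2.symm))
  rw [← this, ← e1, ← e3]
  exact congrArg g₀ (g.symm_apply_apply _)

/-- Stabilizers are written as cosets of the form in `isOpenCoset_apply_eq`, with identity element
`1`, so that the topology of `ContAut G` applies to them directly. -/
theorem image_stabilizer_of_conj {Φ : ContAut G} {g : G} (h : ∀ k, Φ.1 k = g * k * g⁻¹)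
    (a : ℕ) : Φ.1 '' {k : G | k.1 a = (1 : G).1 a} = {k : G | k.1 (g.1 a) = g.1 a} := by
  ext k
  constructor
  · rintro ⟨k, hk, rfl⟩
    rw [h]
    change g.1 (k.1 (g.1⁻¹ (g.1 a))) = g.1 a
    rw [show g.1⁻¹ (g.1 a) = a from g.1.symm_apply_apply a, show k.1 a = a from hk]
  · intro hk
    refine ⟨g⁻¹ * k * g, ?_, by rw [h]; group⟩
    change g.1⁻¹ (k.1 (g.1 a)) = a
    rw [show k.1 (g.1 a) = g.1 a from hk]
    exact g.1.symm_apply_apply a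

/-- Let inner automorphisms converge to `Φ` along an ultrafilter. The image of the stabilizer of `a`
is the stabilizer of the translate of `a` by the conjugating element, and it is eventually constant.
As a stabilizer has few fixed points, the translate itself is eventually constant. The limit of the
conjugating elements lies in `G` because `G` is closed, and it induces `Φ`. -/
theorem isClosed_inn (hG : IsOligomorphic G) : IsClosed (Inn G : Set (ContAut G)) := by
  refine isClosed_of_closure_subset fun Φ hΦ => ?_
  obtain ⟨u, hu, huΦ⟩ := mem_closure_iff_ultrafilter.1 hΦ
  have h1 : ∀ Ψ : ContAut G, ∃ g : G, Ψ ∈ Inn G → ∀ h, Ψ.1 h = g * h * g⁻¹ := by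
    intro Ψ
    by_cases h : Ψ ∈ Inn G
    · obtain ⟨g, hg⟩ := mem_inn_iff.1 h
      exact ⟨g, fun _ => hg⟩
    · exact ⟨1, fun h' => absurd h' h⟩
  choose f hf using h1
  have hu' : ∀ᶠ Ψ in (u : Filter (ContAut G)), ∀ h, Ψ.1 h = f Ψ * h * (f Ψ)⁻¹ := by
    filter_upwards [hu] with Ψ hΨ using hf Ψ hΨ
  have ev : ∀ {A : Set G}, IsOpenCoset A → ∀ᶠ Ψ in (u : Filter (ContAut G)),
      Ψ.1 '' A = Φ.1 '' A := fun hA =>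
    huΦ ((isOpen_image_eq hA).mem_nhds rfl)
  have ev' : ∀ {A : Set G}, IsOpenCoset A → ∀ᶠ Ψ in (u : Filter (ContAut G)),
      (Ψ⁻¹).1 '' A = (Φ⁻¹).1 '' A := fun hA =>
    (tendsto_inv Φ).mono_left huΦ ((isOpen_image_eq hA).mem_nhds rfl)
  have hlim : ∀ a, ∃ b, ∀ᶠ Ψ in (u : Filter (ContAut G)), (f Ψ).1 a = b := by
    intro a
    refine hG.exists_eventually_eq u f a ?_
    have hA := isOpenCoset_apply_eq (1 : G) a
    filter_upwards [ev hA, hu'] with Ψ h1 h2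
    filter_upwards [ev hA, hu'] with Ψ' h1' h2' k hk
    have e := h1.trans h1'.symm
    rw [image_stabilizer_of_conj h2, image_stabilizer_of_conj h2'] at e
    exact (Set.ext_iff.1 e k).1 hk
  -- A pointwise limit of permutations may fail to be surjective, so the inverses need a limit as
  -- well.
  have hlim' : ∀ a, ∃ b, ∀ᶠ Ψ in (u : Filter (ContAut G)), ((f Ψ)⁻¹).1 a = b := by
    intro a
    refine hG.exists_eventually_eq u (fun Ψ => (f Ψ)⁻¹) a ?_
    have hA := isOpenCoset_apply_eq (1 : G) a
    have hinv : ∀ Ψ : ContAut G, (∀ h, Ψ.1 h = f Ψ * h * (f Ψ)⁻¹) →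
        ∀ h, (Ψ⁻¹).1 h = (f Ψ)⁻¹ * h * ((f Ψ)⁻¹)⁻¹ := by
      intro Ψ hΨ h
      apply Ψ.1.injective
      rw [hΨ ((f Ψ)⁻¹ * h * ((f Ψ)⁻¹)⁻¹)]
      refine (Ψ.1.apply_symm_apply h).trans ?_
      group
    filter_upwards [ev' hA, hu'] with Ψ h1 h2
    filter_upwards [ev' hA, hu'] with Ψ' h1' h2' k hk
    have e := h1.trans h1'.symm
    rw [image_stabilizer_of_conj (hinv _ h2), image_stabilizer_of_conj (hinv _ h2')] at e
    exact (Set.ext_iff.1 e k).1 hk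
  choose g hg using hlim
  choose g' hg' using hlim'
  let e : Equiv.Perm ℕ := ⟨g, g', fun a => by
    obtain ⟨Ψ, h1, h2⟩ := ((hg a).and (hg' (g a))).exists
    rw [← h2, ← h1]
    exact (f Ψ).1.symm_apply_apply a, fun a => by
    obtain ⟨Ψ, h1, h2⟩ := ((hg (g' a)).and (hg' a)).exists
    rw [← h1, ← h2]
    exact (f Ψ).1.apply_symm_apply a⟩
  have he : e ∈ G := by
    refine mem_of_forall_sameOrbit hG.1 fun n c => ?_
    have : ∀ᶠ Ψ in (u : Filter (ContAut G)), ∀ i, (f Ψ).1 (c i) = g (c i) :=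
      Filter.eventually_all.2 fun i => hg (c i)
    obtain ⟨Ψ, hΨ⟩ := this.exists
    exact ⟨(f Ψ).1, (f Ψ).2, hΨ⟩
  refine mem_inn_iff.2 ⟨⟨e, he⟩, fun h => ?_⟩
  ext a
  have hA := (isOpenCoset_apply_eq (Φ.1 h) a).image Φ⁻¹
  have hB : Φ.1 '' ((Φ⁻¹).1 '' {k : G | k.1 a = (Φ.1 h).1 a}) = {k : G | k.1 a = (Φ.1 h).1 a} := by
    rw [← coe_mul_image, mul_inv_cancel, coe_one_image]
  have hmem : h ∈ (Φ⁻¹).1 '' {k : G | k.1 a = (Φ.1 h).1 a} :=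
    ⟨Φ.1 h, rfl, Φ.1.symm_apply_apply h⟩
  obtain ⟨Ψ, h1, h2, h3, h4⟩ :=
    ((ev hA).and (hu'.and ((hg' a).and (hg (h.1 (g' a)))))).exists
  have h5 : Ψ.1 h ∈ {k : G | k.1 a = (Φ.1 h).1 a} := by
    rw [← hB, ← h1]
    exact Set.mem_image_of_mem _ hmem
  have h6 : (Ψ.1 h).1 a = (Φ.1 h).1 a := h5
  rw [← h6, h2]
  change (f Ψ).1 (h.1 ((f Ψ)⁻¹.1 a)) = g (h.1 (g' a))
  rw [h3, h4]

/-- Conjugation by an element of the normalizer of `G`. -/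
def conjContAut (s : Subgroup.normalizer (G : Set (Equiv.Perm ℕ))) : ContAut G :=
  ⟨G.normalizerMonoidHom s, by
    have key : ∀ s : Subgroup.normalizer (G : Set (Equiv.Perm ℕ)),
        Continuous (G.normalizerMonoidHom s : G → G) := by
      intro s
      refine continuous_induced_rng.2 ?_
      change Continuous fun g : G => s.1 * g.1 * s.1⁻¹
      fun_prop
    refine ⟨key s, ?_⟩
    have := key s⁻¹
    rwa [map_inv] at this⟩

theorem conjContAut_apply (s : Subgroup.normalizer (G : Set (Equiv.Perm ℕ))) (g : G) (a : ℕ) :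
    ((conjContAut s).1 g).1 (s.1 a) = s.1 (g.1 a) := by
  change s.1 (g.1 (s.1⁻¹ (s.1 a))) = _
  rw [show s.1⁻¹ (s.1 a) = a from s.1.symm_apply_apply a]

theorem conjContAut_mul (s t : Subgroup.normalizer (G : Set (Equiv.Perm ℕ))) :
    conjContAut (s * t) = conjContAut s * conjContAut t :=
  Subtype.ext (map_mul G.normalizerMonoidHom s t)

/-- The elements of `Out(G)` given by conjugation with a permutation form a neighbourhood of the
identity. -/
theorem range_conjContAut_mem_nhds (hG : IsOligomorphic G) :
    Set.range (fun s : Subgroup.normalizer (G : Set (Equiv.Perm ℕ)) =>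
      (QuotientGroup.mk (conjContAut s) : Out G)) ∈ nhds (1 : Out G) := by
  obtain ⟨N, hN⟩ := hG.exists_bound 1
  have h1 := eventually_apply_eq_iff (1 : ContAut G) N
  have h2 := (QuotientGroup.isOpenMap_coe (N := Inn G)).image_mem_nhds h1
  refine Filter.mem_of_superset h2 ?_
  rintro _ ⟨Ψ, hΨ, rfl⟩
  obtain ⟨s, hs, -⟩ := exists_perm_of_apply_eq_iff hN (Φ := (1 : ContAut G).1) (Ψ := Ψ.1) hΨ
  have e : ∀ g : G, s * g.1 * s⁻¹ = (Ψ.1 g).1 := by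
    intro g
    rw [mul_inv_eq_iff_eq_mul]
    ext b
    exact hs g b
  have hsN : s ∈ Subgroup.normalizer (G : Set (Equiv.Perm ℕ)) := by
    rw [Subgroup.mem_normalizer_iff]
    intro g
    constructor
    · intro hg
      rw [e ⟨g, hg⟩]
      exact (Ψ.1 _).2
    · intro hg
      have := e (Ψ.1.symm ⟨_, hg⟩)
      rw [MulEquiv.apply_symm_apply] at this
      have h3 : (Ψ.1.symm ⟨_, hg⟩).1 = g := by simpa using this
      rw [← h3]
      exact (Ψ.1.symm ⟨_, hg⟩).2
  refine ⟨⟨s, hsN⟩, congrArg _ (Subtype.ext (MulEquiv.ext fun g => Subtype.ext (e g)))⟩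

/-- Modulo `G`, each ultrafilter on the normalizer of `G` converges to a permutation of `ℕ` in
its action on orbits of tuples. -/
theorem IsOligomorphic.exists_perm_eventually_sameOrbit (hG : IsOligomorphic G) {X : Type}
    (u : Ultrafilter X) (s : X → Subgroup.normalizer (G : Set (Equiv.Perm ℕ))) :
    ∃ e : Equiv.Perm ℕ, ∀ (n : ℕ) (c : Fin n → ℕ),
      ∀ᶠ x in (u : Filter X), SameOrbit G ((s x).1 ∘ c) (e ∘ c) := by
  have comp_snoc : ∀ (g : Equiv.Perm ℕ) {n : ℕ} (c : Fin n → ℕ) (y : ℕ),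
      g ∘ (Fin.snoc c y : Fin (n + 1) → ℕ) = (Fin.snoc (g ∘ c) (g y) : Fin (n + 1) → ℕ) :=
    fun g n c y => Fin.comp_snoc g c y
  obtain ⟨e, -, he⟩ := exists_equiv_of_back_and_forth
    (fun n (c d : Fin n → ℕ) => ∀ᶠ x in (u : Filter X), SameOrbit G ((s x).1 ∘ c) d)
    (fun a b f h => by
      filter_upwards [h] with x hx using hx.comp f)
    (fun a b h => by
      obtain ⟨x, g, hg, hx⟩ := h.exists
      rw [← hx 0, ← hx 1]
      simp)
    (fun {n} a b h y => by
      obtain ⟨d, hd⟩ := hG.exists_eventually_sameOrbit u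
        (fun x => (s x).1 ∘ (Fin.snoc a y : Fin (n + 1) → ℕ))
      obtain ⟨x₀, ⟨g, hg, hx₀⟩, hd₀⟩ := (h.and hd).exists
      refine ⟨g ((s x₀).1 y), ?_⟩
      filter_upwards [hd] with x hx
      refine hx.symm.trans (hd₀.trans ⟨g, hg, fun i => ?_⟩)
      rw [show b = g ∘ ((s x₀).1 ∘ a) from (funext hx₀).symm, ← comp_snoc, ← comp_snoc]
      rfl)
    (fun {n} a b h y => by
      have h' : ∀ x, ∃ g : G, SameOrbit G ((s x).1 ∘ a) b → g.1 ∘ ((s x).1 ∘ a) = b := by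
        intro x
        by_cases hx : SameOrbit G ((s x).1 ∘ a) b
        · obtain ⟨g, hg, hgx⟩ := hx
          exact ⟨⟨g, hg⟩, fun _ => funext hgx⟩
        · exact ⟨1, fun hx' => absurd hx' hx⟩
      choose g hg using h'
      obtain ⟨d, hd⟩ := hG.exists_eventually_sameOrbit u
        (fun x => (Fin.snoc a ((s x).1.symm ((g x).1.symm y)) : Fin (n + 1) → ℕ))
      obtain ⟨x₀, hd₀⟩ := hd.exists
      refine ⟨(s x₀).1.symm ((g x₀).1.symm y), ?_⟩
      filter_upwards [h, hd] with x hx hdx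
      -- The preimage of `y` depends on `x`. Some `k` in `G` moves the one chosen at `x₀` to the one
      -- at `x` while fixing `a`, and normality turns `k` into the element `s k s⁻¹` of `G` acting
      -- after `s`.
      obtain ⟨k, hk, hkx⟩ := hd₀.symm.trans hdx
      have h1 : (s x).1 * k⁻¹ * (s x).1⁻¹ ∈ G :=
        (Subgroup.mem_normalizer_iff.1 (s x).2 _).1 (G.inv_mem hk)
      have h2 : g x * ((s x).1 * k⁻¹ * (s x).1⁻¹)⁻¹ ∈ G := G.mul_mem (g x).2 (G.inv_mem h1)
      refine ⟨_, h2, fun i => ?_⟩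
      have e1 : ∀ z, (g x * ((s x).1 * k⁻¹ * (s x).1⁻¹)⁻¹ : Equiv.Perm ℕ) ((s x).1 z) =
          (g x).1 ((s x).1 (k z)) := by
        intro z
        simp [mul_assoc]
      refine (e1 _).trans ?_
      rw [hkx i]
      refine Fin.lastCases ?_ (fun j => ?_) i
      · rw [snoc_last_apply, snoc_last_apply, Equiv.apply_symm_apply, Equiv.apply_symm_apply]
      · rw [snoc_castSucc_apply, snoc_castSucc_apply]
        exact congrFun (hg x hx) j)
    (Fin.elim0 : Fin 0 → ℕ) (Fin.elim0 : Fin 0 → ℕ)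
    (Filter.Eventually.of_forall fun x => ⟨1, G.one_mem, fun i => i.elim0⟩)
  exact ⟨e, he⟩

theorem SameOrbit.comp_normalizer {n : ℕ} {c d : Fin n → ℕ} (h : SameOrbit G c d)
    {s : Equiv.Perm ℕ} (hs : s ∈ Subgroup.normalizer (G : Set (Equiv.Perm ℕ))) :
    SameOrbit G (s ∘ c) (s ∘ d) := by
  obtain ⟨g, hg, h⟩ := h
  refine ⟨s * g * s⁻¹, (Subgroup.mem_normalizer_iff.1 hs g).1 hg, fun i => ?_⟩
  simp [Equiv.Perm.mul_apply, ← h i]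

/-- The limit permutation `e` normalizes `G` because the `s x` do. Eventually `s x` and `e` induce
the same map on the finitely many orbits of `(m + m)`-tuples, and this determines the action on
prescribed cosets up to an inner automorphism. -/
theorem IsOligomorphic.exists_tendsto_conjContAut (hG : IsOligomorphic G) {X : Type}
    (u : Ultrafilter X) (s : X → Subgroup.normalizer (G : Set (Equiv.Perm ℕ))) :
    ∃ e : Subgroup.normalizer (G : Set (Equiv.Perm ℕ)),
      Filter.Tendsto (fun x => (QuotientGroup.mk (conjContAut (s x)) : Out G)) u
        (nhds (QuotientGroup.mk (conjContAut e))) := by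
  obtain ⟨e, he⟩ := hG.exists_perm_eventually_sameOrbit u s
  have heN : e ∈ Subgroup.normalizer (G : Set (Equiv.Perm ℕ)) := by
    rw [Subgroup.mem_normalizer_iff]
    intro g
    constructor
    · intro hg
      refine mem_of_forall_sameOrbit hG.1 fun n c => ?_
      obtain ⟨x, h1, h2⟩ := ((he n (e.symm ∘ c)).and (he n (g ∘ e.symm ∘ c))).exists
      have e1 : e ∘ e.symm ∘ c = c := by funext i; simp
      rw [e1] at h1
      have h3 : SameOrbit G (e.symm ∘ c) (g ∘ e.symm ∘ c) := ⟨g, hg, fun _ => rfl⟩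
      exact h1.symm.trans ((h3.comp_normalizer (s x).2).trans h2)
    · intro hg
      refine mem_of_forall_sameOrbit hG.1 fun n c => ?_
      obtain ⟨x, h1, h2⟩ := ((he n c).and (he n (g ∘ c))).exists
      have h3 : SameOrbit G (e ∘ c) (e ∘ g ∘ c) := ⟨_, hg, fun i => by simp⟩
      have h4 := ((h1.trans h3).trans h2.symm).comp_normalizer (inv_mem (s x).2)
      have e1 : ∀ c : Fin n → ℕ, ⇑(s x).1⁻¹ ∘ (s x).1 ∘ c = c := by
        intro c; funext i; exact (s x).1.symm_apply_apply _
      rwa [e1, e1] at h4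
  refine ⟨⟨e, heN⟩, fun U hU => ?_⟩
  have h1 : (QuotientGroup.mk : ContAut G → Out G) ⁻¹' U ∈ nhds (conjContAut ⟨e, heN⟩) :=
    QuotientGroup.continuous_mk.continuousAt.preimage_mem_nhds hU
  obtain ⟨F, hF, hF', H⟩ := exists_cosets_of_mem_nhds h1
  obtain ⟨m, hm⟩ := exists_fixing_of_finite hF hF'
  obtain ⟨R, hR, hR'⟩ := hG.exists_reps (m + m)
  have h2 : ∀ᶠ x in (u : Filter X), ∀ c ∈ R, SameOrbit G ((s x).1 ∘ c) (e ∘ c) :=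
    (Filter.eventually_all_finite hR).2 fun c _ => he _ c
  rw [Filter.mem_map]
  filter_upwards [h2, he m (fun i => i)] with x hx hx'
  have hall : ∀ c : Fin (m + m) → ℕ, SameOrbit G ((s x).1 ∘ c) (e ∘ c) := by
    intro c
    obtain ⟨d, hd, hcd⟩ := hR' c
    exact (hcd.comp_normalizer (s x).2).trans ((hx d hd).trans (hcd.symm.comp_normalizer heN))
  obtain ⟨g, hg, hgx⟩ := hx'
  have hgN : g ∈ Subgroup.normalizer (G : Set (Equiv.Perm ℕ)) := Subgroup.le_normalizer hg
  -- The factor `g` makes `g * s x` agree with `e` below `m`. The discrepancy `t` then fixes these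
  -- numbers and preserves orbits, so conjugation by it fixes every coset in `F`; `g` itself
  -- disappears in `Out G`.
  let t : Subgroup.normalizer (G : Set (Equiv.Perm ℕ)) := ⟨e, heN⟩⁻¹ * ⟨g, hgN⟩ * s x
  have ht : ∀ a < m, t.1 a = a := by
    intro a ha
    change e.symm (g ((s x).1 a)) = a
    rw [Equiv.symm_apply_eq]
    exact hgx ⟨a, ha⟩
  have ht' : PreservesOrbits G (m + m) t.1 := by
    intro c
    have h3 : SameOrbit G ((s x).1 ∘ c) (g ∘ (s x).1 ∘ c) := ⟨g, hg, fun _ => rfl⟩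
    have h4 := ((hall c).symm.trans h3).comp_normalizer (inv_mem heN)
    have e1 : ⇑e⁻¹ ∘ e ∘ c = c := by funext i; exact e.symm_apply_apply _
    rw [e1] at h4
    exact h4
  have e2 : ∀ A ∈ F, (conjContAut t).1 '' A = A := by
    intro A hA
    ext y
    obtain ⟨z, rfl⟩ := (conjContAut t).1.surjective y
    rw [(conjContAut t).1.injective.mem_set_image]
    exact mem_coset_iff_of_preservesOrbits (hm A hA) ht ht' fun a => conjContAut_apply t z a
  have e3 : conjContAut (⟨g, hgN⟩ * s x) ∈ (QuotientGroup.mk : ContAut G → Out G) ⁻¹' U := by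
    refine H _ fun A hA => ?_
    conv_rhs => rw [← e2 A hA]
    rw [← coe_mul_image, ← conjContAut_mul]
    congr 3
    simp [t, mul_assoc]
  have e4 : conjContAut ⟨g, hgN⟩ ∈ Inn G :=
    mem_inn_iff.2 ⟨⟨g, hg⟩, fun _ => rfl⟩
  have e5 : (QuotientGroup.mk (conjContAut (⟨g, hgN⟩ * s x)) : Out G) =
      QuotientGroup.mk (conjContAut (s x)) := by
    rw [conjContAut_mul, QuotientGroup.mk_mul, (QuotientGroup.eq_one_iff _).2 e4, one_mul]
  change (QuotientGroup.mk (conjContAut (s x)) : Out G) ∈ U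
  rw [← e5]
  exact e3

theorem isCompact_range_conjContAut (hG : IsOligomorphic G) :
    IsCompact (Set.range (fun s : Subgroup.normalizer (G : Set (Equiv.Perm ℕ)) =>
      (QuotientGroup.mk (conjContAut s) : Out G))) := by
  rw [isCompact_iff_ultrafilter_le_nhds]
  intro u hu
  have h1 : ∀ x : Out G, ∃ s : Subgroup.normalizer (G : Set (Equiv.Perm ℕ)),
      x ∈ Set.range (fun s : Subgroup.normalizer (G : Set (Equiv.Perm ℕ)) =>
        (QuotientGroup.mk (conjContAut s) : Out G)) → QuotientGroup.mk (conjContAut s) = x := by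
    intro x
    by_cases hx : x ∈ Set.range (fun s : Subgroup.normalizer (G : Set (Equiv.Perm ℕ)) =>
        (QuotientGroup.mk (conjContAut s) : Out G))
    · obtain ⟨s, hs⟩ := hx
      exact ⟨s, fun _ => hs⟩
    · exact ⟨1, fun hx' => absurd hx' hx⟩
  choose s hs using h1
  obtain ⟨e, he⟩ := hG.exists_tendsto_conjContAut u s
  refine ⟨_, ⟨e, rfl⟩, ?_⟩
  refine Filter.Tendsto.congr' (f₂ := id) ?_ he
  filter_upwards [Filter.le_principal_iff.1 hu] with x hx using hs x hx

theorem out_locallyCompactSpace (hG : IsOligomorphic G) : LocallyCompactSpace (Out G) :=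
  (isCompact_range_conjContAut hG).locallyCompactSpace_of_mem_nhds_of_group
    (range_conjContAut_mem_nhds hG)

/-- Closedness of `Inn G` makes the quotient Hausdorff, and a Hausdorff nonarchimedean group is
totally disconnected. -/
theorem out_totallyDisconnectedSpace (hG : IsOligomorphic G) :
    TotallyDisconnectedSpace (Out G) := by
  have := isClosed_inn hG
  infer_instance

end Out

/-! ## The topology on interpretations -/

section InterpTopology

variable {L : FirstOrder.Language.{0, 0}} [L.IsRelational] [L.Structure ℕ]
variable {α β γ : Interpretation (L.completeTheory ℕ) (L.completeTheory ℕ)}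

theorem sameSort_iff : Interpretation.SameSort α β ↔ ∃ h : α.dim = β.dim,
    (∀ v : Fin β.dim → ℕ, α.dom.Realize (v ∘ Fin.cast h) ↔ β.dom.Realize v) ∧
    ∀ v w : Fin β.dim → ℕ, α.eqv.Realize (Sum.elim (v ∘ Fin.cast h) (w ∘ Fin.cast h)) ↔
      β.eqv.Realize (Sum.elim v w) := by
  refine exists_congr fun h => and_congr ?_ ?_
  · rw [theory_iff_iff]
    simp only [Formula.realize_relabel]
  · rw [theory_iff_iff]
    simp only [Formula.realize_relabel]
    constructor
    · intro H v w
      rw [← H, Sum.elim_comp_map]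
    · intro H v
      rw [← Sum.elim_comp_inl_inr v, Sum.elim_comp_map]
      exact H _ _

theorem sameRel_iff {n : ℕ} {R : L.Relations n} : Interpretation.SameRel α β R ↔
    ∃ h : α.dim = β.dim, ∀ v : Fin n × Fin β.dim → ℕ,
      (α.rel R).Realize (v ∘ Prod.map id (Fin.cast h)) ↔ (β.rel R).Realize v := by
  refine exists_congr fun h => ?_
  rw [theory_iff_iff]
  simp only [Formula.realize_relabel]

theorem SameSort.trans (h : Interpretation.SameSort α β) (h' : Interpretation.SameSort β γ) :
    Interpretation.SameSort α γ := by
  obtain ⟨e, h1, h2⟩ := sameSort_iff.1 h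
  obtain ⟨e', h3, h4⟩ := sameSort_iff.1 h'
  exact sameSort_iff.2 ⟨e.trans e', fun v => (h1 _).trans (h3 v),
    fun v w => (h2 _ _).trans (h4 v w)⟩

theorem SameRel.trans {n : ℕ} {R : L.Relations n} (h : Interpretation.SameRel α β R)
    (h' : Interpretation.SameRel β γ R) : Interpretation.SameRel α γ R := by
  obtain ⟨e, h1⟩ := sameRel_iff.1 h
  obtain ⟨e', h3⟩ := sameRel_iff.1 h'
  exact sameRel_iff.2 ⟨e.trans e', fun v => (h1 _).trans (h3 v)⟩

theorem eventually_sameSort (α : Interpretation (L.completeTheory ℕ) (L.completeTheory ℕ)) :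
    ∀ᶠ β in nhds α, Interpretation.SameSort α β := by
  refine (TopologicalSpace.isOpen_generateFrom_of_mem (Or.inl ⟨α, rfl⟩) :
    IsOpen {β | Interpretation.SameSort α β}).mem_nhds ?_
  exact sameSort_iff.2 ⟨rfl, fun _ => Iff.rfl, fun _ _ => Iff.rfl⟩

theorem eventually_sameRel (α : Interpretation (L.completeTheory ℕ) (L.completeTheory ℕ))
    {n : ℕ} (R : L.Relations n) : ∀ᶠ β in nhds α, Interpretation.SameRel α β R := by
  refine (TopologicalSpace.isOpen_generateFrom_of_mem (Or.inr ⟨α, n, R, rfl⟩) :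
    IsOpen {β | Interpretation.SameRel α β R}).mem_nhds ?_
  exact sameRel_iff.2 ⟨rfl, fun _ => Iff.rfl⟩

/-- The two kinds of generators compose transitively with agreement, so near `α` finitely many
relation symbols, together with the sort, control membership. -/
theorem exists_relations_of_mem_nhds
    {U : Set (Interpretation (L.completeTheory ℕ) (L.completeTheory ℕ))} (hU : U ∈ nhds α) :
    ∃ S : Set (Σ n : ℕ, L.Relations n), S.Finite ∧
      ∀ β, Interpretation.SameSort α β → (∀ R ∈ S, Interpretation.SameRel α β R.2) → β ∈ U := by
  obtain ⟨V, hVU, hV, hα⟩ := mem_nhds_iff.1 hU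
  suffices H : ∃ S : Set (Σ n : ℕ, L.Relations n), S.Finite ∧
      ∀ β, Interpretation.SameSort α β → (∀ R ∈ S, Interpretation.SameRel α β R.2) → β ∈ V by
    obtain ⟨S, h1, h2⟩ := H
    exact ⟨S, h1, fun β h h' => hVU (h2 β h h')⟩
  clear hU hVU
  induction hV with
  | basic W hW =>
    rcases hW with ⟨γ, rfl⟩ | ⟨γ, n, R, rfl⟩
    · exact ⟨∅, Set.finite_empty, fun β h _ => SameSort.trans hα h⟩
    · exact ⟨{⟨n, R⟩}, Set.finite_singleton _, fun β _ h => SameRel.trans hα (h ⟨n, R⟩ rfl)⟩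
  | univ => exact ⟨∅, Set.finite_empty, fun _ _ _ => trivial⟩
  | inter V W _ _ ih1 ih2 =>
    obtain ⟨S1, h1, h2⟩ := ih1 hα.1
    obtain ⟨S2, h3, h4⟩ := ih2 hα.2
    exact ⟨S1 ∪ S2, h1.union h3, fun β h h' =>
      ⟨h2 β h fun R hR => h' R (Or.inl hR), h4 β h fun R hR => h' R (Or.inr hR)⟩⟩
  | sUnion C _ ih =>
    obtain ⟨W, hW, hαW⟩ := hα
    obtain ⟨S, h1, h2⟩ := ih W hW hαW
    exact ⟨S, h1, fun β h h' => ⟨W, hW, h2 β h h'⟩⟩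

/-- Coordinate maps with the same domain and the same kernel differ by a permutation. -/
theorem exists_perm_of_sameSort {r : (Fin α.dim → ℕ) → ℕ → Prop}
    {s : (Fin β.dim → ℕ) → ℕ → Prop} (hr : α.IsCoord ℕ ℕ r) (hs : β.IsCoord ℕ ℕ s)
    (e : α.dim = β.dim)
    (hdom : ∀ v : Fin β.dim → ℕ, α.dom.Realize (v ∘ Fin.cast e) ↔ β.dom.Realize v)
    (heqv : ∀ v w : Fin β.dim → ℕ, α.eqv.Realize (Sum.elim (v ∘ Fin.cast e) (w ∘ Fin.cast e)) ↔
      β.eqv.Realize (Sum.elim v w)) :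
    ∃ p : Equiv.Perm ℕ, ∀ v a, r (v ∘ Fin.cast e) a ↔ s v (p a) := by
  -- Forgetting the relation symbols leaves only the domain and the kernel, so the comparison of
  -- coordinate maps over the empty language yields a bare permutation.
  let : Language.empty.Structure ℕ := Language.emptyStructure
  let δ : PreInterp L Language.empty :=
    ⟨β.dim, β.one_le_dim, β.dom, β.eqv, fun R => isEmptyElim R⟩
  have h1 : δ.IsCoord ℕ ℕ (fun v a => r (v ∘ Fin.cast e) a) :=
    ⟨fun v => hr.func _, fun a => by
      obtain ⟨x, hx⟩ := hr.surj a
      exact ⟨x ∘ Fin.cast e.symm, hx⟩, fun v => (hdom v).symm.trans (hr.dom_iff _),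
      fun v w => (heqv v w).symm.trans (hr.eqv_iff _ _), fun R => isEmptyElim R⟩
  have h2 : δ.IsCoord ℕ ℕ s :=
    ⟨hs.func, hs.surj, hs.dom_iff, hs.eqv_iff, fun R => isEmptyElim R⟩
  obtain ⟨p, hp⟩ := Interpretation.exists_equiv h1 h2
  exact ⟨p.toEquiv, hp⟩

/-- The map induced by an interpretation depends continuously on the interpretation. -/
theorem Represents.eventually_exists (hG : IsOligomorphic (autGroup L))
    {Φ : autGroup L → autGroup L} (hα : Represents α Φ) {F : Set (Set (autGroup L))}
    (hF : F.Finite) (hF' : ∀ A ∈ F, IsOpenCoset A) :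
    ∀ᶠ β in nhds α, ∃ Ψ, Represents β Ψ ∧ ∀ A ∈ F, ∀ g, Φ g ∈ A ↔ Ψ g ∈ A := by
  obtain ⟨r, hr, hΦ⟩ := hα
  obtain ⟨m, hm⟩ := exists_fixing_of_finite hF hF'
  obtain ⟨S, hS, hS'⟩ := exists_finite_preservesOrbits hG (m + m)
  filter_upwards [eventually_sameSort α,
    (Filter.eventually_all_finite hS).2 fun R _ => eventually_sameRel α R.2] with β h1 h2
  obtain ⟨s, hs⟩ := exists_isCoord_nat hG β
  obtain ⟨e, hdom, heqv⟩ := sameSort_iff.1 h1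
  obtain ⟨p, hp⟩ := exists_perm_of_sameSort hr hs e hdom heqv
  have hsurj : ∀ a, ∃ v : Fin β.dim → ℕ, r (v ∘ Fin.cast e) a := by
    intro a
    obtain ⟨x, hx⟩ := hr.surj a
    exact ⟨x ∘ Fin.cast e.symm, hx⟩
  -- Agreement of the formulas for the symbols in `S` says that `p` respects these relations, and
  -- `S` was chosen to define all orbits of this length.
  have hpres : PreservesOrbits (autGroup L) (m + m) p := by
    refine hS' p fun R hR a => ?_
    obtain ⟨e', hrel⟩ := sameRel_iff.1 (h2 R hR)
    choose v hv using fun i => hsurj (a i)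
    rw [← hr.rel_iff' R.2 (x := (fun q : Fin R.1 × Fin β.dim => v q.1 q.2) ∘
      Prod.map id (Fin.cast e)) (a := a) hv, hrel,
      hs.rel_iff' R.2 (a := p ∘ a) fun i => (hp _ _).1 (hv i)]
  -- The tuple is doubled only to reach length `m + m`. The element `g` agrees with `p` below `m`,
  -- and correcting the coordinate map by `g⁻¹` yields a permutation fixing these numbers.
  obtain ⟨g, hg, hgp⟩ := hpres (Fin.append (fun i : Fin m => (i : ℕ)) (fun i : Fin m => (i : ℕ)))
  obtain ⟨f, hf⟩ := hg
  have hs'' := hs.congr f.symm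
  obtain ⟨Ψ, hΨ⟩ := hs''.exists_equivariant
  refine ⟨Ψ, ⟨_, hs'', hΨ⟩, fun A hA k => ?_⟩
  have hfg : ∀ x, f.symm x = g⁻¹ x := by
    intro x
    apply f.injective
    rw [FirstOrder.Language.Equiv.apply_symm_apply, hf]
    exact (g.apply_symm_apply x).symm
  refine mem_coset_iff_of_preservesOrbits (hm A hA) (s := g⁻¹ * p) ?_ ?_ ?_
  · intro a ha
    have := hgp (Fin.castAdd m ⟨a, ha⟩)
    simp only [Function.comp_apply, Fin.append_left] at this
    change g⁻¹ (p a) = a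
    rw [← this]
    exact g.symm_apply_apply a
  · intro c
    exact (hpres c).trans ⟨g⁻¹, inv_mem ⟨f, hf⟩, fun i => rfl⟩
  · intro a
    obtain ⟨v, hv⟩ := hsurj a
    have e1 := hΨ k v ((g⁻¹ * p) a) ⟨p a, (hp _ _).1 hv, hfg _⟩
    refine hs''.func _ _ _ e1 ⟨p ((Φ k).1 a), (hp _ _).1 ?_, hfg _⟩
    exact hΦ k _ _ hv

/-- The interpretation inducing an automorphism can be chosen to depend continuously on the
automorphism. -/
theorem Represents.eventually_exists_mem (hG : IsOligomorphic (autGroup L))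
    {Φ : ContAut (autGroup L)} (hα : Represents α Φ.1)
    {U : Set (Interpretation (L.completeTheory ℕ) (L.completeTheory ℕ))} (hU : U ∈ nhds α) :
    ∀ᶠ Ψ : ContAut (autGroup L) in nhds Φ, ∃ β ∈ U, Represents β Ψ.1 := by
  obtain ⟨r, hr, hΦ⟩ := hα
  obtain ⟨S, hS, hS'⟩ := exists_relations_of_mem_nhds hU
  choose N hN using hG.exists_bound
  obtain ⟨M, hM⟩ := (hS.image fun R => N R.1).bddAbove
  -- The summand `N 1` makes the comparison permutation exist; `M` bounds representatives of the
  -- orbits for all arities occurring in `S`.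
  filter_upwards [eventually_apply_eq_iff Φ (N 1 + M)] with Ψ hΨ
  obtain ⟨s, hs, hs'⟩ := exists_perm_of_apply_eq_iff (N := N 1 + M) (Φ := Φ.1) (Ψ := Ψ.1)
    (fun c => by
      obtain ⟨d, hcd, hd⟩ := hN 1 c
      exact ⟨d, hcd, fun i => (hd i).trans_le (Nat.le_add_right _ _)⟩) hΨ
  have hpres : ∀ R ∈ S, PreservesOrbits (autGroup L) R.1 s := by
    intro R hR
    refine preservesOrbits_of_apply_eq (N := N 1 + M) (fun c => ?_) hs hs'
    obtain ⟨d, hcd, hd⟩ := hN R.1 c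
    exact ⟨d, hcd, fun i => (hd i).trans_le
      ((hM ⟨R, hR, rfl⟩).trans (Nat.le_add_left _ _))⟩
  have hrel : ∀ R ∈ S, ∀ a : Fin R.1 → ℕ,
      Structure.RelMap R.2 (s ∘ a) ↔ Structure.RelMap R.2 a := by
    intro R hR a
    obtain ⟨g, hg, hga⟩ := hpres R hR a
    rw [show s ∘ a = g ∘ a from (funext hga).symm, relMap_comp_of_mem_autGroup hg]
  -- Composing with `s` leaves the domain and the kernel of `r` unchanged, and also the formulas for
  -- the relations that `s` preserves.
  have hequi : IsEquivariantCoord (autGroup L) (fun x a => r x (s.symm a)) Ψ.1 := by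
    refine ⟨fun x a b ha hb => s.symm.injective (hr.func _ _ _ ha hb), fun a => hr.surj _,
      fun g x a ha => ?_⟩
    have := hΦ g _ _ ha
    have e : s.symm ((Ψ.1 g).1 a) = (Φ.1 g).1 (s.symm a) := by
      rw [Equiv.symm_apply_eq, hs, Equiv.apply_symm_apply]
    rwa [e]
  obtain ⟨dom, eqv, rel, H⟩ := hequi.exists_isCoord hG α.one_le_dim
  refine ⟨⟨_, H.isInterp⟩, hS' _ ?_ ?_, _, H, hequi.equivariant⟩
  · refine sameSort_iff.2 ⟨rfl, fun v => ?_, fun v w => ?_⟩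
    · refine (hr.dom_iff _).trans (Iff.trans ?_ (H.dom_iff _).symm)
      exact ⟨fun ⟨a, ha⟩ => ⟨s a, by rwa [Equiv.symm_apply_apply]⟩, fun ⟨a, ha⟩ => ⟨_, ha⟩⟩
    · refine (hr.eqv_iff _ _).trans (Iff.trans ?_ (H.eqv_iff _ _).symm)
      exact ⟨fun ⟨a, ha⟩ => ⟨s a, by rwa [Equiv.symm_apply_apply]⟩, fun ⟨a, ha⟩ => ⟨_, ha⟩⟩
  · intro R hR
    refine sameRel_iff.2 ⟨rfl, fun v => ?_⟩
    refine (hr.rel_iff _ _).trans (Iff.trans ?_ (H.rel_iff _ _).symm)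
    constructor
    · rintro ⟨a, h1, h2⟩
      refine ⟨s ∘ a, fun i => ?_, (hrel R hR a).2 h2⟩
      rw [Function.comp_apply, Equiv.symm_apply_apply]
      exact h1 i
    · rintro ⟨a, h1, h2⟩
      refine ⟨s.symm ∘ a, h1, (hrel R hR _).1 ?_⟩
      rwa [← Function.comp_assoc, Equiv.self_comp_symm]

end InterpTopology

/-! ## The isomorphism between `B(T)` and `Out(G)` -/

section Iso

variable {L : FirstOrder.Language.{0, 0}} [L.IsRelational] [L.Structure ℕ]
variable {α β : Interpretation (L.completeTheory ℕ) (L.completeTheory ℕ)}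

/-- The homotopy class of a self-interpretation. -/
def Mor.mk (α : Interpretation (L.completeTheory ℕ) (L.completeTheory ℕ)) :
    Mor (L.completeTheory ℕ) (L.completeTheory ℕ) :=
  Quotient.mk _ α

theorem Mor.mk_eq_iff : Mor.mk α = Mor.mk β ↔ Interpretation.Homotopic α β :=
  Quotient.eq (r := Interpretation.homotopySetoid _ _)

theorem Mor.mk_comp : Mor.mk (β.comp α) = Mor.mk β * Mor.mk α := rfl

theorem Mor.mk_one : Mor.mk (Interpretation.one (L.completeTheory ℕ)) = 1 := rfl

theorem Mor.exists_mk (p : Mor (L.completeTheory ℕ) (L.completeTheory ℕ)) :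
    ∃ α, Mor.mk α = p :=
  Quotient.exists_rep p

theorem Represents.eq_one_of_mk (h : Mor.mk α = 1) {Φ : autGroup L → autGroup L}
    (hΦ : Represents α Φ) : ∃ e : autGroup L, ∀ g, Φ g = e * g * e⁻¹ := by
  rw [← Mor.mk_one, Mor.mk_eq_iff] at h
  exact represents_one.exists_conj (hΦ.of_homotopic h)

/-- An invertible interpretation induces an automorphism of the topological group `G`. -/
theorem Represents.exists_contAut {Φ Φ' : autGroup L → autGroup L}
    (h : Represents α Φ) (h' : Represents β Φ') (h1 : Mor.mk α * Mor.mk β = 1)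
    (h2 : Mor.mk β * Mor.mk α = 1) :
    ∃ Ψ : ContAut (autGroup L), Represents α Ψ.1 := by
  obtain ⟨e, he⟩ := (h'.comp h).eq_one_of_mk h1
  obtain ⟨e', he'⟩ := (h.comp h').eq_one_of_mk h2
  -- `Φ ∘ Φ'` is conjugation by `e`, so undoing it first gives a right inverse of `Φ`; the other
  -- product gives injectivity.
  have hinv : ∀ g, Φ (Φ' (e⁻¹ * g * e)) = g := by
    intro g
    refine (he _).trans ?_
    group
  have hinj : Function.Injective Φ := by
    intro g k hgk
    have h3 : e' * g * e'⁻¹ = e' * k * e'⁻¹ := by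
      rw [← he', ← he', Function.comp_apply, Function.comp_apply, hgk]
    simpa using h3
  refine ⟨⟨⟨⟨Φ, fun g => Φ' (e⁻¹ * g * e), fun g => hinj (hinv _), hinv⟩, h.map_mul⟩,
    h.continuous, ?_⟩, h⟩
  change Continuous fun g => Φ' (e⁻¹ * g * e)
  exact h'.continuous.comp (by fun_prop)

theorem exists_contAut_of_unit (hG : IsOligomorphic (autGroup L))
    (u : BGroup (L.completeTheory ℕ)) :
    ∃ (Ψ : ContAut (autGroup L)) (α : _), Mor.mk α = u.val ∧ Represents α Ψ.1 := by
  obtain ⟨α, hα⟩ := Mor.exists_mk u.val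
  obtain ⟨β, hβ⟩ := Mor.exists_mk u⁻¹.val
  obtain ⟨Φ, hΦ⟩ := exists_represents hG α
  obtain ⟨Φ', hΦ'⟩ := exists_represents hG β
  obtain ⟨Ψ, hΨ⟩ := hΦ.exists_contAut hΦ' (by rw [hα, hβ, Units.mul_inv])
    (by rw [hα, hβ, Units.inv_mul])
  exact ⟨Ψ, α, hα, hΨ⟩

/-- The outer automorphism of `G` induced by an element of `B(T)`. -/
noncomputable def toOut (hG : IsOligomorphic (autGroup L)) (u : BGroup (L.completeTheory ℕ)) :
    Out (autGroup L) :=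
  QuotientGroup.mk (exists_contAut_of_unit hG u).choose

/-- Another representative of the class induces a conjugate automorphism, so any representative and
any induced automorphism may be used to compute `toOut`. -/
theorem toOut_eq (hG : IsOligomorphic (autGroup L)) {u : BGroup (L.completeTheory ℕ)}
    {Ψ : ContAut (autGroup L)} (hα : Mor.mk α = u.val) (hΨ : Represents α Ψ.1) :
    toOut hG u = QuotientGroup.mk Ψ := by
  obtain ⟨β, hβ, hΨ'⟩ := (exists_contAut_of_unit hG u).choose_spec
  rw [toOut]
  set Ψ' := (exists_contAut_of_unit hG u).choose
  obtain ⟨e, he⟩ := (hΨ'.of_homotopic (Mor.mk_eq_iff.1 (hβ.trans hα.symm))).exists_conj hΨ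
  refine QuotientGroup.eq.2 (mem_inn_iff.2 ⟨Ψ'.1.symm e, fun g => ?_⟩)
  apply Ψ'.1.injective
  refine (Ψ'.1.apply_symm_apply (Ψ.1 g)).trans ?_
  rw [map_mul, map_mul, map_inv, MulEquiv.apply_symm_apply, he]

/-- An interpretation inducing `Φ⁻¹` is an inverse up to homotopy, since both composites induce the
identity map. -/
theorem exists_unit (hG : IsOligomorphic (autGroup L)) {Φ : ContAut (autGroup L)}
    (hΦ : Represents α Φ.1) : ∃ u : BGroup (L.completeTheory ℕ), Mor.mk α = u.val := by
  obtain ⟨β, hβ⟩ := exists_represents_contAut hG Φ⁻¹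
  have h1 := hΦ.comp hβ
  have h2 := hβ.comp hΦ
  rw [show ((Φ⁻¹).1 : autGroup L → autGroup L) ∘ Φ.1 = id from
    funext fun g => Φ.1.symm_apply_apply g] at h1
  rw [show (Φ.1 : autGroup L → autGroup L) ∘ (Φ⁻¹).1 = id from
    funext fun g => Φ.1.apply_symm_apply g] at h2
  exact ⟨⟨Mor.mk α, Mor.mk β, Mor.mk_eq_iff.2 (h2.homotopic hG represents_one),
    Mor.mk_eq_iff.2 (h1.homotopic hG represents_one)⟩, rfl⟩

/-- `toOut` as a homomorphism. -/
noncomputable def toOutHom (hG : IsOligomorphic (autGroup L)) :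
    BGroup (L.completeTheory ℕ) →* Out (autGroup L) :=
  MonoidHom.mk' (toOut hG) fun u v => by
    obtain ⟨Φ, α, hα, hΦ⟩ := exists_contAut_of_unit hG u
    obtain ⟨Ψ, β, hβ, hΨ⟩ := exists_contAut_of_unit hG v
    rw [toOut_eq hG hα hΦ, toOut_eq hG hβ hΨ, ← QuotientGroup.mk_mul]
    refine toOut_eq hG (α := α.comp β) ?_ (hΨ.comp hΦ)
    rw [Mor.mk_comp, hα, hβ, Units.val_mul]

theorem toOutHom_bijective (hG : IsOligomorphic (autGroup L)) :
    Function.Bijective (toOutHom hG) := by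
  constructor
  · rw [injective_iff_map_eq_one]
    intro u hu
    obtain ⟨Φ, α, hα, hΦ⟩ := exists_contAut_of_unit hG u
    have h1 : (QuotientGroup.mk Φ : Out (autGroup L)) = 1 := (toOut_eq hG hα hΦ).symm.trans hu
    obtain ⟨e, he⟩ := mem_inn_iff.1 ((QuotientGroup.eq_one_iff Φ).1 h1)
    -- An inner automorphism can be absorbed into the coordinate map, so `α` also induces the
    -- identity and is homotopic to `1`.
    have h2 := hΦ.conj e⁻¹
    rw [show (fun g => e⁻¹ * Φ.1 g * e⁻¹⁻¹) = id from funext fun g => by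
      rw [he, id]; group] at h2
    apply Units.ext
    rw [← hα, Units.val_one, ← Mor.mk_one]
    exact Mor.mk_eq_iff.2 (h2.homotopic hG represents_one)
  · intro q
    obtain ⟨Φ, rfl⟩ := QuotientGroup.mk_surjective q
    obtain ⟨α, hα⟩ := exists_represents_contAut hG Φ
    obtain ⟨u, hu⟩ := exists_unit hG hα
    exact ⟨u, toOut_eq hG hu hα⟩

theorem continuous_toOut (hG : IsOligomorphic (autGroup L)) : Continuous (toOut hG) := by
  refine continuous_iff_continuousAt.2 fun u W hW => ?_
  obtain ⟨Φ, α, hα, hΦ⟩ := exists_contAut_of_unit hG u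
  rw [toOut_eq hG hα hΦ] at hW
  have h1 : (QuotientGroup.mk : ContAut (autGroup L) → Out (autGroup L)) ⁻¹' W ∈ nhds Φ :=
    QuotientGroup.continuous_mk.continuousAt.preimage_mem_nhds hW
  obtain ⟨F, hF, hF', H⟩ := exists_cosets_of_mem_nhds h1
  -- `V` is defined on all of `Mor`, with `Ψ` an arbitrary induced map, so that its openness can be
  -- checked on interpretations without invertibility.
  let V : Set (Mor (L.completeTheory ℕ) (L.completeTheory ℕ)) := {p | ∃ β Ψ, Mor.mk β = p ∧
    Represents β Ψ ∧ ∀ A ∈ F, ∀ g, Ψ g ∈ Φ.1 '' A ↔ g ∈ A}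
  have hV : IsOpen V := by
    change IsOpen (Mor.mk ⁻¹' V)
    refine isOpen_iff_mem_nhds.2 ?_
    rintro γ ⟨β, Ψ, hβ, hΨ, hA⟩
    have h2 := (hΨ.of_homotopic (Mor.mk_eq_iff.1 hβ)).eventually_exists hG
      (hF.image fun A => Φ.1 '' A) (by
        rintro _ ⟨A, hA, rfl⟩
        exact (hF' A hA).image Φ)
    filter_upwards [h2] with δ ⟨Ψ', hΨ', hA'⟩
    exact ⟨δ, Ψ', rfl, hΨ', fun A hAF g =>
      (hA' _ ⟨A, hAF, rfl⟩ g).symm.trans (hA A hAF g)⟩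
  have huV : u.val ∈ V := ⟨α, Φ.1, hα, hΦ, fun A _ g => Φ.1.injective.mem_set_image⟩
  rw [Filter.mem_map]
  filter_upwards [(hV.preimage Units.continuous_val).mem_nhds huV] with v ⟨β, Ψ, hβ, hΨ, hA⟩
  obtain ⟨Ψ₀, β₀, hβ₀, hΨ₀⟩ := exists_contAut_of_unit hG v
  obtain ⟨e, he⟩ := (hΨ₀.of_homotopic (Mor.mk_eq_iff.1 (hβ₀.trans hβ.symm))).exists_conj hΨ
  have hconj : MulAut.conj e ∈ ContAut (autGroup L) := by
    constructor
    · change Continuous fun g => e * g * e⁻¹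
      fun_prop
    · change Continuous fun g => e⁻¹ * g * e
      fun_prop
  -- The map `Ψ` witnessing `V` is a conjugate of a topological automorphism, hence one itself, and
  -- it computes `toOut hG v`.
  have hrep : Represents β ((⟨MulAut.conj e, hconj⟩ : ContAut (autGroup L)) * Ψ₀).1 := by
    rwa [show (((⟨MulAut.conj e, hconj⟩ : ContAut (autGroup L)) * Ψ₀).1 :
      autGroup L → autGroup L) = Ψ from funext fun g => (he g).symm]
  change toOut hG v ∈ W
  rw [toOut_eq hG hβ hrep]
  refine H _ fun A hAF => ?_
  ext y
  obtain ⟨z, rfl⟩ := ((⟨MulAut.conj e, hconj⟩ : ContAut (autGroup L)) * Ψ₀).1.surjective y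
  rw [MulEquiv.injective _ |>.mem_set_image, ← hA A hAF z, he z]
  rfl

/-- Along the quotient map, continuity into `Mor` follows by choosing interpretations that depend
continuously on the automorphism. The second coordinate in the topology of the unit group comes for
free, since inversion on `Out G` is continuous. -/
theorem continuous_toOutHom_symm (hG : IsOligomorphic (autGroup L)) :
    Continuous (MulEquiv.ofBijective (toOutHom hG) (toOutHom_bijective hG)).symm := by
  let f := MulEquiv.ofBijective (toOutHom hG) (toOutHom_bijective hG)
  have hval : Continuous fun q : Out (autGroup L) => (f.symm q).val := by
    refine QuotientGroup.isOpenQuotientMap_mk.isQuotientMap.continuous_iff.2 ?_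
    refine continuous_iff_continuousAt.2 fun Φ W hW => ?_
    obtain ⟨α, hα⟩ := exists_represents_contAut hG Φ
    have key : ∀ (Ψ : ContAut (autGroup L)) (β : _), Represents β Ψ.1 →
        (f.symm (QuotientGroup.mk Ψ)).val = Mor.mk β := by
      intro Ψ β hβ
      obtain ⟨u, hu⟩ := exists_unit hG hβ
      rw [hu]
      congr 1
      rw [MulEquiv.symm_apply_eq]
      exact (toOut_eq hG hu hβ).symm
    have hW' : W ∈ nhds (Mor.mk α) := by
      rw [← key Φ α hα]
      exact hW
    have h1 : Mor.mk ⁻¹' W ∈ nhds α :=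
      (continuous_quotient_mk' : Continuous (Quotient.mk
        (Interpretation.homotopySetoid _ _))).continuousAt.preimage_mem_nhds hW'
    rw [Filter.mem_map]
    filter_upwards [hα.eventually_exists_mem hG h1] with Ψ ⟨β, hβ, hΨ⟩
    change (f.symm (QuotientGroup.mk Ψ)).val ∈ W
    rw [key Ψ β hΨ]
    exact hβ
  refine Units.continuous_iff.2 ⟨hval, ?_⟩
  have : (fun q : Out (autGroup L) => (f.symm q)⁻¹.val) = (fun q => (f.symm q).val) ∘ Inv.inv := by
    funext q
    rw [Function.comp_apply, map_inv]
  rw [this]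
  exact hval.comp continuous_inv

/-- `B(T)` and `Out(G)` are isomorphic as topological groups. -/
noncomputable def bGroupEquivOut (hG : IsOligomorphic (autGroup L)) :
    BGroup (L.completeTheory ℕ) ≃ₜ* Out (autGroup L) where
  toMulEquiv := MulEquiv.ofBijective (toOutHom hG) (toOutHom_bijective hG)
  continuous_toFun := continuous_toOut hG
  continuous_invFun := continuous_toOutHom_symm hG

end Iso

end OligoOut

/-! ### Transfer of the topological properties from `Out(G)` to `B(T)` -/

theorem theorem1p3 (L : FirstOrder.Language.{0, 0}) [L.IsRelational]
    [Countable (Σ n : ℕ, L.Relations n)] [L.Structure ℕ]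
    (G : Subgroup (Equiv.Perm ℕ)) (hG : OligoOut.IsOligomorphic G)
    (hGM : G = OligoOut.autGroup L)
    (T : L.Theory) (hT : T = L.completeTheory ℕ) :
    IsTopologicalGroup (OligoOut.BGroup T) ∧
    TotallyDisconnectedSpace (OligoOut.BGroup T) ∧
    LocallyCompactSpace (OligoOut.BGroup T) ∧
    Nonempty (OligoOut.BGroup T ≃ₜ* OligoOut.Out G) ∧
    IsTopologicalGroup (OligoOut.Out G) ∧
    TotallyDisconnectedSpace (OligoOut.Out G) ∧
    LocallyCompactSpace (OligoOut.Out G) := by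
  subst hGM hT
  let e := OligoOut.bGroupEquivOut hG
  have h1 := OligoOut.out_totallyDisconnectedSpace hG
  have h2 := OligoOut.out_locallyCompactSpace hG
  exact ⟨Topology.IsInducing.topologicalGroup e e.toHomeomorph.isInducing,
    e.toHomeomorph.isEmbedding.isTotallyDisconnected_range.1
      (isTotallyDisconnected_of_totallyDisconnectedSpace _),
    e.toHomeomorph.isClosedEmbedding.locallyCompactSpace, ⟨e⟩, inferInstance, h1, h2⟩
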